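/- Let $d\in\mathbb N$, $1\le p,q<\infty$, $s\in\mathbb R$, and let $p',q'\in(1,\infty]$ be the conjugate exponents. Fix a window $0\ne g\in\mathcal S(\mathbb R^d)$ and put $V_gf(x,\xi)=\int_{\mathbb R^d} f(y)\,\overline{g(y-x)}\,e^{-iy\cdot\xi}\,dy$ (in the sense of distributions) for $f\in\mathcal S'(\mathbb R^d)$, and $v_s(x,\xi)=(1+|x|^2+|\xi|^2)^{s/2}$. For $1\le p,q\le\infty$ and $s\in\mathbb R$ let $\mathcal M_s^{p,q}(\mathbb R^d)$ be the space of those $f\in\mathcal S'(\mathbb R^d)$ with $$\|f\|_{\mathcal M_s^{p,q}}=\Big(\int_{\mathbb R^d}\Big(\int_{\mathbb R^d}|V_gf(x,\xi)|^p\,v_s(x,\xi)^p\,dx\Big)^{q/p}d\xi\Big)^{1/q}<\infty$$ (with essential suprema if $p$ or $q$ is $\infty$). Let $A=-\Delta+|x|^2$ on $\mathbb R^d$, let $\phi_\alpha(x)=\prod_{i=1}^d(2^{\alpha_i}\alpha_i!\sqrt\pi)^{-1/2}H_{\alpha_i}(x_i)e^{-x_i^2/2}$, $\alpha\in\mathbb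 N_0^d$, be the $L^2$-normalised Hermite functions ($H_n$ being the physicists' Hermite polynomials), so that $A\phi_\alpha=\lambda_\alpha\phi_\alpha$ with $\lambda_\alpha=\sum_{i=1}^d(2\alpha_i+1)$, and let $F:\mathbb R\to\mathbb C$ be any function. By $F(A)$ on $\mathcal M_s^{p,q}(\mathbb R^d)$ we mean the bounded operator that satisfies $F(A)u=F(\lambda)u$ for every $u\in\mathcal M_s^{p,q}(\mathbb R^d)$ and $\lambda\in\mathbb R$ with $Au=\lambda u$ in $\mathcal S'(\mathbb R^d)$; in particular $F(A)\phi_\alpha=F(\lambda_\alpha)\phi_\alpha$ for all $\alpha$. For $0<r\le1$ a bounded operator $T$ on a Banach space $B$ is called $r$-nuclear if there are $x_n'\in B'$ and $y_n\in B$ with $\sum_n\|x_n'\|^r\|y_n\|^r<\infty$ and $Tx=\sum_n\langle x,x_n'\rangle y_n$ for all $x\in B$. A $1$-nuclear $T$ has the trace $\operatorname{Tr}T=\sum_n\langle y_n,x_n'\rangle$ if this value is the same for all representations of $T$ of that kind with $r=1$. (i) Let $0<r\le1$ and suppose that $$\sum_{\alpha\in\mathbb N_0^d}|F(\lambda_\alpha)|^r\,\|\phi_\alpha\|^r_{\mathcal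 M_s^{p,q}}\,\|\phi_\alpha\|^r_{\mathcal M_{-s}^{p',q'}}<\infty.\qquad(*)$$ Then there is exactly one bounded operator $F(A)$ on $\mathcal M_s^{p,q}(\mathbb R^d)$ as above, and it is $r$-nuclear. (ii) If $(*)$ holds with $r=1$, then the trace of $F(A)$ on $\mathcal M_s^{p,q}(\mathbb R^d)$ is well defined, the series $\sum_\alpha F(\lambda_\alpha)$ converges absolutely, and $$\operatorname{Tr}F(-\Delta+|x|^2)=\sum_{\alpha\in\mathbb N_0^d}F(\lambda_\alpha).$$ -/

import Mathlib

open scoped SchwartzMap ENNReal Topology ContDiff Nat InnerProductSpace Laplacian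
open MeasureTheory

noncomputable section

namespace HarmonicModulation

/-- The Euclidean space `ℝ^d`. -/
abbrev Rn (d : ℕ) : Type := EuclideanSpace ℝ (Fin d)

variable {d : ℕ}

/-! ### The short-time Fourier transform -/

/-- The unimodular exponential `y ↦ exp (-i y · ξ)`. -/
def expNeg (ξ y : Rn d) : ℂ := Complex.exp (-(Complex.I * ((⟪y, ξ⟫_ℝ : ℝ) : ℂ)))

theorem contDiff_expNeg (ξ : Rn d) : ContDiff ℝ ∞ (expNeg ξ) := by
  unfold expNeg
  refine Complex.contDiff_exp.comp (ContDiff.neg (contDiff_const.mul ?_))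
  exact Complex.ofRealCLM.contDiff.comp (contDiff_id.inner ℝ contDiff_const)

theorem norm_iteratedDeriv_exp_aux (n : ℕ) (t : ℝ) :
    ‖iteratedDeriv n (fun t : ℝ => Complex.exp (-(Complex.I * (t : ℂ)))) t‖ = 1 := by
  have h : ∀ n : ℕ, iteratedDeriv n (fun t : ℝ => Complex.exp (-(Complex.I * (t : ℂ)))) =
      fun t : ℝ => (-Complex.I) ^ n * Complex.exp (-(Complex.I * (t : ℂ))) := by
    intro n
    induction n with
    | zero => simp
    | succ n ih =>
      rw [iteratedDeriv_succ, ih]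
      funext t
      have h1 : HasDerivAt (fun t : ℝ => -(Complex.I * (t : ℂ))) (-Complex.I) t := by
        have h0 := ((Complex.ofRealCLM.hasDerivAt (x := t)).const_mul Complex.I).fun_neg
        simpa using h0
      have h2 := (h1.cexp.const_mul ((-Complex.I) ^ n)).deriv
      rw [h2]
      ring
  rw [h]
  have : (-(Complex.I * (t : ℂ))) = ((-t : ℝ) : ℂ) * Complex.I := by push_cast; ring
  simp only [norm_mul, norm_pow, norm_neg, Complex.norm_I, one_pow, one_mul]
  rw [this, Complex.norm_exp_ofReal_mul_I]

theorem norm_iteratedFDeriv_expNeg_le (ξ : Rn d) (n : ℕ) (y : Rn d) :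
    ‖iteratedFDeriv ℝ n (expNeg ξ) y‖ ≤ ‖ξ‖ ^ n := by
  have hc : ContDiff ℝ ∞ (fun t : ℝ => Complex.exp (-(Complex.I * (t : ℂ)))) :=
    Complex.contDiff_exp.comp (ContDiff.neg (contDiff_const.mul Complex.ofRealCLM.contDiff))
  have he : expNeg ξ = (fun t : ℝ => Complex.exp (-(Complex.I * (t : ℂ)))) ∘ (innerSL ℝ ξ) := by
    funext y
    simp [expNeg, real_inner_comm]
  rw [he, (innerSL ℝ ξ).iteratedFDeriv_comp_right hc y (i := n) (by exact_mod_cast le_top)]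
  refine (ContinuousMultilinearMap.norm_compContinuousLinearMap_le _ _).trans ?_
  rw [norm_iteratedFDeriv_eq_norm_iteratedDeriv, norm_iteratedDeriv_exp_aux]
  simp

theorem hasTemperateGrowth_expNeg (ξ : Rn d) : Function.HasTemperateGrowth (expNeg ξ) :=
  ⟨contDiff_expNeg ξ, fun n => ⟨0, ‖ξ‖ ^ n, fun y => by
    simpa using norm_iteratedFDeriv_expNeg_le ξ n y⟩⟩

/-- Pointwise complex conjugate of a Schwartz function. -/
def conjSchwartz (g : 𝓢(Rn d, ℂ)) : 𝓢(Rn d, ℂ) :=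
  SchwartzMap.postcompCLM (𝕜 := ℝ) (Complex.conjCLE : ℂ →L[ℝ] ℂ) g

/-- The test function `y ↦ exp (-i y · ξ) * conj (g (y - x))`. -/
def stftAtom (g : 𝓢(Rn d, ℂ)) (x ξ : Rn d) : 𝓢(Rn d, ℂ) :=
  SchwartzMap.smulLeftCLM ℂ (expNeg ξ) (SchwartzMap.compSubConstCLM ℂ x (conjSchwartz g))

theorem stftAtom_apply (g : 𝓢(Rn d, ℂ)) (x ξ y : Rn d) :
    stftAtom g x ξ y =
      Complex.exp (-(Complex.I * ((⟪y, ξ⟫_ℝ : ℝ) : ℂ))) * (starRingEnd ℂ) (g (y - x)) := by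
  rw [stftAtom, SchwartzMap.smulLeftCLM_apply_apply (hasTemperateGrowth_expNeg ξ)]
  simp [conjSchwartz, expNeg, SchwartzMap.postcompCLM_apply]

/-- The short-time Fourier transform of a tempered distribution `f` with window `g`:
`V_g f (x, ξ) = ∫ f(y) conj (g (y - x)) exp (-i y · ξ) dy` in the sense of distributions. -/
def stft (g : 𝓢(Rn d, ℂ)) (f : 𝓢'(Rn d, ℂ)) (x ξ : Rn d) : ℂ := f (stftAtom g x ξ)

theorem stftAtom_bound (g : 𝓢(Rn d, ℂ)) (K n : ℕ) (R : ℝ) :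
    ∃ C : ℝ, ∀ x ξ : Rn d, ‖x‖ ≤ R → ‖ξ‖ ≤ R → ∀ y : Rn d,
      ‖y‖ ^ K * ‖iteratedFDeriv ℝ n (stftAtom g x ξ) y‖ ≤ C := by
  set h := conjSchwartz g with hh
  set S := 2 ^ K * (Finset.Iic (K, n)).sup (fun m => SchwartzMap.seminorm ℂ m.1 m.2) h with hS
  have hS0 : 0 ≤ S := by positivity
  refine ⟨∑ i ∈ Finset.range (n + 1), (n.choose i : ℝ) * |R| ^ i * ((1 + |R|) ^ K * S), ?_⟩
  intro x ξ hx hξ y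
  have hx' : ‖x‖ ≤ |R| := hx.trans (le_abs_self R)
  have hξ' : ‖ξ‖ ≤ |R| := hξ.trans (le_abs_self R)
  have hfun : (stftAtom g x ξ : Rn d → ℂ) = fun y => expNeg ξ y * h (y - x) := by
    funext y
    rw [stftAtom, SchwartzMap.smulLeftCLM_apply_apply (hasTemperateGrowth_expNeg ξ)]
    simp [hh]
  have hsm : ContDiff ℝ ∞ (fun y => h (y - x)) :=
    (h.smooth ⊤).comp (contDiff_id.sub contDiff_const)
  have hle := norm_iteratedFDeriv_mul_le (contDiff_expNeg ξ) hsm y (n := n)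
    (by exact_mod_cast le_top)
  rw [hfun]
  calc ‖y‖ ^ K * ‖iteratedFDeriv ℝ n (fun y => expNeg ξ y * h (y - x)) y‖
      ≤ ‖y‖ ^ K * ∑ i ∈ Finset.range (n + 1), (n.choose i : ℝ) *
          ‖iteratedFDeriv ℝ i (expNeg ξ) y‖ *
          ‖iteratedFDeriv ℝ (n - i) (fun y => h (y - x)) y‖ := by gcongr
    _ = ∑ i ∈ Finset.range (n + 1), (n.choose i : ℝ) *
          ‖iteratedFDeriv ℝ i (expNeg ξ) y‖ *
          (‖y‖ ^ K * ‖iteratedFDeriv ℝ (n - i) (fun y => h (y - x)) y‖) := by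
        rw [Finset.mul_sum]
        exact Finset.sum_congr rfl fun i _ => by ring
    _ ≤ _ := by
        refine Finset.sum_le_sum fun i _ => ?_
        have h1 : ‖iteratedFDeriv ℝ i (expNeg ξ) y‖ ≤ |R| ^ i :=
          (norm_iteratedFDeriv_expNeg_le ξ i y).trans (by gcongr)
        have h2 : ‖y‖ ^ K * ‖iteratedFDeriv ℝ (n - i) (fun y => h (y - x)) y‖ ≤
            (1 + |R|) ^ K * S := by
          rw [iteratedFDeriv_comp_sub]
          have h3 := SchwartzMap.one_add_le_sup_seminorm_apply (𝕜 := ℂ) (m := (K, n))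
            (k := K) (n := n - i) le_rfl (Nat.sub_le n i) h (y - x)
          have h4 : ‖y‖ ≤ (1 + |R|) * (1 + ‖y - x‖) := by
            have : ‖y‖ ≤ ‖y - x‖ + ‖x‖ := by simpa using norm_add_le (y - x) x
            nlinarith [norm_nonneg (y - x), abs_nonneg R,
              mul_nonneg (abs_nonneg R) (norm_nonneg (y - x))]
          calc ‖y‖ ^ K * ‖iteratedFDeriv ℝ (n - i) (⇑h) (y - x)‖
              ≤ ((1 + |R|) * (1 + ‖y - x‖)) ^ K * ‖iteratedFDeriv ℝ (n - i) (⇑h) (y - x)‖ := by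
                gcongr
            _ = (1 + |R|) ^ K * ((1 + ‖y - x‖) ^ K * ‖iteratedFDeriv ℝ (n - i) (⇑h) (y - x)‖) := by
                rw [mul_pow]; ring
            _ ≤ _ := by gcongr
        gcongr

theorem continuous_iteratedFDeriv_stftAtom (g : 𝓢(Rn d, ℂ)) (n : ℕ) :
    Continuous (fun z : (Rn d × Rn d) × Rn d =>
      iteratedFDeriv ℝ n (stftAtom g z.1.1 z.1.2) z.2) := by
  set h := conjSchwartz g with hh
  let G : (Rn d × Rn d) × Rn d → ℂ := fun z =>
    Complex.exp (-(Complex.I * ((⟪z.2, z.1.2⟫_ℝ : ℝ) : ℂ))) * h (z.2 - z.1.1)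
  have hG : ContDiff ℝ ∞ G := by
    refine ContDiff.mul ?_ ((h.smooth ⊤).comp (contDiff_snd.sub (contDiff_fst.comp contDiff_fst)))
    refine Complex.contDiff_exp.comp (ContDiff.neg (contDiff_const.mul ?_))
    exact Complex.ofRealCLM.contDiff.comp
      (contDiff_snd.inner ℝ (contDiff_snd.comp contDiff_fst))
  let ι : Rn d →L[ℝ] (Rn d × Rn d) × Rn d := ContinuousLinearMap.inr ℝ _ _
  have key : ∀ z : (Rn d × Rn d) × Rn d,
      iteratedFDeriv ℝ n (stftAtom g z.1.1 z.1.2) z.2 =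
        (iteratedFDeriv ℝ n G z).compContinuousLinearMap (fun _ => ι) := by
    intro z
    have hfun : (stftAtom g z.1.1 z.1.2 : Rn d → ℂ) =
        (fun w => G (w + (z.1, 0))) ∘ ι := by
      funext y
      rw [stftAtom, SchwartzMap.smulLeftCLM_apply_apply (hasTemperateGrowth_expNeg _)]
      simp [G, ι, hh, expNeg]
    have hG' : ContDiff ℝ ∞ (fun w => G (w + (z.1, 0))) :=
      hG.comp (contDiff_id.add contDiff_const)
    rw [hfun, ι.iteratedFDeriv_comp_right hG' z.2 (i := n) (by exact_mod_cast le_top),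
      iteratedFDeriv_comp_add_right]
    congr 2
    simp [ι]
  simp_rw [key]
  exact (ContinuousMultilinearMap.compContinuousLinearMapL (fun _ : Fin n => ι)).continuous.comp
    (hG.continuous_iteratedFDeriv (by exact_mod_cast le_top))

theorem continuous_stftAtom (g : 𝓢(Rn d, ℂ)) :
    Continuous (fun z : Rn d × Rn d => stftAtom g z.1 z.2) := by
  rw [continuous_iff_continuousAt]
  intro z₀
  rw [ContinuousAt, (schwartz_withSeminorms ℂ (Rn d) ℂ).tendsto_nhds]
  rintro ⟨k, n⟩ ε hε
  obtain ⟨C, hC⟩ := stftAtom_bound g (k + 1) n (‖z₀‖ + 1)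
  have hC0 : 0 ≤ C := le_trans (by positivity)
    (hC z₀.1 z₀.2 ((norm_fst_le z₀).trans (by linarith)) ((norm_snd_le z₀).trans (by linarith)) 0)
  -- outside a large ball the decay is uniform, inside it joint continuity suffices
  set R : ℝ := 4 * C / ε + 1 with hR
  have hR0 : 0 < R := by positivity
  have hcont : Continuous (fun w : (Rn d × Rn d) × Rn d =>
      ‖w.2‖ ^ k * ‖iteratedFDeriv ℝ n (stftAtom g w.1.1 w.1.2) w.2 -
        iteratedFDeriv ℝ n (stftAtom g z₀.1 z₀.2) w.2‖) := by
    have h1 := continuous_iteratedFDeriv_stftAtom g n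
    have h2 := h1.comp (f := fun w : (Rn d × Rn d) × Rn d => (z₀, w.2)) (by fun_prop)
    exact (continuous_snd.norm.pow k).mul (h1.sub h2).norm
  have hin : ∀ᶠ z in 𝓝 z₀, ∀ y ∈ Metric.closedBall (0 : Rn d) R,
      ‖y‖ ^ k * ‖iteratedFDeriv ℝ n (stftAtom g z.1 z.2) y -
        iteratedFDeriv ℝ n (stftAtom g z₀.1 z₀.2) y‖ < ε / 2 := by
    refine (isCompact_closedBall (0 : Rn d) R).eventually_forall_of_forall_eventually ?_
    intro y _
    have := (hcont.tendsto (z₀, y)).eventually_lt_const (u := ε / 2) (by simpa using by positivity)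
    exact this
  have hball : ∀ᶠ z in 𝓝 z₀, ‖z‖ ≤ ‖z₀‖ + 1 := by
    have := (continuous_norm.tendsto z₀).eventually_lt_const (u := ‖z₀‖ + 1) (by linarith)
    exact this.mono fun z hz => hz.le
  filter_upwards [hin, hball] with z hz hzb
  refine lt_of_le_of_lt ?_ (half_lt_self hε)
  refine SchwartzMap.seminorm_le_bound ℂ k n _ (by positivity) fun y => ?_
  have hsub : iteratedFDeriv ℝ n (⇑(stftAtom g z.1 z.2 - stftAtom g z₀.1 z₀.2)) y =
      iteratedFDeriv ℝ n (stftAtom g z.1 z.2) y -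
        iteratedFDeriv ℝ n (stftAtom g z₀.1 z₀.2) y := by
    have h1 : ContDiff ℝ n (stftAtom g z.1 z.2) := (stftAtom g z.1 z.2).smooth n
    have h2 : ContDiff ℝ n (stftAtom g z₀.1 z₀.2) := (stftAtom g z₀.1 z₀.2).smooth n
    have h3 : (⇑(stftAtom g z.1 z.2 - stftAtom g z₀.1 z₀.2) : Rn d → ℂ) =
      ⇑(stftAtom g z.1 z.2) - ⇑(stftAtom g z₀.1 z₀.2) := by ext; simp
    rw [h3, iteratedFDeriv_sub_apply h1.contDiffAt h2.contDiffAt]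
  rw [hsub]
  by_cases hy : ‖y‖ ≤ R
  · exact (hz y (by simpa using hy)).le
  · push Not at hy
    have hy0 : 0 < ‖y‖ := hR0.trans hy
    have b1 := hC z.1 z.2 ((norm_fst_le z).trans hzb) ((norm_snd_le z).trans hzb) y
    have b2 := hC z₀.1 z₀.2 ((norm_fst_le z₀).trans (by linarith))
      ((norm_snd_le z₀).trans (by linarith)) y
    have b3 := norm_sub_le (iteratedFDeriv ℝ n (stftAtom g z.1 z.2) y)
        (iteratedFDeriv ℝ n (stftAtom g z₀.1 z₀.2) y)
    have b4 : ‖y‖ * (‖y‖ ^ k * ‖iteratedFDeriv ℝ n (stftAtom g z.1 z.2) y -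
        iteratedFDeriv ℝ n (stftAtom g z₀.1 z₀.2) y‖) ≤ 2 * C := by
      calc _ = ‖y‖ ^ (k + 1) * ‖iteratedFDeriv ℝ n (stftAtom g z.1 z.2) y -
        iteratedFDeriv ℝ n (stftAtom g z₀.1 z₀.2) y‖ := by ring
        _ ≤ ‖y‖ ^ (k + 1) * (‖iteratedFDeriv ℝ n (stftAtom g z.1 z.2) y‖ +
            ‖iteratedFDeriv ℝ n (stftAtom g z₀.1 z₀.2) y‖) := by gcongr
        _ ≤ 2 * C := by rw [mul_add]; linarith
    have b5 : 2 * C ≤ ‖y‖ * (ε / 2) := by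
      have : 4 * C / ε ≤ ‖y‖ := by linarith
      rw [div_le_iff₀ hε] at this
      linarith
    exact le_of_mul_le_mul_left (b4.trans b5) hy0

theorem continuous_stft (g : 𝓢(Rn d, ℂ)) (f : 𝓢'(Rn d, ℂ)) :
    Continuous (fun z : Rn d × Rn d => stft g f z.1 z.2) :=
  f.continuous.comp (continuous_stftAtom g)

/-! ### Modulation spaces -/

/-- The polynomial weight `v_s (x, ξ) = (1 + |x|² + |ξ|²)^{s/2}`. -/
def polyWeight (s : ℝ) (x ξ : Rn d) : ℝ := (1 + ‖x‖ ^ 2 + ‖ξ‖ ^ 2) ^ (s / 2)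

/-- The modulation norm
`(∫ (∫ |V_g f(x, ξ)|^p v_s(x, ξ)^p dx)^{q/p} dξ)^{1/q}` of a tempered distribution, with values
in `[0, ∞]` and with essential suprema in place of the integrals if `p = ∞` or `q = ∞`. -/
def modNorm (g : 𝓢(Rn d, ℂ)) (p q : ℝ≥0∞) (s : ℝ) (f : 𝓢'(Rn d, ℂ)) : ℝ≥0∞ :=
  eLpNorm (fun ξ : Rn d => eLpNorm (fun x : Rn d => polyWeight s x ξ • stft g f x ξ) p volume)
    q volume

theorem continuous_polyWeight (s : ℝ) :
    Continuous (fun z : Rn d × Rn d => polyWeight s z.1 z.2) := by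
  unfold polyWeight
  refine Continuous.rpow_const (by fun_prop) fun z => Or.inl ?_
  positivity

theorem continuous_weighted_stft (g : 𝓢(Rn d, ℂ)) (s : ℝ) (f : 𝓢'(Rn d, ℂ)) :
    Continuous (fun z : Rn d × Rn d => polyWeight s z.1 z.2 • stft g f z.1 z.2) :=
  (continuous_polyWeight s).smul (continuous_stft g f)

theorem eLpNorm_top_eq_iSup {h : Rn d → ℂ} (hh : Continuous h) :
    eLpNorm h ∞ volume = ⨆ x, ‖h x‖ₑ := by
  rw [eLpNorm_exponent_top]
  refine le_antisymm essSup_le_iSup (iSup_le fun x => ?_)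
  by_contra hlt
  push Not at hlt
  have hopen : IsOpen {y | eLpNormEssSup h volume < ‖h y‖ₑ} :=
    isOpen_lt continuous_const hh.enorm
  have hpos := hopen.measure_pos volume ⟨x, hlt⟩
  have hzero : volume {y | eLpNormEssSup h volume < ‖h y‖ₑ} = 0 := by
    have := ae_le_eLpNormEssSup (f := h) (μ := volume)
    rw [ae_iff] at this
    simpa using this
  exact hpos.ne' hzero

theorem measurable_eLpNorm_slice (g : 𝓢(Rn d, ℂ)) (p : ℝ≥0∞) (hp : 1 ≤ p) (s : ℝ)
    (f : 𝓢'(Rn d, ℂ)) :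
    Measurable (fun ξ : Rn d =>
      eLpNorm (fun x : Rn d => polyWeight s x ξ • stft g f x ξ) p volume) := by
  have hc := continuous_weighted_stft g s f
  rcases eq_or_ne p ∞ with rfl | hpt
  · have : ∀ ξ : Rn d, eLpNorm (fun x : Rn d => polyWeight s x ξ • stft g f x ξ) ∞ volume =
        ⨆ x, ‖polyWeight s x ξ • stft g f x ξ‖ₑ := fun ξ =>
      eLpNorm_top_eq_iSup (hc.comp (f := fun x : Rn d => (x, ξ)) (by fun_prop))
    simp_rw [this]
    refine LowerSemicontinuous.measurable (lowerSemicontinuous_iSup fun x => ?_)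
    exact ((hc.comp (f := fun ξ : Rn d => (x, ξ)) (by fun_prop)).enorm).lowerSemicontinuous
  · have hp0 : p ≠ 0 := (zero_lt_one.trans_le hp).ne'
    simp_rw [eLpNorm_eq_lintegral_rpow_enorm_toReal hp0 hpt]
    refine Measurable.pow_const ?_ _
    have : Measurable (fun z : Rn d × Rn d => ‖polyWeight s z.1 z.2 • stft g f z.1 z.2‖ₑ ^ p.toReal) :=
      (hc.measurable.enorm).pow_const _
    exact this.lintegral_prod_left'

theorem modNorm_zero (g : 𝓢(Rn d, ℂ)) (p q : ℝ≥0∞) (s : ℝ) : modNorm g p q s 0 = 0 := by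
  simp [modNorm, stft]

theorem modNorm_add_le (g : 𝓢(Rn d, ℂ)) {p q : ℝ≥0∞} (hp : 1 ≤ p) (hq : 1 ≤ q) (s : ℝ)
    (f₁ f₂ : 𝓢'(Rn d, ℂ)) :
    modNorm g p q s (f₁ + f₂) ≤ modNorm g p q s f₁ + modNorm g p q s f₂ := by
  have hslice : ∀ (f : 𝓢'(Rn d, ℂ)) (ξ : Rn d),
      AEStronglyMeasurable (fun x : Rn d => polyWeight s x ξ • stft g f x ξ) volume := fun f ξ =>
    ((continuous_weighted_stft g s f).comp
      (f := fun x : Rn d => (x, ξ)) (by fun_prop)).aestronglyMeasurable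
  have hm := fun f => (measurable_eLpNorm_slice g p hp s f).aestronglyMeasurable (μ := volume)
  refine le_trans ?_ (eLpNorm_add_le (hm f₁) (hm f₂) hq)
  refine eLpNorm_mono_enorm fun ξ => ?_
  simp only [enorm_eq_self, Pi.add_apply]
  refine le_trans (le_of_eq ?_) (eLpNorm_add_le (hslice f₁ ξ) (hslice f₂ ξ) hp)
  congr 1
  funext x
  simp [stft]

theorem modNorm_smul_le (g : 𝓢(Rn d, ℂ)) (p q : ℝ≥0∞) (s : ℝ) (c : ℂ) (f : 𝓢'(Rn d, ℂ)) :
    modNorm g p q s (c • f) ≤ ‖c‖ₑ * modNorm g p q s f := by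
  refine eLpNorm_le_nnreal_smul_eLpNorm_of_ae_le_mul' (c := ‖c‖₊) (ae_of_all _ fun ξ => ?_) q
  simp only [enorm_eq_self]
  refine eLpNorm_le_nnreal_smul_eLpNorm_of_ae_le_mul' (c := ‖c‖₊) (ae_of_all _ fun x => ?_) p
  have : polyWeight s x ξ • stft g (c • f) x ξ = c • (polyWeight s x ξ • stft g f x ξ) := by
    simp [stft, mul_left_comm]
  rw [this, enorm_smul]
  rfl

theorem modNorm_smul (g : 𝓢(Rn d, ℂ)) (p q : ℝ≥0∞) (s : ℝ) (c : ℂ) (f : 𝓢'(Rn d, ℂ)) :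
    modNorm g p q s (c • f) = ‖c‖ₑ * modNorm g p q s f := by
  rcases eq_or_ne c 0 with rfl | hc
  · refine le_antisymm (modNorm_smul_le g p q s 0 f) ?_
    rw [enorm_zero, zero_mul]
    exact zero_le
  refine le_antisymm (modNorm_smul_le g p q s c f) ?_
  have h := modNorm_smul_le g p q s c⁻¹ (c • f)
  rw [smul_smul, inv_mul_cancel₀ hc, one_smul] at h
  calc ‖c‖ₑ * modNorm g p q s f ≤ ‖c‖ₑ * (‖c⁻¹‖ₑ * modNorm g p q s (c • f)) := by gcongr
    _ = modNorm g p q s (c • f) := by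
      rw [← mul_assoc, ← enorm_mul, mul_inv_cancel₀ hc]
      simp

section Space

variable (g : 𝓢(Rn d, ℂ)) (p q : ℝ≥0∞) [Fact (1 ≤ p)] [Fact (1 ≤ q)] (s : ℝ)

/-- The tempered distributions of finite modulation norm. -/
def modulationSubmodule : Submodule ℂ 𝓢'(Rn d, ℂ) where
  carrier := {f | modNorm g p q s f < ⊤}
  zero_mem' := by simp [modNorm_zero]
  add_mem' {f₁ f₂} h₁ h₂ :=
    (modNorm_add_le g Fact.out Fact.out s f₁ f₂).trans_lt (ENNReal.add_lt_top.2 ⟨h₁, h₂⟩)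
  smul_mem' c f h := by
    simp only [Set.mem_ofPred_eq, modNorm_smul] at h ⊢
    exact ENNReal.mul_lt_top enorm_lt_top h

/-- The modulation space `M_s^{p,q}(ℝ^d)` (with respect to the window `g`): the space of tempered
distributions `f` with `modNorm g p q s f < ⊤`. It is a type of its own because it carries
the topology of its norm and not the one induced by the tempered distributions. -/
def ModulationSpace : Type := ↥(modulationSubmodule g p q s)

namespace ModulationSpace

instance : AddCommGroup (ModulationSpace g p q s) :=
  inferInstanceAs (AddCommGroup ↥(modulationSubmodule g p q s))

instance : Module ℂ (ModulationSpace g p q s) :=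
  inferInstanceAs (Module ℂ ↥(modulationSubmodule g p q s))

variable {g p q s}

/-- The inclusion of a modulation space into the tempered distributions. -/
def toDistribution : ModulationSpace g p q s →ₗ[ℂ] 𝓢'(Rn d, ℂ) :=
  (modulationSubmodule g p q s).subtype

theorem modNorm_lt_top (f : ModulationSpace g p q s) :
    modNorm g p q s (toDistribution f) < ⊤ := f.2

instance : Norm (ModulationSpace g p q s) :=
  ⟨fun f => (modNorm g p q s (toDistribution f)).toReal⟩

theorem norm_def (f : ModulationSpace g p q s) :
    ‖f‖ = (modNorm g p q s (toDistribution f)).toReal := rfl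

theorem core : SeminormedSpace.Core ℂ (ModulationSpace g p q s) where
  norm_nonneg f := ENNReal.toReal_nonneg
  norm_smul c f := by
    rw [norm_def, norm_def, map_smul, modNorm_smul, ENNReal.toReal_mul, toReal_enorm]
  norm_triangle f₁ f₂ := by
    rw [norm_def, norm_def, norm_def, map_add,
      ← ENNReal.toReal_add (modNorm_lt_top f₁).ne (modNorm_lt_top f₂).ne]
    exact ENNReal.toReal_mono
      (ENNReal.add_lt_top.2 ⟨modNorm_lt_top f₁, modNorm_lt_top f₂⟩).ne
      (modNorm_add_le g Fact.out Fact.out s _ _)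

/-- The topology of `M_s^{p,q}` is that of the modulation norm. (For `g ≠ 0` the
seminorm `‖f‖ = ‖V_g f‖` is a norm; this is a theorem that the definition does not need.) -/
instance : SeminormedAddCommGroup (ModulationSpace g p q s) :=
  SeminormedAddCommGroup.ofCore core

instance : NormedSpace ℂ (ModulationSpace g p q s) where
  norm_smul_le c f := (core.norm_smul c f).le

end ModulationSpace

end Space

/-! ### Nuclear operators and their trace -/

section Nuclear

variable {B₁ B₂ B : Type*} [SeminormedAddCommGroup B₁] [NormedSpace ℂ B₁]
  [SeminormedAddCommGroup B₂] [NormedSpace ℂ B₂] [SeminormedAddCommGroup B] [NormedSpace ℂ B]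

/-- `T = ∑ₙ x'ₙ ⊗ yₙ` with functionals `x'ₙ` in the dual of `B₁` and vectors `yₙ` in `B₂` such that
`∑ₙ ‖x'ₙ‖^r ‖yₙ‖^r < ∞`. -/
def IsNuclearRepresentation (r : ℝ) (T : B₁ →L[ℂ] B₂)
    (x' : ℕ → (B₁ →L[ℂ] ℂ)) (y : ℕ → B₂) : Prop :=
  Summable (fun n => ‖x' n‖ ^ r * ‖y n‖ ^ r) ∧
    ∀ x : B₁, HasSum (fun n => x' n x • y n) (T x)

/-- `T` is an `r`-nuclear operator. -/
def IsRNuclear (r : ℝ) (T : B₁ →L[ℂ] B₂) : Prop :=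
  ∃ (x' : ℕ → (B₁ →L[ℂ] ℂ)) (y : ℕ → B₂), IsNuclearRepresentation r T x' y

/-- The operator `T` is nuclear, its trace is well defined, and its value is `τ`: every nuclear
representation `T = ∑ₙ x'ₙ ⊗ yₙ` has `∑ₙ ⟨yₙ, x'ₙ⟩ = τ`. -/
def HasNuclearTrace (T : B →L[ℂ] B) (τ : ℂ) : Prop :=
  IsRNuclear 1 T ∧
    ∀ (x' : ℕ → (B →L[ℂ] ℂ)) (y : ℕ → B), IsNuclearRepresentation 1 T x' y →
      HasSum (fun n => x' n (y n)) τ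

end Nuclear

/-! ### The harmonic oscillator and the Hermite functions -/

/-- The harmonic oscillator `-Δ + |x|²`, acting on tempered distributions. -/
def harmonicOscillator (f : 𝓢'(Rn d, ℂ)) : 𝓢'(Rn d, ℂ) :=
  -Δ f + TemperedDistribution.smulLeftCLM ℂ (fun x : Rn d => ((‖x‖ ^ 2 : ℝ) : ℂ)) f

theorem hasTemperateGrowth_norm_sq :
    Function.HasTemperateGrowth (fun x : Rn d => ((‖x‖ ^ 2 : ℝ) : ℂ)) := by
  fun_prop

theorem exists_gaussian_bound (K n : ℕ) : ∃ C : ℝ, ∀ x : Rn d,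
    ‖x‖ ^ K * ‖iteratedFDeriv ℝ n (fun x : Rn d => Real.exp (-(‖x‖ ^ 2 / 2))) x‖ ≤ C := by
  have hf : Function.HasTemperateGrowth (fun x : Rn d => -(‖x‖ ^ 2 / 2)) := by
    have h1 : Function.HasTemperateGrowth (fun x : Rn d => (-(1 / 2) : ℝ) * ‖x‖ ^ 2) := by fun_prop
    convert h1 using 2
    ring
  obtain ⟨k, C, hC, hb⟩ := hf.norm_iteratedFDeriv_le_uniform n
  refine ⟨n ! * (1 + C) ^ n * (Real.exp 2 * (K + k * n)!), fun x => ?_⟩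
  set t := ‖x‖ with ht
  have ht0 : 0 ≤ t := norm_nonneg x
  have hD := norm_iteratedFDeriv_comp_le (𝕜 := ℝ) (g := Real.exp)
    (f := fun x : Rn d => -(‖x‖ ^ 2 / 2)) (n := n) (N := ∞) Real.contDiff_exp hf.1
    (by exact_mod_cast le_top) x (C := Real.exp (-(t ^ 2 / 2))) (D := (1 + C) * (1 + t) ^ k)
    (by
      intro i _
      rw [norm_iteratedFDeriv_eq_norm_iteratedDeriv, iteratedDeriv_eq_iterate,
        Real.iter_deriv_exp, Real.norm_of_nonneg (Real.exp_pos _).le])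
    (by
      intro i hi1 hi
      have hone : 1 ≤ (1 + C) * (1 + t) ^ k :=
        one_le_mul_of_one_le_of_one_le (by linarith) (one_le_pow₀ (by linarith))
      calc _ ≤ C * (1 + t) ^ k := hb i hi x
        _ ≤ (1 + C) * (1 + t) ^ k := by gcongr; linarith
        _ ≤ ((1 + C) * (1 + t) ^ k) ^ i := le_self_pow₀ hone (by omega))
  have hpow : (1 + t) ^ (K + k * n) * Real.exp (-(t ^ 2 / 2)) ≤
      Real.exp 2 * (K + k * n)! := by
    set m := K + k * n
    have h1 : (1 + t) ^ m ≤ (2 + t ^ 2 / 2) ^ m := by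
      refine pow_le_pow_left₀ (by positivity) ?_ m
      nlinarith [sq_nonneg (t - 1)]
    have h2 := Real.pow_div_factorial_le_exp (2 + t ^ 2 / 2) (by positivity) m
    rw [div_le_iff₀ (by positivity)] at h2
    calc (1 + t) ^ m * Real.exp (-(t ^ 2 / 2))
        ≤ (Real.exp (2 + t ^ 2 / 2) * m !) * Real.exp (-(t ^ 2 / 2)) := by
          gcongr
          exact h1.trans h2
      _ = (Real.exp (2 + t ^ 2 / 2) * Real.exp (-(t ^ 2 / 2))) * m ! := by ring
      _ = Real.exp 2 * m ! := by rw [← Real.exp_add]; congr 2; ring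
  calc t ^ K * ‖iteratedFDeriv ℝ n (fun x : Rn d => Real.exp (-(‖x‖ ^ 2 / 2))) x‖
      ≤ (1 + t) ^ K * (n ! * Real.exp (-(t ^ 2 / 2)) * ((1 + C) * (1 + t) ^ k) ^ n) := by
        gcongr
        · linarith
        · exact hD
    _ = n ! * (1 + C) ^ n * ((1 + t) ^ (K + k * n) * Real.exp (-(t ^ 2 / 2))) := by
        rw [mul_pow, pow_add, pow_mul]; ring
    _ ≤ _ := by gcongr

/-- The Gaussian `exp (-|x|²/2)`. -/
def gaussian (d : ℕ) : 𝓢(Rn d, ℝ) where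
  toFun x := Real.exp (-(‖x‖ ^ 2 / 2))
  smooth' := by
    refine Real.contDiff_exp.comp ?_
    exact ((contDiff_norm_sq ℝ).div_const 2).neg
  decay' := exists_gaussian_bound

/-- The normalised physicists' Hermite polynomial
`(2^n n! √π)^{-1/2} H_n(t) = (n! √π)^{-1/2} He_n(√2 t)`. -/
def normHermite (n : ℕ) (t : ℝ) : ℝ :=
  (Real.sqrt (n ! * Real.sqrt Real.pi))⁻¹ *
    Polynomial.aeval (Real.sqrt 2 * t) (Polynomial.hermite n)

/-- The Hermite function `φ_α(x) = ∏ᵢ (2^{αᵢ} αᵢ! √π)^{-1/2} H_{αᵢ}(xᵢ) exp (-xᵢ²/2)`; these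
functions, for `α ∈ ℕ^d`, are the usual `L²`-orthonormal basis of eigenfunctions of the harmonic
oscillator. -/
def hermiteFunction (α : Fin d → ℕ) : 𝓢(Rn d, ℂ) :=
  SchwartzMap.postcompCLM (𝕜 := ℝ) Complex.ofRealCLM
    (SchwartzMap.smulLeftCLM ℝ (fun x : Rn d => ∏ i, normHermite (α i) (x i)) (gaussian d))

theorem hasTemperateGrowth_prod {ι : Type*} (t : Finset ι) (f : ι → Rn d → ℝ)
    (hf : ∀ i, (f i).HasTemperateGrowth) :
    Function.HasTemperateGrowth (fun x => ∏ i ∈ t, f i x) := by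
  classical
  induction t using Finset.induction_on with
  | empty =>
    simp only [Finset.prod_empty]
    exact Function.HasTemperateGrowth.const (1 : ℝ)
  | insert a t ha ih =>
    simp only [Finset.prod_insert ha]
    exact (hf a).mul ih

theorem hasTemperateGrowth_normHermite (n : ℕ) (i : Fin d) :
    Function.HasTemperateGrowth (fun x : Rn d => normHermite n (x i)) := by
  have hi : Function.HasTemperateGrowth (fun x : Rn d => x i) :=
    (EuclideanSpace.proj (𝕜 := ℝ) i : Rn d →L[ℝ] ℝ).hasTemperateGrowth
  unfold normHermite
  simp_rw [Polynomial.aeval_eq_sum_range, mul_pow]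
  refine (Function.HasTemperateGrowth.const _).mul (Function.HasTemperateGrowth.sum fun k _ => ?_)
  have : Function.HasTemperateGrowth (fun x : Rn d =>
      (((Polynomial.hermite n).coeff k : ℤ) : ℝ) * (Real.sqrt 2 ^ k * (x i) ^ k)) :=
    (Function.HasTemperateGrowth.const _).mul
      ((Function.HasTemperateGrowth.const _).mul (hi.pow k))
  simpa [zsmul_eq_mul] using this

theorem hermiteFunction_apply (α : Fin d → ℕ) (x : Rn d) :
    hermiteFunction α x =
      ((∏ i, (normHermite (α i) (x i) * Real.exp (-((x i) ^ 2 / 2))) : ℝ) : ℂ) := by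
  have h := hasTemperateGrowth_prod Finset.univ
    (fun i (x : Rn d) => normHermite (α i) (x i)) fun i => hasTemperateGrowth_normHermite (α i) i
  have hg : gaussian d x = ∏ i, Real.exp (-((x i) ^ 2 / 2)) := by
    change Real.exp (-(‖x‖ ^ 2 / 2)) = _
    rw [← Real.exp_sum, EuclideanSpace.norm_sq_eq, Finset.sum_div, ← Finset.sum_neg_distrib]
    simp
  rw [hermiteFunction, SchwartzMap.postcompCLM_apply, SchwartzMap.smulLeftCLM_apply_apply h, hg,
    Finset.prod_mul_distrib]
  rfl

/-- The eigenvalue `∑ᵢ (2 αᵢ + 1)` of the harmonic oscillator that belongs to `φ_α`. -/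
def hermiteEigenvalue (α : Fin d → ℕ) : ℝ := ∑ i, (2 * (α i : ℝ) + 1)

/-- The Hermite function `φ_α` as a tempered distribution. -/
def hermiteDistribution (α : Fin d → ℕ) : 𝓢'(Rn d, ℂ) :=
  SchwartzMap.toTemperedDistributionCLM (Rn d) ℂ volume (hermiteFunction α)

theorem derivative_hermite_succ (n : ℕ) :
    Polynomial.derivative (Polynomial.hermite (n + 1)) =
      ((n : Polynomial ℤ) + 1) * Polynomial.hermite n := by
  induction n with
  | zero => simp [Polynomial.hermite_succ]
  | succ n ih =>
    rw [Polynomial.hermite_succ (n + 1), map_sub, Polynomial.derivative_mul, ih]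
    have h2 : Polynomial.derivative (((n : Polynomial ℤ) + 1) * Polynomial.hermite n) =
        ((n : Polynomial ℤ) + 1) * Polynomial.derivative (Polynomial.hermite n) := by
      simp [Polynomial.derivative_mul]
    rw [h2]
    have h3 := Polynomial.hermite_succ n
    rw [Polynomial.derivative_X]
    push_cast
    linear_combination (-(n : Polynomial ℤ) - 1) * h3

theorem hermite_ode (n : ℕ) :
    Polynomial.derivative (Polynomial.derivative (Polynomial.hermite n)) =
      Polynomial.X * Polynomial.derivative (Polynomial.hermite n) -
        (n : Polynomial ℤ) * Polynomial.hermite n := by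
  have h := congrArg Polynomial.derivative (Polynomial.hermite_succ n)
  rw [derivative_hermite_succ, map_sub, Polynomial.derivative_mul, Polynomial.derivative_X] at h
  linear_combination h

/-- The one-dimensional Hermite functions satisfy `h'' = (t² - (2 n + 1)) h`. -/
theorem exists_hasDerivAt_hermite (n : ℕ) : ∃ u : ℝ → ℝ,
    (∀ t, HasDerivAt (fun t => normHermite n t * Real.exp (-(t ^ 2 / 2))) (u t) t) ∧
    ∀ t, HasDerivAt u ((t ^ 2 - (2 * n + 1)) * (normHermite n t * Real.exp (-(t ^ 2 / 2)))) t := by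
  set c := (Real.sqrt (n ! * Real.sqrt Real.pi))⁻¹ with hc
  set P := Polynomial.hermite n with hP
  set w := Real.sqrt 2 with hw
  have hw2 : w ^ 2 = 2 := Real.sq_sqrt (by norm_num)
  have hpoly : ∀ (Q : Polynomial ℤ) (t : ℝ), HasDerivAt (fun t => Polynomial.aeval (w * t) Q)
      (Polynomial.aeval (w * t) (Polynomial.derivative Q) * w) t := by
    intro Q t
    have h1 : HasDerivAt (fun t : ℝ => w * t) w t := by
      simpa using (hasDerivAt_id t).const_mul w
    exact (Q.hasDerivAt_aeval (w * t)).comp t h1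
  have hexp : ∀ t : ℝ, HasDerivAt (fun t : ℝ => Real.exp (-(t ^ 2 / 2)))
      (Real.exp (-(t ^ 2 / 2)) * (-t)) t := by
    intro t
    have h1 : HasDerivAt (fun t : ℝ => -(t ^ 2 / 2)) (-t) t := by
      exact ((hasDerivAt_pow 2 t).div_const 2).fun_neg.congr_deriv (by norm_num)
    exact h1.exp
  refine ⟨fun t => c * ((Polynomial.aeval (w * t) (Polynomial.derivative P) * w -
    t * Polynomial.aeval (w * t) P) * Real.exp (-(t ^ 2 / 2))), fun t => ?_, fun t => ?_⟩
  · have h := ((hpoly P t).fun_mul (hexp t)).const_mul c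
    have hfun : (fun t => normHermite n t * Real.exp (-(t ^ 2 / 2))) =
        fun t => c * (Polynomial.aeval (w * t) P * Real.exp (-(t ^ 2 / 2))) := by
      funext t
      simp only [normHermite, ← hc, ← hP, ← hw]
      ring
    rw [hfun]
    exact h.congr_deriv (by ring)
  · have h1 := ((hpoly (Polynomial.derivative P) t).mul_const w).fun_sub
      ((hasDerivAt_id' t).fun_mul (hpoly P t))
    have h := (h1.fun_mul (hexp t)).const_mul c
    refine h.congr_deriv ?_
    have hode := congrArg (Polynomial.aeval (w * t)) (hermite_ode n)
    simp only [map_sub, map_mul, Polynomial.aeval_X, map_natCast] at hode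
    rw [← hP] at hode
    simp only [normHermite, ← hc, ← hP, ← hw]
    rw [hode]
    linear_combination (c * Real.exp (-(t ^ 2 / 2)) *
      (t * w * Polynomial.aeval (w * t) (Polynomial.derivative P) -
        (n : ℝ) * Polynomial.aeval (w * t) P)) * hw2

theorem lineDeriv_separated (i : Fin d) (u v : ℝ → ℝ) (huv : ∀ t, HasDerivAt u (v t) t)
    (h : Fin d → ℝ → ℝ) (x : Rn d) :
    lineDeriv ℝ (fun x : Rn d => ((u (x i) * ∏ j ∈ Finset.univ.erase i, h j (x j) : ℝ) : ℂ)) x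
      (EuclideanSpace.basisFun (Fin d) ℝ i) =
    ((v (x i) * ∏ j ∈ Finset.univ.erase i, h j (x j) : ℝ) : ℂ) := by
  have hfun : (fun t : ℝ => ((u ((x + t • EuclideanSpace.basisFun (Fin d) ℝ i) i) *
      ∏ j ∈ Finset.univ.erase i, h j ((x + t • EuclideanSpace.basisFun (Fin d) ℝ i) j) : ℝ) : ℂ)) =
      fun t : ℝ => ((u (x i + t) * ∏ j ∈ Finset.univ.erase i, h j (x j) : ℝ) : ℂ) := by
    funext t
    congr 2
    · simp
    · refine Finset.prod_congr rfl fun j hj => ?_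
      simp [Finset.ne_of_mem_erase hj]
  rw [lineDeriv, hfun]
  have h1 : HasDerivAt (fun t : ℝ => u (x i + t)) (v (x i)) 0 := by
    have := huv (x i + 0)
    rw [add_zero] at this
    simpa using HasDerivAt.comp_const_add (x i) 0 (by simpa using this)
  exact ((h1.mul_const _).ofReal_comp).deriv

/-- The Hermite functions are eigenfunctions: `(-Δ + |x|²) φ_α = λ_α φ_α`. -/
theorem harmonicOscillator_hermiteDistribution (α : Fin d → ℕ) :
    harmonicOscillator (hermiteDistribution α) =
      (hermiteEigenvalue α : ℂ) • hermiteDistribution α := by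
  choose u hu hu' using exists_hasDerivAt_hermite
  let h : ℕ → ℝ → ℝ := fun n t => normHermite n t * Real.exp (-(t ^ 2 / 2))
  have hφ : ∀ i : Fin d, (hermiteFunction α : Rn d → ℂ) = fun x => ((h (α i) (x i) *
      ∏ j ∈ Finset.univ.erase i, h (α j) (x j) : ℝ) : ℂ) := by
    intro i
    funext x
    rw [hermiteFunction_apply, ← Finset.mul_prod_erase _ _ (Finset.mem_univ i)]
  have hΔ : ∀ x, (Δ (hermiteFunction α)) x =
      ((‖x‖ ^ 2 - hermiteEigenvalue α : ℝ) : ℂ) * hermiteFunction α x := by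
    intro x
    rw [SchwartzMap.laplacian_eq_sum (EuclideanSpace.basisFun (Fin d) ℝ), sum_apply]
    have hi : ∀ i : Fin d, (LineDeriv.lineDerivOp (EuclideanSpace.basisFun (Fin d) ℝ i)
        (LineDeriv.lineDerivOp (EuclideanSpace.basisFun (Fin d) ℝ i) (hermiteFunction α))
          : 𝓢(Rn d, ℂ)) x =
        (((x i) ^ 2 - (2 * (α i : ℝ) + 1) : ℝ) : ℂ) * hermiteFunction α x := by
      intro i
      have h1 : ((LineDeriv.lineDerivOp (EuclideanSpace.basisFun (Fin d) ℝ i) (hermiteFunction α)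
          : 𝓢(Rn d, ℂ)) : Rn d → ℂ) = fun x => ((u (α i) (x i) *
          ∏ j ∈ Finset.univ.erase i, h (α j) (x j) : ℝ) : ℂ) := by
        funext x
        rw [SchwartzMap.lineDerivOp_apply, hφ i]
        exact lineDeriv_separated i _ _ (hu (α i)) _ x
      rw [SchwartzMap.lineDerivOp_apply, h1,
        lineDeriv_separated i _ _ (hu' (α i)) (fun j => h (α j)) x, hφ i]
      push_cast
      simp only [h]
      push_cast
      ring
    simp_rw [hi]
    rw [← Finset.sum_mul, EuclideanSpace.norm_sq_eq, hermiteEigenvalue]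
    congr 1
    push_cast
    rw [Finset.sum_sub_distrib]
    congr 1
    exact Finset.sum_congr rfl fun i _ => by 
      rw [← Complex.ofReal_pow, ← Complex.ofReal_pow, Real.norm_eq_abs, sq_abs]
  have hmul : TemperedDistribution.smulLeftCLM ℂ (fun x : Rn d => ((‖x‖ ^ 2 : ℝ) : ℂ))
      (hermiteDistribution α) = SchwartzMap.toTemperedDistributionCLM (Rn d) ℂ volume
        (SchwartzMap.smulLeftCLM ℂ (fun x : Rn d => ((‖x‖ ^ 2 : ℝ) : ℂ)) (hermiteFunction α)) := by
    ext ψ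
    rw [TemperedDistribution.smulLeftCLM_apply_apply, hermiteDistribution,
      SchwartzMap.toTemperedDistributionCLM_apply_apply volume,
      SchwartzMap.toTemperedDistributionCLM_apply_apply volume]
    refine integral_congr_ae (ae_of_all _ fun x => ?_)
    simp only [SchwartzMap.smulLeftCLM_apply_apply hasTemperateGrowth_norm_sq, smul_eq_mul]
    ring
  rw [harmonicOscillator, hmul, hermiteDistribution,
    TemperedDistribution.laplacian_toTemperedDistributionCLM_eq, ← map_neg, ← map_add, ← map_smul]
  congr 1
  ext x
  have := hΔ x
  simp only [add_apply, neg_apply, smul_apply, this,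
    SchwartzMap.smulLeftCLM_apply_apply hasTemperateGrowth_norm_sq, smul_eq_mul]
  push_cast
  ring

/-- The bounded operator `T` on `M_s^{p,q}` is `F(-Δ + |x|²)`: it multiplies each eigenvector of
`-Δ + |x|²` by the value of `F` at its eigenvalue. -/
def IsFunctionOfOscillator {g : 𝓢(Rn d, ℂ)} {p q : ℝ≥0∞} [Fact (1 ≤ p)] [Fact (1 ≤ q)] {s : ℝ}
    (F : ℝ → ℂ) (T : ModulationSpace g p q s →L[ℂ] ModulationSpace g p q s) : Prop :=
  ∀ (lam : ℝ) (f : ModulationSpace g p q s),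
    harmonicOscillator f.toDistribution = (lam : ℂ) • f.toDistribution → T f = F lam • f

/-- The series
`∑_α |F(λ_α)|^r ‖φ_α‖^r ‖φ_α‖^r` with the norms of `M_s^{p,q}` and of `M_{-s}^{p',q'}`. -/
def hermiteSeries (g : 𝓢(Rn d, ℂ)) (p q : ℝ≥0∞) (s : ℝ) (F : ℝ → ℂ) (r : ℝ) : ℝ≥0∞ :=
  ∑' α : Fin d → ℕ, ‖F (hermiteEigenvalue α)‖ₑ ^ r *
    modNorm g p q s (hermiteDistribution α) ^ r *
    modNorm g p.conjExponent q.conjExponent (-s) (hermiteDistribution α) ^ r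

end HarmonicModulation

end

/-!
Applying the short-time Fourier transform `V_g` to a synthesis `∫ c(z) M_ξ T_x g dz` convolves the
coefficients with a rapidly decreasing kernel, so mixed-norm estimates of `c` pass to modulation
norms. Together with the inversion formula `‖g‖² f = (2π)^{-d} ∫ V_g f(z) M_ξ T_x g dz` this gives
the duality bound `|⟨f, u⟩| ≤ C ‖f‖_{p,q,s} ‖u‖_{p',q',-s}`, completeness, and, for finite `p` and
`q`, the strong convergence to the identity of the localization operators, which integrate only over
balls. As these are integrals of rank-one operators, they evaluate the trace of a nuclear operator
as a limit that does not depend on its representation.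

The generating function of the Hermite functions is a time-frequency shift of the Gaussian, so a
distribution that vanishes on all `φ_α` vanishes. Hence `F(A) = ∑_α F(λ_α) ⟨·, φ_α⟩ φ_α` is the only
candidate; by the duality bound `(*)` makes this series `r`-nuclear, and its trace is
`∑_α F(λ_α)` by orthonormality.
-/

noncomputable section

namespace HarmonicModulation

open Filter

variable {d : ℕ}

/-! ### Mixed norms -/

section MixedNorm

variable {X Y Z : Type*} [MeasurableSpace X] [MeasurableSpace Y] [MeasurableSpace Z]
  {μ : Measure X} {ν : Measure Y} {τ : Measure Z}

theorem rpow_lintegral_le_of_le_lintegral [SFinite μ] [SFinite τ]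
    {h : X → Z → ℝ≥0∞} (hh : Measurable (Function.uncurry h)) {a : ℝ} (ha : 1 < a)
    {u : X → ℝ≥0∞} (hu : Measurable u) (hfin : ∫⁻ x, u x ^ a ∂μ ≠ ⊤)
    (hle : ∀ x, u x ≤ ∫⁻ t, h x t ∂τ) :
    (∫⁻ x, u x ^ a ∂μ) ^ (1 / a) ≤ ∫⁻ t, (∫⁻ x, h x t ^ a ∂μ) ^ (1 / a) ∂τ := by
  set I := ∫⁻ x, u x ^ a ∂μ
  rcases eq_or_ne I 0 with h0 | h0
  · rw [h0, ENNReal.zero_rpow_of_pos (by positivity)]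
    exact zero_le
  set b := a / (a - 1)
  have hba : b.HolderConjugate a := (Real.HolderConjugate.conjExponent ha).symm
  have hmul : (a - 1) * b = a := mul_div_cancel₀ a (sub_ne_zero.2 ha.ne')
  -- `I = ∫ u^(a-1) u`; swap the integrals and apply Hölder's inequality in `x`
  have holder : I ≤ I ^ (1 / b) * ∫⁻ t, (∫⁻ x, h x t ^ a ∂μ) ^ (1 / a) ∂τ := calc
    I ≤ ∫⁻ x, u x ^ (a - 1) * ∫⁻ t, h x t ∂τ ∂μ := by
      refine lintegral_mono fun x => ?_
      calc u x ^ a = u x ^ (a - 1) * u x := by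
            conv_rhs => rw [← ENNReal.rpow_one (u x), ← ENNReal.rpow_mul, one_mul]
            rw [← ENNReal.rpow_add_of_nonneg _ _ (by linarith) zero_le_one, sub_add_cancel]
        _ ≤ _ := by gcongr; exact hle x
    _ = ∫⁻ x, ∫⁻ t, u x ^ (a - 1) * h x t ∂τ ∂μ :=
      lintegral_congr fun x => (lintegral_const_mul _ (by fun_prop)).symm
    _ = ∫⁻ t, ∫⁻ x, u x ^ (a - 1) * h x t ∂μ ∂τ :=
      lintegral_lintegral_swap (((hu.comp measurable_fst).pow_const _).mul hh).aemeasurable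
    _ ≤ ∫⁻ t, I ^ (1 / b) * (∫⁻ x, h x t ^ a ∂μ) ^ (1 / a) ∂τ := by
      refine lintegral_mono fun t => ?_
      refine (ENNReal.lintegral_mul_le_Lp_mul_Lq μ hba (hu.pow_const _).aemeasurable
        (hh.comp measurable_prodMk_right).aemeasurable).trans_eq ?_
      simp_rw [← ENNReal.rpow_mul, hmul]
      rfl
    _ = _ := lintegral_const_mul _ (((hh.pow_const a).lintegral_prod_left').pow_const _)
  have hsplit : I = I ^ (1 / b) * I ^ (1 / a) := by
    rw [← ENNReal.rpow_add _ _ h0 hfin, hba.one_div_add_one_div, div_one, ENNReal.rpow_one]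
  have hb0 : I ^ (1 / b) ≠ 0 := by simp [ENNReal.rpow_eq_zero_iff, h0, hfin]
  have hbt : I ^ (1 / b) ≠ ⊤ := ENNReal.rpow_ne_top_of_nonneg (one_div_nonneg.2 hba.nonneg) hfin
  exact (ENNReal.mul_le_mul_iff_right hb0 hbt).1 (hsplit.symm.trans_le holder)

theorem exists_measurable_lt_lintegral [SigmaFinite μ] {f : X → ℝ≥0∞} {L : ℝ≥0∞}
    (hL : L < ∫⁻ x, f x ∂μ) :
    ∃ g : X → ℝ≥0∞, Measurable g ∧ (∀ x, g x ≤ f x) ∧ ∫⁻ x, g x ∂μ < ⊤ ∧ L < ∫⁻ x, g x ∂μ := by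
  simp_rw [lintegral_eq_nnreal, lt_iSup_iff] at hL
  obtain ⟨v, hv, hLv⟩ := hL
  rw [← SimpleFunc.lintegral_eq_lintegral] at hLv
  obtain ⟨w, hw, hfin, hLw⟩ := exists_lt_lintegral_simpleFunc_of_lt_lintegral hLv
  exact ⟨fun x => w x, w.measurable.coe_nnreal_ennreal,
    fun x => (ENNReal.coe_le_coe.2 (hw x)).trans (hv x), hfin, hLw⟩

theorem minkowski_lintegral [SigmaFinite μ] [SFinite τ]
    {h : X → Z → ℝ≥0∞} (hh : Measurable (Function.uncurry h)) {a : ℝ} (ha : 1 ≤ a) :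
    (∫⁻ x, (∫⁻ t, h x t ∂τ) ^ a ∂μ) ^ (1 / a) ≤
      ∫⁻ t, (∫⁻ x, h x t ^ a ∂μ) ^ (1 / a) ∂τ := by
  rcases ha.eq_or_lt with rfl | ha
  · simpa only [ENNReal.rpow_one, div_one] using (lintegral_lintegral_swap hh.aemeasurable).le
  have ha0 : 0 < a := one_pos.trans ha
  rw [one_div, ENNReal.rpow_inv_le_iff ha0]
  refine le_of_forall_lt fun L hL => ?_
  obtain ⟨v, hvm, hv, hfin, hLv⟩ := exists_measurable_lt_lintegral hL
  have hroot : ∀ x, (v x ^ a⁻¹) ^ a = v x := fun x => ENNReal.rpow_inv_rpow ha0.ne' _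
  have key := rpow_lintegral_le_of_le_lintegral (μ := μ) hh ha (hvm.pow_const a⁻¹)
    (by simpa only [hroot] using hfin.ne) fun x => (ENNReal.rpow_inv_le_iff ha0).2 (hv x)
  simp only [hroot, one_div] at key
  exact hLv.trans_le ((ENNReal.rpow_inv_le_iff ha0).1 key)

theorem eLpNorm_lintegral_le [SigmaFinite μ] [SFinite τ]
    {h : X → Z → ℝ≥0∞} (hh : Measurable (Function.uncurry h)) {p : ℝ≥0∞} (hp : 1 ≤ p)
    (hpt : p ≠ ⊤) :
    eLpNorm (fun x => ∫⁻ t, h x t ∂τ) p μ ≤ ∫⁻ t, eLpNorm (fun x => h x t) p μ ∂τ := by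
  have hp0 : p ≠ 0 := (zero_lt_one.trans_le hp).ne'
  simp_rw [eLpNorm_eq_lintegral_rpow_enorm_toReal hp0 hpt, enorm_eq_self]
  exact minkowski_lintegral hh (by simpa using ENNReal.toReal_mono hpt hp)

theorem measurable_eLpNorm_left [SFinite μ] {h : X → Z → ℝ≥0∞}
    (hh : Measurable (Function.uncurry h)) {p : ℝ≥0∞} (hpt : p ≠ ⊤) :
    Measurable fun t => eLpNorm (fun x => h x t) p μ := by
  rcases eq_or_ne p 0 with rfl | hp0
  · simp
  simp_rw [eLpNorm_eq_lintegral_rpow_enorm_toReal hp0 hpt, enorm_eq_self]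
  exact ((hh.pow_const _).lintegral_prod_left').pow_const _

theorem eLpNorm_const_mul_le {p : ℝ≥0∞} {c : ℝ≥0∞} (hc : c ≠ ⊤)
    (u : X → ℝ≥0∞) : eLpNorm (fun x => c * u x) p μ ≤ c * eLpNorm u p μ := by
  lift c to NNReal using hc
  exact eLpNorm_le_nnreal_smul_eLpNorm_of_ae_le_mul' (ae_of_all _ fun x => by simp) p

theorem eLpNorm_comp_add_right {G : Type*} [MeasurableSpace G] [AddGroup G] [MeasurableAdd G]
    {μ : Measure G} [μ.IsAddRightInvariant] {p : ℝ≥0∞} (u : G → ℝ≥0∞) (a : G) :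
    eLpNorm (fun x => u (x + a)) p μ = eLpNorm u p μ := by
  conv_rhs => rw [← map_add_right_eq_self μ a, (measurableEmbedding_addRight a).eLpNorm_map_measure]
  rfl

theorem lintegral_rpow_ne_top_of_eLpNorm_ne_top {p : ℝ≥0∞} (hp0 : p ≠ 0) (hpt : p ≠ ⊤)
    {v : X → ℝ≥0∞} (hv : eLpNorm v p μ ≠ ⊤) : ∫⁻ x, v x ^ p.toReal ∂μ ≠ ⊤ := by
  simpa only [enorm_eq_self] using
    (lintegral_rpow_enorm_lt_top_of_eLpNorm_lt_top hp0 hpt (lt_top_iff_ne_top.2 hv)).ne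

theorem tendsto_eLpNorm_zero {p : ℝ≥0∞} (hp0 : p ≠ 0) (hpt : p ≠ ⊤) {u : ℕ → X → ℝ≥0∞}
    (hu : ∀ n, Measurable (u n)) {v : X → ℝ≥0∞} (hv : eLpNorm v p μ ≠ ⊤)
    (hle : ∀ n x, u n x ≤ v x) (hlim : ∀ᵐ x ∂μ, Tendsto (fun n => u n x) atTop (𝓝 0)) :
    Tendsto (fun n => eLpNorm (u n) p μ) atTop (𝓝 0) := by
  have tendsto_rpow : ∀ {w : ℕ → ℝ≥0∞} {a : ℝ}, 0 < a → Tendsto w atTop (𝓝 0) →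
      Tendsto (fun n => w n ^ a) atTop (𝓝 0) := fun {w a} ha hw => by
    simpa only [ENNReal.zero_rpow_of_pos ha, Function.comp_def] using
      ((ENNReal.continuous_rpow_const (y := a)).tendsto 0).comp hw
  have ha : 0 < p.toReal := ENNReal.toReal_pos hp0 hpt
  simp only [eLpNorm_eq_lintegral_rpow_enorm_toReal hp0 hpt, enorm_eq_self]
  refine tendsto_rpow (by positivity) ?_
  simpa only [lintegral_zero] using tendsto_lintegral_of_dominated_convergence (f := fun _ => 0)
    (fun x => v x ^ p.toReal) (fun n => (hu n).pow_const _)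
    (fun n => ae_of_all _ fun x => ENNReal.rpow_le_rpow (hle n x) ha.le)
    (lintegral_rpow_ne_top_of_eLpNorm_ne_top hp0 hpt hv)
    (hlim.mono fun x hx => tendsto_rpow ha hx)

theorem lintegral_mul_le_eLpNorm_mul_eLpNorm_top {u v : X → ℝ≥0∞} (hu : Measurable u) :
    ∫⁻ x, u x * v x ∂μ ≤ eLpNorm u 1 μ * eLpNorm v ⊤ μ := by
  rw [eLpNorm_exponent_top, eLpNorm_one_eq_lintegral_enorm, eLpNormEssSup]
  simp only [enorm_eq_self]
  rw [← lintegral_mul_const _ hu]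
  exact lintegral_mono_ae ((ENNReal.ae_le_essSup v).mono fun x hx => by gcongr)

theorem lintegral_mul_le_eLpNorm_mul_eLpNorm {p q : ℝ≥0∞} [p.HolderConjugate q]
    {u v : X → ℝ≥0∞} (hu : Measurable u) (hv : Measurable v) :
    ∫⁻ x, u x * v x ∂μ ≤ eLpNorm u p μ * eLpNorm v q μ := by
  rcases eq_or_ne p ⊤ with rfl | hp
  · obtain rfl : q = 1 := (ENNReal.HolderConjugate.eq_top_iff_eq_one ⊤ q).1 rfl
    simpa only [mul_comm] using lintegral_mul_le_eLpNorm_mul_eLpNorm_top (v := u) hv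
  rcases eq_or_ne q ⊤ with rfl | hq
  · obtain rfl : p = 1 := (ENNReal.HolderConjugate.eq_top_iff_eq_one ⊤ p).1 rfl
    exact lintegral_mul_le_eLpNorm_mul_eLpNorm_top hu
  have hp0 := ENNReal.HolderConjugate.ne_zero p q
  have hq0 := ENNReal.HolderConjugate.ne_zero q p
  have hpq : p.toReal.HolderConjugate q.toReal := ENNReal.HolderTriple.toReal
    (r := 1) (ENNReal.toReal_pos hp0 hp) (ENNReal.toReal_pos hq0 hq)
  rw [eLpNorm_eq_lintegral_rpow_enorm_toReal hp0 hp, eLpNorm_eq_lintegral_rpow_enorm_toReal hq0 hq]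
  exact ENNReal.lintegral_mul_le_Lp_mul_Lq μ hpq hu.aemeasurable hv.aemeasurable

/-- The mixed Lebesgue norm `‖u‖_{L^q_y(L^p_x)}` of a nonnegative function; as in the modulation
norm, the `p`-norm in the first variable is taken first. -/
def mixedNorm (μ : Measure X) (ν : Measure Y) (p q : ℝ≥0∞) (u : X → Y → ℝ≥0∞) : ℝ≥0∞ :=
  eLpNorm (fun y => eLpNorm (fun x => u x y) p μ) q ν

theorem mixedNorm_mono {p q : ℝ≥0∞} {u v : X → Y → ℝ≥0∞}
    (huv : ∀ x y, u x y ≤ v x y) : mixedNorm μ ν p q u ≤ mixedNorm μ ν p q v :=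
  eLpNorm_mono_enorm fun y => eLpNorm_mono_enorm fun x => huv x y

theorem mixedNorm_const_mul_le {p q : ℝ≥0∞} {c : ℝ≥0∞}
    (hc : c ≠ ⊤) (u : X → Y → ℝ≥0∞) :
    mixedNorm μ ν p q (fun x y => c * u x y) ≤ c * mixedNorm μ ν p q u :=
  (eLpNorm_mono_enorm fun _ => eLpNorm_const_mul_le hc _).trans (eLpNorm_const_mul_le hc _)

theorem mixedNorm_mul_le {p q : ℝ≥0∞} {a : X → ℝ≥0∞} {b : Y → ℝ≥0∞} (hb : ∀ y, b y ≠ ⊤)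
    (ha : eLpNorm a p μ ≠ ⊤) :
    mixedNorm μ ν p q (fun x y => a x * b y) ≤ eLpNorm a p μ * eLpNorm b q ν := by
  refine (eLpNorm_mono_enorm fun y => ?_).trans (eLpNorm_const_mul_le ha b)
  simpa only [enorm_eq_self, mul_comm] using eLpNorm_const_mul_le (p := p) (μ := μ) (hb y) a

theorem mixedNorm_comp_add_right {G : Type*} [MeasurableSpace G] [AddGroup G] [MeasurableAdd G]
    {μ : Measure G} [μ.IsAddRightInvariant] {p q : ℝ≥0∞} (u : G → G → ℝ≥0∞) (a b : G) :
    mixedNorm μ μ p q (fun x y => u (x + a) (y + b)) = mixedNorm μ μ p q u :=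
  (congrArg (eLpNorm · q μ) (funext fun y => eLpNorm_comp_add_right (fun x => u x (y + b)) a)).trans
    (eLpNorm_comp_add_right (fun y => eLpNorm (fun x => u x y) p μ) b)

theorem mixedNorm_lintegral_le [SigmaFinite μ] [SigmaFinite ν] [SFinite τ] {h : X → Y → Z → ℝ≥0∞}
    (hh : Measurable fun w : (X × Y) × Z => h w.1.1 w.1.2 w.2) {p q : ℝ≥0∞} (hp : 1 ≤ p)
    (hpt : p ≠ ⊤) (hq : 1 ≤ q) (hqt : q ≠ ⊤) :
    mixedNorm μ ν p q (fun x y => ∫⁻ t, h x y t ∂τ) ≤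
      ∫⁻ t, mixedNorm μ ν p q (fun x y => h x y t) ∂τ := by
  refine (eLpNorm_mono_enorm fun y => ?_).trans (eLpNorm_lintegral_le
    (h := fun y t => eLpNorm (fun x => h x y t) p μ) ?_ hq hqt)
  · simp only [enorm_eq_self]
    exact eLpNorm_lintegral_le (h := fun x t => h x y t)
      (hh.comp (f := fun w : X × Z => ((w.1, y), w.2)) (by fun_prop)) hp hpt
  · exact measurable_eLpNorm_left (h := fun x (w : Y × Z) => h x w.1 w.2)
      (hh.comp (f := fun w : X × (Y × Z) => ((w.1, w.2.1), w.2.2)) (by fun_prop)) hpt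

theorem lintegral_prod_mul_le_mixedNorm [SFinite μ] [SFinite ν] {p q p' q' : ℝ≥0∞}
    [p.HolderConjugate p'] [q.HolderConjugate q'] {u v : X → Y → ℝ≥0∞}
    (hu : Measurable (Function.uncurry u)) (hv : Measurable (Function.uncurry v))
    (hu' : Measurable fun y => eLpNorm (fun x => u x y) p μ)
    (hv' : Measurable fun y => eLpNorm (fun x => v x y) p' μ) :
    ∫⁻ z, u z.1 z.2 * v z.1 z.2 ∂(μ.prod ν) ≤
      mixedNorm μ ν p q u * mixedNorm μ ν p' q' v := by
  rw [lintegral_prod_symm (fun z : X × Y => u z.1 z.2 * v z.1 z.2) (hu.mul hv).aemeasurable]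
  refine (lintegral_mono fun y => ?_).trans (lintegral_mul_le_eLpNorm_mul_eLpNorm hu' hv')
  exact lintegral_mul_le_eLpNorm_mul_eLpNorm
    (hu.comp measurable_prodMk_right) (hv.comp measurable_prodMk_right)

theorem ae_eLpNorm_lt_top_of_mixedNorm_ne_top [SFinite μ] {p q : ℝ≥0∞} (hpt : p ≠ ⊤)
    (hq0 : q ≠ 0) (hqt : q ≠ ⊤) {v : X → Y → ℝ≥0∞} (hvm : Measurable (Function.uncurry v))
    (hv : mixedNorm μ ν p q v ≠ ⊤) : ∀ᵐ y ∂ν, eLpNorm (fun x => v x y) p μ < ⊤ := by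
  filter_upwards [ae_lt_top ((measurable_eLpNorm_left hvm hpt).pow_const _)
    (lintegral_rpow_ne_top_of_eLpNorm_ne_top hq0 hqt hv)] with y hy
  exact (ENNReal.rpow_lt_top_iff_of_pos (ENNReal.toReal_pos hq0 hqt)).1 hy

theorem tendsto_mixedNorm_zero [SFinite μ] {p q : ℝ≥0∞} (hp0 : p ≠ 0) (hpt : p ≠ ⊤)
    (hq0 : q ≠ 0) (hqt : q ≠ ⊤) {u : ℕ → X → Y → ℝ≥0∞}
    (hu : ∀ n, Measurable (Function.uncurry (u n))) {v : X → Y → ℝ≥0∞}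
    (hvm : Measurable (Function.uncurry v)) (hv : mixedNorm μ ν p q v ≠ ⊤)
    (hle : ∀ n x y, u n x y ≤ v x y) (hlim : ∀ x y, Tendsto (fun n => u n x y) atTop (𝓝 0)) :
    Tendsto (fun n => mixedNorm μ ν p q (u n)) atTop (𝓝 0) := by
  refine tendsto_eLpNorm_zero hq0 hqt (fun n => measurable_eLpNorm_left (hu n) hpt) hv
    (fun n y => eLpNorm_mono_enorm fun x => hle n x y) ?_
  filter_upwards [ae_eLpNorm_lt_top_of_mixedNorm_ne_top hpt hq0 hqt hvm hv] with y hy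
  exact tendsto_eLpNorm_zero hp0 hpt (fun n => (hu n).comp measurable_prodMk_right) hy.ne
    (fun n x => hle n x y) (ae_of_all _ fun x => hlim x y)

end MixedNorm

/-! ### Weak integrals of Schwartz-valued maps -/

section WeakIntegral

/-- Hahn–Banach: a functional dominated by the seminorm `‖J ·‖` factors through `J`. -/
theorem exists_clm_comp_eq_of_norm_le {𝕜 V W : Type*} [RCLike 𝕜] [AddCommGroup V] [Module 𝕜 V]
    [NormedAddCommGroup W] [NormedSpace 𝕜 W] (J : V →ₗ[𝕜] W) (f : V →ₗ[𝕜] 𝕜) {C : ℝ}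
    (hf : ∀ u, ‖f u‖ ≤ C * ‖J u‖) : ∃ L : W →L[𝕜] 𝕜, ∀ u, f u = L (J u) := by
  obtain ⟨s, hs⟩ := J.rangeRestrict.exists_rightInverse_of_surjective J.range_rangeRestrict
  have hJs : ∀ w : LinearMap.range J, J (s w) = w := fun w =>
    congrArg Subtype.val (LinearMap.congr_fun hs w)
  let L₀ : LinearMap.range J →L[𝕜] 𝕜 :=
    (f ∘ₗ s).mkContinuous C fun w => (hf (s w)).trans_eq (by rw [hJs]; rfl)
  obtain ⟨L, hL, -⟩ := exists_extension_norm_eq (LinearMap.range J) L₀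
  refine ⟨L, fun u => ?_⟩
  set w : LinearMap.range J := ⟨J u, u, rfl⟩
  have hker : f (u - s w) = 0 := norm_le_zero_iff.1 <| (hf _).trans_eq <| by
    rw [map_sub, hJs, sub_self, norm_zero, mul_zero]
  rw [map_sub, sub_eq_zero] at hker
  exact hker.trans (hL w).symm

variable {E : Type*} [NormedAddCommGroup E] [NormedSpace ℝ E]

theorem continuous_schwartz_eval (y : E) : Continuous fun u : 𝓢(E, ℂ) => u y :=
  (BoundedContinuousFunction.evalCLM ℂ (β := ℂ) y).continuous.comp
    (SchwartzMap.toBoundedContinuousFunctionCLM ℂ E ℂ).continuous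

theorem continuous_schwartz_seminorm (k n : ℕ) :
    Continuous (SchwartzMap.seminorm ℂ k n : Seminorm ℂ 𝓢(E, ℂ)) :=
  (schwartz_withSeminorms ℂ E ℂ).continuous_seminorm (k, n)

theorem norm_weightedDeriv (k n : ℕ) (u : 𝓢(E, ℂ)) (y : E) :
    ‖(‖y‖ ^ k) • iteratedFDeriv ℝ n u y‖ = ‖y‖ ^ k * ‖iteratedFDeriv ℝ n u y‖ := by
  rw [norm_smul, norm_pow, norm_norm]

/-- The Banach space of bounded continuous functions on `E` with values in the `n`-linear forms. The
metric on the forms is spelled out because instance search finds one that is only defeq, and not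
reducibly so, to the metric of their norm. -/
abbrev BoundedForms (E : Type*) [NormedAddCommGroup E] [NormedSpace ℝ E] (n : ℕ) : Type _ :=
  @BoundedContinuousFunction E (E [×n]→L[ℝ] ℂ) _
    NormedAddCommGroup.toSeminormedAddCommGroup.toPseudoMetricSpace

/-- The weighted derivative `y ↦ ‖y‖ ^ k • D^n u(y)` of a Schwartz function, as a bounded continuous
function. Its sup norm is the Schwartz seminorm, so these maps embed `𝓢(E, ℂ)` into a family of
Banach spaces. -/
def weightedDeriv (k n : ℕ) : 𝓢(E, ℂ) →ₗ[ℂ] BoundedForms E n where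
  toFun u := BoundedContinuousFunction.ofNormedAddCommGroup
    (fun y => (‖y‖ ^ k) • iteratedFDeriv ℝ n u y)
    ((continuous_norm.pow k).smul ((u.smooth n).continuous_iteratedFDeriv le_rfl))
    (SchwartzMap.seminorm ℂ k n u)
    fun y => (norm_weightedDeriv k n u y).trans_le (SchwartzMap.le_seminorm ℂ k n u y)
  map_add' u v := by
    ext1 y
    simp [iteratedFDeriv_add_apply (u.contDiffAt n) (v.contDiffAt n)]
  map_smul' a u := by
    ext1 y
    simp [iteratedFDeriv_const_smul_apply (u.contDiffAt n), smul_comm a]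

theorem norm_weightedDeriv_eq_seminorm (k n : ℕ) (u : 𝓢(E, ℂ)) :
    ‖weightedDeriv k n u‖ = SchwartzMap.seminorm ℂ k n u := by
  refine le_antisymm ?_ (SchwartzMap.seminorm_le_bound ℂ k n u (norm_nonneg _) fun y => ?_)
  · exact BoundedContinuousFunction.norm_ofNormedAddCommGroup_le _ (apply_nonneg _ _) fun y =>
      (norm_weightedDeriv k n u y).trans_le (SchwartzMap.le_seminorm ℂ k n u y)
  · exact (norm_weightedDeriv k n u y).symm.trans_le ((weightedDeriv k n u).norm_coe_le_norm y)

theorem continuous_weightedDeriv (k n : ℕ) : Continuous (weightedDeriv k n : 𝓢(E, ℂ) → _) := by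
  refine continuous_of_continuousAt_zero (weightedDeriv (E := E) k n) ?_
  rw [ContinuousAt, map_zero, tendsto_zero_iff_norm_tendsto_zero]
  simpa only [norm_weightedDeriv_eq_seminorm, map_zero] using
    (continuous_schwartz_seminorm (E := E) k n).tendsto 0

theorem exists_factor_weightedDeriv (f : 𝓢(E, ℂ) →L[ℂ] ℂ) :
    ∃ (t : Finset (ℕ × ℕ))
      (L : (∀ i : t, BoundedForms E i.1.2) →L[ℂ] ℂ),
      ∀ u, f u = L fun i => weightedDeriv i.1.1 i.1.2 u := by
  obtain ⟨t, C, -, hC⟩ := Seminorm.bound_of_continuous (schwartz_withSeminorms ℂ E ℂ)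
    ((normSeminorm ℂ ℂ).comp f.toLinearMap) f.continuous.norm
  let J : 𝓢(E, ℂ) →ₗ[ℂ] ∀ i : t, BoundedForms E i.1.2 :=
    LinearMap.pi fun i => weightedDeriv i.1.1 i.1.2
  refine ⟨t, exists_clm_comp_eq_of_norm_le J f.toLinearMap (C := C) fun u => ?_⟩
  refine (hC u).trans (mul_le_mul_of_nonneg_left ?_ C.coe_nonneg)
  refine Seminorm.finset_sup_apply_le (norm_nonneg _) fun i hi => ?_
  exact (norm_weightedDeriv_eq_seminorm i.1 i.2 u).symm.trans_le (norm_le_pi_norm (J u) ⟨i, hi⟩)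

variable {Z : Type*} [TopologicalSpace Z] [MeasurableSpace Z] {μ : Measure Z} {G : Z → 𝓢(E, ℂ)}

/-- A continuous map into the Schwartz space all of whose continuous seminorms are integrable;
such maps have weak integrals, computed pointwise. -/
def SchwartzIntegrable (G : Z → 𝓢(E, ℂ)) (μ : Measure Z) : Prop :=
  Continuous G ∧ ∀ p : Seminorm ℂ 𝓢(E, ℂ), Continuous p → Integrable (fun z => p (G z)) μ

theorem SchwartzIntegrable.lineDerivOp (hG : SchwartzIntegrable G μ) (v : E) :
    SchwartzIntegrable (fun z => LineDeriv.lineDerivOp v (G z)) μ := by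
  have hc := (LineDeriv.lineDerivOpCLM ℂ 𝓢(E, ℂ) v).continuous
  exact ⟨hc.comp hG.1, fun p hp =>
    hG.2 (p.comp (LineDeriv.lineDerivOpCLM ℂ 𝓢(E, ℂ) v).toLinearMap) (hp.comp hc)⟩

variable [OpensMeasurableSpace Z]

theorem SchwartzIntegrable.integrable_eval (hG : SchwartzIntegrable G μ) (y : E) :
    Integrable (fun z => G z y) μ :=
  (hG.2 _ (continuous_schwartz_seminorm 0 0)).mono'
    ((continuous_schwartz_eval y).comp hG.1).aestronglyMeasurable
    (ae_of_all _ fun z => SchwartzMap.norm_le_seminorm ℂ (G z) y)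

theorem hasDerivAt_schwartz_line (u : 𝓢(E, ℂ)) (v y : E) (t : ℝ) :
    HasDerivAt (fun t : ℝ => u (y + t • v)) (LineDeriv.lineDerivOp v u (y + t • v)) t := by
  have hline : HasDerivAt (fun t : ℝ => y + t • v) v t := by
    simpa using ((hasDerivAt_id t).smul_const v).const_add y
  rw [SchwartzMap.lineDerivOp_apply_eq_fderiv]
  exact (u.hasFDerivAt (y + t • v)).comp_hasDerivAt t hline

theorem SchwartzIntegrable.integral_lineDerivOp (hG : SchwartzIntegrable G μ) {Ψ : 𝓢(E, ℂ)}
    (hΨ : ∀ y, ∫ z, G z y ∂μ = Ψ y) (v y : E) :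
    ∫ z, LineDeriv.lineDerivOp v (G z) y ∂μ = LineDeriv.lineDerivOp v Ψ y := by
  have hG' := hG.lineDerivOp v
  have hderiv := (hasDerivAt_integral_of_dominated_loc_of_deriv_le (μ := μ) (s := Set.univ)
    (F := fun (t : ℝ) z => G z (y + t • v)) (x₀ := 0)
    (F' := fun (t : ℝ) z => LineDeriv.lineDerivOp v (G z) (y + t • v)) Filter.univ_mem
    (Filter.Eventually.of_forall fun t => (hG.integrable_eval _).aestronglyMeasurable)
    (hG.integrable_eval _) (hG'.integrable_eval _).aestronglyMeasurable
    (ae_of_all _ fun z t _ => SchwartzMap.norm_le_seminorm ℂ _ _)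
    (hG'.2 _ (continuous_schwartz_seminorm 0 0))
    (ae_of_all _ fun z t _ => hasDerivAt_schwartz_line (G z) v y t)).2
  simp_rw [hΨ] at hderiv
  simpa only [zero_smul, add_zero] using hderiv.unique (hasDerivAt_schwartz_line Ψ v y 0)

theorem SchwartzIntegrable.iteratedLineDerivOp (hG : SchwartzIntegrable G μ) {Ψ : 𝓢(E, ℂ)}
    (hΨ : ∀ y, ∫ z, G z y ∂μ = Ψ y) {n : ℕ} (m : Fin n → E) :
    SchwartzIntegrable (fun z => LineDeriv.iteratedLineDerivOp m (G z)) μ ∧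
      ∀ y, ∫ z, LineDeriv.iteratedLineDerivOp m (G z) y ∂μ =
        LineDeriv.iteratedLineDerivOp m Ψ y := by
  induction n with
  | zero => simpa only [LineDeriv.iteratedLineDerivOp_fin_zero] using ⟨hG, hΨ⟩
  | succ n ih =>
    simp_rw [LineDeriv.iteratedLineDerivOp_succ_left]
    obtain ⟨hint, heq⟩ := ih (Fin.tail m)
    exact ⟨hint.lineDerivOp _, hint.integral_lineDerivOp heq _⟩

variable [SecondCountableTopology Z]

theorem SchwartzIntegrable.integrable_weightedDeriv (hG : SchwartzIntegrable G μ) (k n : ℕ) :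
    Integrable (fun z => weightedDeriv k n (G z)) μ :=
  (hG.2 _ (continuous_schwartz_seminorm k n)).mono'
    ((continuous_weightedDeriv k n).comp hG.1).aestronglyMeasurable
    (ae_of_all _ fun z => (norm_weightedDeriv_eq_seminorm k n (G z)).le)

theorem SchwartzIntegrable.integral_weightedDeriv (hG : SchwartzIntegrable G μ) {Ψ : 𝓢(E, ℂ)}
    (hΨ : ∀ y, ∫ z, G z y ∂μ = Ψ y) (k n : ℕ) :
    ∫ z, weightedDeriv k n (G z) ∂μ = weightedDeriv k n Ψ := by
  ext y m
  let eval : BoundedForms E n →L[ℝ] ℂ :=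
    (ContinuousMultilinearMap.apply ℝ (fun _ : Fin n => E) ℂ m).comp
      (BoundedContinuousFunction.evalCLM ℝ y)
  refine (eval.integral_comp_comm (hG.integrable_weightedDeriv k n)).symm.trans ?_
  change ∫ z, (‖y‖ ^ k) • iteratedFDeriv ℝ n (G z) y m ∂μ = (‖y‖ ^ k) • iteratedFDeriv ℝ n Ψ y m
  simp_rw [integral_smul, ← SchwartzMap.iteratedLineDerivOp_eq_iteratedFDeriv]
  rw [(hG.iteratedLineDerivOp hΨ m).2 y]

theorem SchwartzIntegrable.integrable_integral_apply (hG : SchwartzIntegrable G μ) {Ψ : 𝓢(E, ℂ)}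
    (hΨ : ∀ y, ∫ z, G z y ∂μ = Ψ y) (f : 𝓢(E, ℂ) →L[ℂ] ℂ) :
    Integrable (fun z => f (G z)) μ ∧ ∫ z, f (G z) ∂μ = f Ψ := by
  obtain ⟨t, L, hL⟩ := exists_factor_weightedDeriv f
  have hi : ∀ i : t, Integrable (fun z => weightedDeriv i.1.1 i.1.2 (G z)) μ := fun i =>
    hG.integrable_weightedDeriv _ _
  have hI : Integrable (fun z => fun i : t => weightedDeriv i.1.1 i.1.2 (G z)) μ :=
    Integrable.of_eval hi
  have heq : ∫ z, (fun i : t => weightedDeriv i.1.1 i.1.2 (G z)) ∂μ =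
      fun i : t => weightedDeriv i.1.1 i.1.2 Ψ :=
    funext fun i => (eval_integral hi i).trans (hG.integral_weightedDeriv hΨ _ _)
  simp_rw [hL]
  exact ⟨L.integrable_comp hI, by rw [L.integral_comp_comm hI, heq]⟩

end WeakIntegral

/-! ### Time-frequency shifts and the short-time Fourier transform of Schwartz functions -/

/-- A Schwartz function as a tempered distribution. -/
abbrev ofSchwartz (u : 𝓢(Rn d, ℂ)) : 𝓢'(Rn d, ℂ) :=
  SchwartzMap.toTemperedDistributionCLM (Rn d) ℂ volume u

theorem ofSchwartz_apply (u v : 𝓢(Rn d, ℂ)) : ofSchwartz u v = ∫ y, v y * u y := by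
  simp [SchwartzMap.toTemperedDistributionCLM_apply_apply]

theorem ofSchwartz_comm (u v : 𝓢(Rn d, ℂ)) : ofSchwartz u v = ofSchwartz v u := by
  rw [ofSchwartz_apply, ofSchwartz_apply]
  simp_rw [mul_comm]

theorem conjSchwartz_apply (g : 𝓢(Rn d, ℂ)) (y : Rn d) :
    conjSchwartz g y = (starRingEnd ℂ) (g y) := by
  simp [conjSchwartz, SchwartzMap.postcompCLM_apply]

theorem stftAtom_apply_eq_expNeg_mul (g : 𝓢(Rn d, ℂ)) (x ξ y : Rn d) :
    stftAtom g x ξ y = expNeg ξ y * conjSchwartz g (y - x) := by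
  rw [stftAtom_apply, conjSchwartz_apply, expNeg]

theorem norm_expNeg (ξ y : Rn d) : ‖expNeg ξ y‖ = 1 := by
  simp [expNeg, Complex.norm_exp]

theorem norm_stftAtom_apply (g : 𝓢(Rn d, ℂ)) (x ξ y : Rn d) :
    ‖stftAtom g x ξ y‖ = ‖g (y - x)‖ := by
  rw [stftAtom_apply_eq_expNeg_mul, norm_mul, norm_expNeg, one_mul, conjSchwartz_apply,
    RCLike.norm_conj]

theorem hasDerivAt_expNeg_line (ξ v y : Rn d) :
    HasDerivAt (fun t : ℝ => expNeg ξ (y + t • v))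
      (-(Complex.I * ((⟪v, ξ⟫_ℝ : ℝ) : ℂ)) * expNeg ξ y) 0 := by
  have hinner : HasDerivAt (fun t : ℝ => ⟪y + t • v, ξ⟫_ℝ) ⟪v, ξ⟫_ℝ 0 := by
    simp only [inner_add_left, real_inner_smul_left]
    simpa using ((hasDerivAt_id (0 : ℝ)).mul_const ⟪v, ξ⟫_ℝ).const_add ⟪y, ξ⟫_ℝ
  simpa [expNeg, mul_comm] using ((hinner.ofReal_comp.const_mul Complex.I).fun_neg).cexp

theorem lineDerivOp_stftAtom (g : 𝓢(Rn d, ℂ)) (x ξ v : Rn d) :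
    LineDeriv.lineDerivOp v (stftAtom g x ξ) =
      (-(Complex.I * ((⟪v, ξ⟫_ℝ : ℝ) : ℂ))) • stftAtom g x ξ +
        stftAtom (LineDeriv.lineDerivOp v g) x ξ := by
  ext y
  have hconj : HasDerivAt (fun t : ℝ => conjSchwartz g (y + t • v - x))
      (conjSchwartz (LineDeriv.lineDerivOp v g) (y - x)) 0 := by
    simpa [conjSchwartz_apply, add_sub_right_comm] using
      (hasDerivAt_schwartz_line g v (y - x) 0).star
  have hatom := hasDerivAt_schwartz_line (stftAtom g x ξ) v y 0
  simp only [stftAtom_apply_eq_expNeg_mul, zero_smul, add_zero] at hatom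
  rw [hatom.unique ((hasDerivAt_expNeg_line ξ v y).fun_mul hconj)]
  simp [stftAtom_apply_eq_expNeg_mul, mul_assoc]

theorem inner_mul_stft_ofSchwartz (g u : 𝓢(Rn d, ℂ)) (x ξ v : Rn d) :
    Complex.I * ((⟪v, ξ⟫_ℝ : ℝ) : ℂ) * stft g (ofSchwartz u) x ξ =
      stft g (ofSchwartz (LineDeriv.lineDerivOp v u)) x ξ +
        stft (LineDeriv.lineDerivOp v g) (ofSchwartz u) x ξ := by
  have hparts := SchwartzMap.integral_mul_lineDerivOp_right_eq_neg_left (μ := volume)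
    (stftAtom g x ξ) u v
  rw [← ofSchwartz_apply, ← ofSchwartz_apply, lineDerivOp_stftAtom, map_add, map_smul,
    smul_eq_mul] at hparts
  simp only [stft]
  rw [hparts]
  ring

theorem one_add_norm_sub_le {E : Type*} [SeminormedAddCommGroup E] (x y : E) :
    1 + ‖x - y‖ ≤ (1 + ‖x‖) * (1 + ‖y‖) := by
  nlinarith [norm_sub_le x y, norm_nonneg x, norm_nonneg y,
    mul_nonneg (norm_nonneg x) (norm_nonneg y)]

theorem norm_le_sum_abs (ξ : Rn d) : ‖ξ‖ ≤ ∑ i, |ξ i| := by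
  let e := EuclideanSpace.basisFun (Fin d) ℝ
  calc ‖ξ‖ = ‖∑ i, e.repr ξ i • e i‖ := by rw [e.sum_repr]
    _ ≤ ∑ i, ‖e.repr ξ i • e i‖ := norm_sum_le _ _
    _ = _ := by simp [e, norm_smul]

theorem integrable_inv_one_add_norm_pow :
    Integrable (fun y : Rn d => ((1 + ‖y‖) ^ (d + 1))⁻¹) := by
  refine (integrable_one_add_norm (E := Rn d) (r := (d + 1 : ℝ)) (by simp)).congr
    (ae_of_all _ fun y => ?_)
  dsimp only
  rw [Real.rpow_neg (by positivity)]
  norm_cast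

theorem exists_seminorm_one_add_norm_pow_mul_norm_le (K : ℕ) :
    ∃ p : Seminorm ℂ 𝓢(Rn d, ℂ), Continuous p ∧ ∀ u y, (1 + ‖y‖) ^ K * ‖u y‖ ≤ p u := by
  refine ⟨(2 ^ K : NNReal) • (Finset.Iic (K, 0)).sup fun m => SchwartzMap.seminorm ℂ m.1 m.2,
    (Seminorm.continuous_finsetSup fun i _ => continuous_schwartz_seminorm i.1 i.2).const_smul _,
    fun u y => ?_⟩
  simpa [NNReal.smul_def] using SchwartzMap.one_add_le_sup_seminorm_apply (𝕜 := ℂ) (m := (K, 0))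
    le_rfl le_rfl u y

theorem exists_seminorm_stft_decay_left (K : ℕ) (g : 𝓢(Rn d, ℂ)) :
    ∃ p : Seminorm ℂ 𝓢(Rn d, ℂ), Continuous p ∧ ∀ u x ξ,
      (1 + ‖x‖) ^ K * ‖stft g (ofSchwartz u) x ξ‖ ≤ p u := by
  obtain ⟨q, -, hq⟩ := exists_seminorm_one_add_norm_pow_mul_norm_le (d := d) K
  obtain ⟨r, hr, hrb⟩ := exists_seminorm_one_add_norm_pow_mul_norm_le (d := d) (K + (d + 1))
  set I := ∫ y : Rn d, ((1 + ‖y‖) ^ (d + 1))⁻¹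
  have hI : 0 ≤ I := integral_nonneg fun y => by positivity
  have hqI : 0 ≤ q g * I := mul_nonneg (apply_nonneg q g) hI
  refine ⟨Real.toNNReal (q g * I) • r, hr.const_smul (Real.toNNReal (q g * I)), fun u x ξ => ?_⟩
  have hpoint : ∀ y, (1 + ‖x‖) ^ K * ‖stftAtom g x ξ y * u y‖ ≤
      q g * r u * ((1 + ‖y‖) ^ (d + 1))⁻¹ := fun y => by
    rw [norm_mul, norm_stftAtom_apply, ← div_eq_mul_inv, le_div_iff₀ (by positivity)]
    calc (1 + ‖x‖) ^ K * (‖g (y - x)‖ * ‖u y‖) * (1 + ‖y‖) ^ (d + 1)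
        ≤ ((1 + ‖y‖) * (1 + ‖y - x‖)) ^ K * (‖g (y - x)‖ * ‖u y‖) * (1 + ‖y‖) ^ (d + 1) := by
          gcongr
          simpa using one_add_norm_sub_le y (y - x)
      _ = (1 + ‖y - x‖) ^ K * ‖g (y - x)‖ * ((1 + ‖y‖) ^ (K + (d + 1)) * ‖u y‖) := by
        rw [mul_pow]; ring
      _ ≤ q g * r u := mul_le_mul (hq g _) (hrb u y) (by positivity) (apply_nonneg q g)
  rw [stft, ofSchwartz_apply]
  calc (1 + ‖x‖) ^ K * ‖∫ y, stftAtom g x ξ y * u y‖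
      ≤ (1 + ‖x‖) ^ K * ∫ y, ‖stftAtom g x ξ y * u y‖ := by
        gcongr
        exact norm_integral_le_integral_norm _
    _ = ∫ y, (1 + ‖x‖) ^ K * ‖stftAtom g x ξ y * u y‖ := (integral_const_mul _ _).symm
    _ ≤ ∫ y, q g * r u * ((1 + ‖y‖) ^ (d + 1))⁻¹ :=
        integral_mono_of_nonneg (ae_of_all _ fun y => by positivity)
          (integrable_inv_one_add_norm_pow.const_mul _) (ae_of_all _ hpoint)
    _ = q g * I * r u := by rw [integral_const_mul]; ring
    _ = (Real.toNNReal (q g * I) • r) u := by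
        rw [smul_apply, NNReal.smul_def, Real.coe_toNNReal _ hqI, smul_eq_mul]

/-- Multiplication by `i ξⱼ` moves a derivative onto the function and onto the window, so decay in
`ξ` reduces to decay in `x`. -/
theorem exists_seminorm_stft_decay (K N : ℕ) (g : 𝓢(Rn d, ℂ)) :
    ∃ p : Seminorm ℂ 𝓢(Rn d, ℂ), Continuous p ∧ ∀ u x ξ,
      (1 + ‖x‖) ^ K * (1 + ‖ξ‖) ^ N * ‖stft g (ofSchwartz u) x ξ‖ ≤ p u := by
  induction N generalizing g with
  | zero => simpa using exists_seminorm_stft_decay_left K g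
  | succ N ih =>
    obtain ⟨p, hp, hpb⟩ := ih g
    let e := fun i => EuclideanSpace.basisFun (Fin d) ℝ i
    choose r hr hrb using fun i : Fin d => ih (LineDeriv.lineDerivOp (e i) g)
    let D := fun i => LineDeriv.lineDerivOpCLM ℂ 𝓢(Rn d, ℂ) (e i)
    let pD := fun i => p.comp (D i).toLinearMap + r i
    refine ⟨p + ∑ i, pD i, hp.add
      (Seminorm.continuous_finsetSum fun i _ => (hp.comp (D i).continuous).add (hr i)),
      fun u x ξ => ?_⟩
    set w := (1 + ‖x‖) ^ K * (1 + ‖ξ‖) ^ N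
    set V := stft g (ofSchwartz u) x ξ
    have hcoord : ∀ i, w * (|ξ i| * ‖V‖) ≤ pD i u := fun i => by
      have hmul : |ξ i| * ‖V‖ = ‖stft g (ofSchwartz (LineDeriv.lineDerivOp (e i) u)) x ξ +
          stft (LineDeriv.lineDerivOp (e i) g) (ofSchwartz u) x ξ‖ := by
        rw [← inner_mul_stft_ofSchwartz]
        simp [e, V, EuclideanSpace.inner_single_left]
      rw [hmul]
      refine (mul_le_mul_of_nonneg_left (norm_add_le _ _) (by positivity)).trans ?_
      rw [mul_add]
      exact add_le_add (hpb _ x ξ) (hrb i u x ξ)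
    calc (1 + ‖x‖) ^ K * (1 + ‖ξ‖) ^ (N + 1) * ‖V‖ = w * ((1 + ‖ξ‖) * ‖V‖) := by ring
      _ ≤ w * ((1 + ∑ i, |ξ i|) * ‖V‖) := by
          gcongr
          exact norm_le_sum_abs ξ
      _ = w * ‖V‖ + ∑ i, w * (|ξ i| * ‖V‖) := by rw [← Finset.mul_sum, ← Finset.sum_mul]; ring
      _ ≤ p u + ∑ i, pD i u := add_le_add (hpb u x ξ) (Finset.sum_le_sum fun i _ => hcoord i)
      _ = (p + ∑ i, pD i) u := by
          rw [add_apply, sum_apply]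

theorem exists_norm_pow_mul_iteratedFDeriv_comp_sub_le (h : 𝓢(Rn d, ℂ)) (K n : ℕ) :
    ∃ C : ℝ, 0 ≤ C ∧ ∀ j ≤ n, ∀ x y : Rn d,
      ‖y‖ ^ K * ‖iteratedFDeriv ℝ j (fun z => h (z - x)) y‖ ≤ C * (1 + ‖x‖) ^ K := by
  refine ⟨2 ^ K * (Finset.Iic (K, n)).sup (fun m => SchwartzMap.seminorm ℂ m.1 m.2) h,
    by positivity, fun j hj x y => ?_⟩
  have hh := SchwartzMap.one_add_le_sup_seminorm_apply (𝕜 := ℂ) (m := (K, n)) le_rfl hj h (y - x)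
  have hy : ‖y‖ ≤ (1 + ‖y - x‖) * (1 + ‖x‖) := by
    have := one_add_norm_sub_le (y - x) (-x)
    rw [sub_neg_eq_add, sub_add_cancel, norm_neg] at this
    linarith
  rw [iteratedFDeriv_comp_sub]
  calc ‖y‖ ^ K * ‖iteratedFDeriv ℝ j h (y - x)‖
      ≤ ((1 + ‖y - x‖) * (1 + ‖x‖)) ^ K * ‖iteratedFDeriv ℝ j h (y - x)‖ := by gcongr
    _ = (1 + ‖y - x‖) ^ K * ‖iteratedFDeriv ℝ j h (y - x)‖ * (1 + ‖x‖) ^ K := by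
        rw [mul_pow]; ring
    _ ≤ _ := by gcongr

theorem exists_schwartz_seminorm_stftAtom_le (g : 𝓢(Rn d, ℂ)) (K n : ℕ) :
    ∃ C : ℝ, 0 ≤ C ∧ ∀ x ξ : Rn d,
      SchwartzMap.seminorm ℂ K n (stftAtom g x ξ) ≤ C * ((1 + ‖x‖) ^ K * (1 + ‖ξ‖) ^ n) := by
  set h := conjSchwartz g
  obtain ⟨S, hS, hSb⟩ := exists_norm_pow_mul_iteratedFDeriv_comp_sub_le h K n
  refine ⟨∑ i ∈ Finset.range (n + 1), (n.choose i : ℝ) * S, by positivity, fun x ξ => ?_⟩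
  refine SchwartzMap.seminorm_le_bound ℂ K n _ (by positivity) fun y => ?_
  rw [funext (stftAtom_apply_eq_expNeg_mul g x ξ), Finset.sum_mul]
  have hphase : ∀ i ≤ n, ‖iteratedFDeriv ℝ i (expNeg ξ) y‖ ≤ (1 + ‖ξ‖) ^ n := fun i hi =>
    calc _ ≤ ‖ξ‖ ^ i := norm_iteratedFDeriv_expNeg_le ξ i y
      _ ≤ (1 + ‖ξ‖) ^ i := by gcongr; linarith
      _ ≤ (1 + ‖ξ‖) ^ n := pow_le_pow_right₀ (by linarith [norm_nonneg ξ]) hi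
  have hsmooth : ContDiff ℝ ∞ fun y => h (y - x) :=
    (h.smooth ⊤).comp (contDiff_id.sub contDiff_const)
  have hleibniz := norm_iteratedFDeriv_mul_le (contDiff_expNeg ξ) hsmooth y (n := n)
    (by exact_mod_cast le_top)
  refine (mul_le_mul_of_nonneg_left hleibniz (by positivity)).trans ?_
  rw [Finset.mul_sum]
  refine Finset.sum_le_sum fun i hi => ?_
  have hin : i ≤ n := by simpa [Nat.lt_succ_iff] using hi
  calc _ = (n.choose i : ℝ) * (‖iteratedFDeriv ℝ i (expNeg ξ) y‖ *
        (‖y‖ ^ K * ‖iteratedFDeriv ℝ (n - i) (fun y => h (y - x)) y‖)) := by ring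
    _ ≤ (n.choose i : ℝ) * ((1 + ‖ξ‖) ^ n * (S * (1 + ‖x‖) ^ K)) :=
        mul_le_mul_of_nonneg_left (mul_le_mul (hphase i hin) (hSb _ (Nat.sub_le n i) x y)
          (by positivity) (by positivity)) (Nat.cast_nonneg _)
    _ = _ := by ring

/-- The weight `(1 + |x|)^N (1 + |ξ|)^N` on phase space, which measures decay and growth in both
variables at once. -/
def phaseWeight (N : ℕ) (x ξ : Rn d) : ℝ := (1 + ‖x‖) ^ N * (1 + ‖ξ‖) ^ N

theorem phaseWeight_pos (N : ℕ) (x ξ : Rn d) : 0 < phaseWeight N x ξ := by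
  unfold phaseWeight; positivity

theorem phaseWeight_add (M N : ℕ) (x ξ : Rn d) :
    phaseWeight (M + N) x ξ = phaseWeight M x ξ * phaseWeight N x ξ := by
  unfold phaseWeight; ring

theorem pow_mul_pow_le_phaseWeight {k n N : ℕ} (hk : k ≤ N) (hn : n ≤ N) (x ξ : Rn d) :
    (1 + ‖x‖) ^ k * (1 + ‖ξ‖) ^ n ≤ phaseWeight N x ξ := by
  unfold phaseWeight
  gcongr <;> linarith [norm_nonneg x, norm_nonneg ξ]

theorem phaseWeight_neg (N : ℕ) (x ξ : Rn d) : phaseWeight N x (-ξ) = phaseWeight N x ξ := by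
  simp [phaseWeight]

theorem integrable_phaseWeight_inv :
    Integrable (fun z : Rn d × Rn d => (phaseWeight (d + 1) z.1 z.2)⁻¹) volume := by
  simpa only [phaseWeight, mul_inv, ← Measure.volume_eq_prod] using
    (integrable_inv_one_add_norm_pow (d := d)).mul_prod integrable_inv_one_add_norm_pow

theorem exists_seminorm_stftAtom_growth (g : 𝓢(Rn d, ℂ)) (p : Seminorm ℂ 𝓢(Rn d, ℂ))
    (hp : Continuous p) :
    ∃ (C : ℝ) (N : ℕ), ∀ x ξ : Rn d, p (stftAtom g x ξ) ≤ C * phaseWeight N x ξ := by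
  obtain ⟨t, C, -, hC⟩ := Seminorm.bound_of_continuous (schwartz_withSeminorms ℂ (Rn d) ℂ) p hp
  choose D hD₀ hD using fun i : ℕ × ℕ => exists_schwartz_seminorm_stftAtom_le g i.1 i.2
  have hsum : 0 ≤ ∑ i ∈ t, D i := Finset.sum_nonneg fun i _ => hD₀ i
  set N := ∑ i ∈ t, (i.1 + i.2)
  refine ⟨C * ∑ i ∈ t, D i, N, fun x ξ => (hC _).trans ?_⟩
  rw [smul_apply, NNReal.smul_def, smul_eq_mul, mul_assoc]
  gcongr
  refine Seminorm.finset_sup_apply_le (mul_nonneg hsum (phaseWeight_pos _ _ _).le) fun i hi => ?_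
  have hN : i.1 + i.2 ≤ N :=
    Finset.single_le_sum (f := fun i : ℕ × ℕ => i.1 + i.2) (fun i _ => Nat.zero_le _) hi
  exact (hD i x ξ).trans (mul_le_mul (Finset.single_le_sum (fun i _ => hD₀ i) hi)
    (pow_mul_pow_le_phaseWeight (by lia) (by lia) x ξ) (by positivity) hsum)

theorem exists_stft_decay (N : ℕ) (g : 𝓢(Rn d, ℂ)) :
    ∃ p : Seminorm ℂ 𝓢(Rn d, ℂ), Continuous p ∧ ∀ u x ξ,
      ‖stft g (ofSchwartz u) x ξ‖ ≤ p u * (phaseWeight N x ξ)⁻¹ := by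
  obtain ⟨p, hp, h⟩ := exists_seminorm_stft_decay N N g
  refine ⟨p, hp, fun u x ξ => ?_⟩
  rw [← div_eq_mul_inv, le_div_iff₀ (phaseWeight_pos N x ξ), mul_comm]
  exact h u x ξ

/-! ### Inversion of the short-time Fourier transform -/

/-- The time-frequency shift `y ↦ exp (i y · ξ) g (y - x)` of the window, written as the conjugate
of `stftAtom g x ξ`. -/
def gaborAtom (g : 𝓢(Rn d, ℂ)) (x ξ : Rn d) : 𝓢(Rn d, ℂ) := stftAtom (conjSchwartz g) x (-ξ)

theorem gaborAtom_apply (g : 𝓢(Rn d, ℂ)) (x ξ y : Rn d) :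
    gaborAtom g x ξ y = Complex.exp (Complex.I * ((⟪y, ξ⟫_ℝ : ℝ) : ℂ)) * g (y - x) := by
  rw [gaborAtom, stftAtom_apply, conjSchwartz_apply]
  simp [inner_neg_right]

theorem conj_stftAtom_apply (g : 𝓢(Rn d, ℂ)) (x ξ y : Rn d) :
    (starRingEnd ℂ) (stftAtom g x ξ y) = gaborAtom g x ξ y := by
  rw [gaborAtom_apply, stftAtom_apply, map_mul, ← Complex.exp_conj]
  simp

theorem continuous_gaborAtom (g : 𝓢(Rn d, ℂ)) :
    Continuous fun z : Rn d × Rn d => gaborAtom g z.1 z.2 :=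
  (continuous_stftAtom (conjSchwartz g)).comp
    (f := fun z : Rn d × Rn d => (z.1, -z.2)) (by fun_prop)

theorem exists_gabor_decay (N : ℕ) (g : 𝓢(Rn d, ℂ)) :
    ∃ p : Seminorm ℂ 𝓢(Rn d, ℂ), Continuous p ∧ ∀ u x ξ,
      ‖ofSchwartz u (gaborAtom g x ξ)‖ ≤ p u * (phaseWeight N x ξ)⁻¹ := by
  obtain ⟨p, hp, h⟩ := exists_stft_decay N (conjSchwartz g)
  exact ⟨p, hp, fun u x ξ => (h u x (-ξ)).trans_eq (by rw [phaseWeight_neg])⟩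

theorem continuous_ofSchwartz_gaborAtom (g u : 𝓢(Rn d, ℂ)) :
    Continuous fun z : Rn d × Rn d => ofSchwartz u (gaborAtom g z.1 z.2) :=
  (ofSchwartz u).continuous.comp (continuous_gaborAtom g)

theorem schwartzIntegrable_smul_stftAtom (g u : 𝓢(Rn d, ℂ)) :
    SchwartzIntegrable
      (fun z : Rn d × Rn d => ofSchwartz u (gaborAtom g z.1 z.2) • stftAtom g z.1 z.2) volume := by
  have hcont := (continuous_ofSchwartz_gaborAtom g u).smul (continuous_stftAtom g)
  refine ⟨hcont, fun p hp => ?_⟩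
  obtain ⟨C, N, hN⟩ := exists_seminorm_stftAtom_growth g p hp
  obtain ⟨r, -, hrb⟩ := exists_gabor_decay (N + (d + 1)) g
  refine (integrable_phaseWeight_inv.const_mul (r u * C)).mono'
    (hp.comp hcont).aestronglyMeasurable (ae_of_all _ fun z => ?_)
  have hpos := phaseWeight_pos N z.1 z.2
  rw [Real.norm_of_nonneg (apply_nonneg _ _), map_smul_eq_mul]
  calc _ ≤ (r u * (phaseWeight (N + (d + 1)) z.1 z.2)⁻¹) * (C * phaseWeight N z.1 z.2) :=
        mul_le_mul (hrb u z.1 z.2) (hN z.1 z.2) (apply_nonneg _ _)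
          ((norm_nonneg _).trans (hrb u z.1 z.2))
    _ = _ := by
        rw [phaseWeight_add]
        field_simp

theorem integral_norm_sq_pos {g : 𝓢(Rn d, ℂ)} (hg : g ≠ 0) : 0 < ∫ y, ‖g y‖ ^ 2 := by
  have hint : Integrable (fun y => ‖g y‖ ^ 2) (volume : Measure (Rn d)) :=
    (memLp_two_iff_integrable_sq_norm g.continuous.aestronglyMeasurable).1 (g.memLp 2 volume)
  obtain ⟨y, hy⟩ : ∃ y, g y ≠ 0 := DFunLike.ne_iff.1 hg
  exact integral_pos_of_integrable_nonneg_nonzero (by fun_prop) hint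
    (fun _ => by positivity) (x := y) (by positivity)

/-- The constant `(2π)^d ‖g‖²` of the inversion formula. -/
def inversionConst (g : 𝓢(Rn d, ℂ)) : ℝ := (2 * Real.pi) ^ d * ∫ y, ‖g y‖ ^ 2

theorem inversionConst_pos {g : 𝓢(Rn d, ℂ)} (hg : g ≠ 0) : 0 < inversionConst g :=
  mul_pos (by positivity) (integral_norm_sq_pos hg)

/-- Mathlib's Fourier transform has `2π` in the exponent; rescaling the frequency by `2π` produces
the factor `(2π)^d`. -/
theorem integral_integral_exp_mul_exp_neg (w : 𝓢(Rn d, ℂ)) (y : Rn d) :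
    ∫ ξ : Rn d, (∫ t, Complex.exp (Complex.I * ((⟪t, ξ⟫_ℝ : ℝ) : ℂ)) * w t) *
      Complex.exp (-(Complex.I * ((⟪y, ξ⟫_ℝ : ℝ) : ℂ))) = (2 * Real.pi) ^ d * w y := by
  set J : Rn d → ℂ := fun ξ => (∫ t, Complex.exp (Complex.I * ((⟪t, ξ⟫_ℝ : ℝ) : ℂ)) * w t) *
    Complex.exp (-(Complex.I * ((⟪y, ξ⟫_ℝ : ℝ) : ℂ)))
  have hinner : ∀ ξ : Rn d, ∫ t, Complex.exp (Complex.I * ((⟪t, (2 * Real.pi) • ξ⟫_ℝ : ℝ) : ℂ)) *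
      w t = FourierTransformInv.fourierInv w ξ := fun ξ => by
    rw [SchwartzMap.fourierInv_coe, Real.fourierInv_eq']
    refine integral_congr_ae (ae_of_all _ fun t => ?_)
    simp only [smul_eq_mul, real_inner_smul_right]
    congr 2
    push_cast; ring
  have houter : ∫ ξ, J ((2 * Real.pi) • ξ) = w y := by
    have hinv : FourierTransform.fourier (FourierTransformInv.fourierInv w) y = w y := by
      rw [FourierTransform.fourier_fourierInv_eq]
    rw [SchwartzMap.fourier_coe, Real.fourier_eq'] at hinv
    simp only [J, hinner]
    rw [← hinv]
    refine integral_congr_ae (ae_of_all _ fun t => ?_)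
    simp only [smul_eq_mul, real_inner_smul_right]
    rw [mul_comm, real_inner_comm]
    congr 2
    push_cast; ring
  have hscale := Measure.integral_comp_smul (volume : Measure (Rn d)) J (2 * Real.pi)
  rw [houter, finrank_euclideanSpace_fin, abs_of_pos (by positivity), Complex.real_smul] at hscale
  rw [hscale]
  push_cast
  rw [mul_inv_cancel_left₀ (by simp [Real.pi_ne_zero])]

theorem integral_gaborAtom_mul_stftAtom_apply (g u : 𝓢(Rn d, ℂ)) (x y : Rn d) :
    ∫ ξ, ofSchwartz u (gaborAtom g x ξ) * stftAtom g x ξ y =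
      ((2 * Real.pi) ^ d * u y) * ((‖g (y - x)‖ ^ 2 : ℝ) : ℂ) := by
  let w : 𝓢(Rn d, ℂ) := SchwartzMap.smulLeftCLM ℂ u (SchwartzMap.compSubConstCLM ℂ x g)
  have hw : ∀ t, w t = u t * g (t - x) := fun t => by
    simp [w, SchwartzMap.smulLeftCLM_apply_apply u.hasTemperateGrowth]
  have hatom : ∀ ξ, ofSchwartz u (gaborAtom g x ξ) * stftAtom g x ξ y =
      ((∫ t, Complex.exp (Complex.I * ((⟪t, ξ⟫_ℝ : ℝ) : ℂ)) * w t) *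
        Complex.exp (-(Complex.I * ((⟪y, ξ⟫_ℝ : ℝ) : ℂ)))) * (starRingEnd ℂ) (g (y - x)) := by
    intro ξ
    rw [ofSchwartz_apply, stftAtom_apply, ← mul_assoc]
    simp only [gaborAtom_apply, hw, mul_assoc, mul_comm (g _)]
  simp_rw [hatom]
  rw [integral_mul_const, integral_integral_exp_mul_exp_neg, hw, Complex.ofReal_pow,
    ← Complex.mul_conj']
  ring

theorem integral_integral_gaborAtom_mul_stftAtom_apply (g u : 𝓢(Rn d, ℂ)) (y : Rn d) :
    ∫ z : Rn d × Rn d, ofSchwartz u (gaborAtom g z.1 z.2) * stftAtom g z.1 z.2 y =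
      inversionConst g * u y := by
  have hint := (schwartzIntegrable_smul_stftAtom g u).integrable_eval y
  simp only [smul_apply, smul_eq_mul] at hint
  rw [Measure.volume_eq_prod] at hint ⊢
  rw [integral_prod _ hint]
  simp only [integral_gaborAtom_mul_stftAtom_apply]
  rw [integral_const_mul, integral_sub_left_eq_self (fun t => ((‖g t‖ ^ 2 : ℝ) : ℂ)) volume y,
    integral_complex_ofReal, inversionConst]
  push_cast
  ring

theorem stft_inversion (g : 𝓢(Rn d, ℂ)) (f : 𝓢'(Rn d, ℂ)) (u : 𝓢(Rn d, ℂ)) :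
    Integrable (fun z : Rn d × Rn d => stft g f z.1 z.2 * ofSchwartz u (gaborAtom g z.1 z.2)) ∧
    ∫ z : Rn d × Rn d, stft g f z.1 z.2 * ofSchwartz u (gaborAtom g z.1 z.2) =
      inversionConst g * f u := by
  let f' : 𝓢(Rn d, ℂ) →L[ℂ] ℂ := ⟨f.toLinearMap, f.continuous⟩
  have hf : ∀ v, f' v = f v := fun _ => rfl
  have hweak := (schwartzIntegrable_smul_stftAtom g u).integrable_integral_apply
    (Ψ := (inversionConst g : ℂ) • u)
    (fun y => by simpa using integral_integral_gaborAtom_mul_stftAtom_apply g u y) f'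
  simp only [map_smul, hf, smul_eq_mul] at hweak
  simpa only [stft, mul_comm] using hweak

theorem eq_zero_of_stft_eq_zero {g : 𝓢(Rn d, ℂ)} (hg : g ≠ 0) {f : 𝓢'(Rn d, ℂ)}
    (hf : ∀ x ξ, stft g f x ξ = 0) : f = 0 := by
  ext u
  have hinv := (stft_inversion g f u).2
  simpa [hf, (inversionConst_pos hg).ne'] using hinv

/-! ### The weights and the modulation norm -/

theorem polyWeight_pos (s : ℝ) (x ξ : Rn d) : 0 < polyWeight s x ξ := by
  unfold polyWeight; positivity

theorem polyWeight_mul_neg (s : ℝ) (x ξ : Rn d) : polyWeight s x ξ * polyWeight (-s) x ξ = 1 := by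
  unfold polyWeight
  rw [← Real.rpow_add (by positivity)]
  simp [neg_div]

theorem polyWeight_le_phaseWeight (s : ℝ) (x ξ : Rn d) :
    polyWeight s x ξ ≤ phaseWeight ⌈|s|⌉₊ x ξ := by
  set k := ⌈|s|⌉₊
  have hs : s ≤ k := (le_abs_self s).trans (Nat.le_ceil _)
  have hone : (1 : ℝ) ≤ 1 + ‖x‖ ^ 2 + ‖ξ‖ ^ 2 := by linarith [sq_nonneg ‖x‖, sq_nonneg ‖ξ‖]
  have hsq : 1 + ‖x‖ ^ 2 + ‖ξ‖ ^ 2 ≤ ((1 + ‖x‖) * (1 + ‖ξ‖)) ^ 2 := by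
    have : 0 ≤ 2 * ‖x‖ + 2 * ‖ξ‖ + 4 * (‖x‖ * ‖ξ‖) + (‖x‖ * ‖ξ‖) ^ 2 +
        2 * (‖x‖ ^ 2 * ‖ξ‖) + 2 * (‖x‖ * ‖ξ‖ ^ 2) := by positivity
    linarith
  calc polyWeight s x ξ ≤ (1 + ‖x‖ ^ 2 + ‖ξ‖ ^ 2) ^ ((k : ℝ) / 2) :=
        Real.rpow_le_rpow_of_exponent_le hone (by linarith)
    _ ≤ (((1 + ‖x‖) * (1 + ‖ξ‖)) ^ 2) ^ ((k : ℝ) / 2) := by gcongr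
    _ = ((1 + ‖x‖) * (1 + ‖ξ‖)) ^ k := by
        rw [← Real.rpow_natCast _ 2, ← Real.rpow_mul (by positivity), ← Real.rpow_natCast _ k]
        congr 1
        push_cast; ring
    _ = phaseWeight k x ξ := mul_pow ..

theorem sq_norm_le_two_mul_sq_norm_add {E : Type*} [SeminormedAddCommGroup E] (y w : E) :
    ‖y‖ ^ 2 ≤ 2 * ‖w‖ ^ 2 + 2 * ‖y + w‖ ^ 2 := by
  have htri : ‖y‖ ≤ ‖y + w‖ + ‖w‖ := by simpa using norm_sub_le (y + w) w
  nlinarith [norm_nonneg y, sq_nonneg (‖y + w‖ - ‖w‖)]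

theorem polyWeight_le_mul_of_nonneg {s : ℝ} (hs : 0 ≤ s) (x ξ a b : Rn d) :
    polyWeight s x ξ ≤ 2 ^ (s / 2) * polyWeight s a b * polyWeight s (x + a) (ξ + b) := by
  unfold polyWeight
  rw [← Real.mul_rpow (by positivity) (by positivity),
    ← Real.mul_rpow (by positivity) (by positivity)]
  refine Real.rpow_le_rpow (by positivity) ?_ (by linarith)
  have hprod : 0 ≤ (‖a‖ ^ 2 + ‖b‖ ^ 2) * (‖x + a‖ ^ 2 + ‖ξ + b‖ ^ 2) := by positivity
  linarith [sq_norm_le_two_mul_sq_norm_add x a, sq_norm_le_two_mul_sq_norm_add ξ b]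

/-- Peetre's inequality. -/
theorem polyWeight_le_mul (s : ℝ) (x ξ a b : Rn d) :
    polyWeight s x ξ ≤ 2 ^ (|s| / 2) * polyWeight |s| a b * polyWeight s (x + a) (ξ + b) := by
  rcases le_total 0 s with hs | hs
  · simpa only [abs_of_nonneg hs] using polyWeight_le_mul_of_nonneg hs x ξ a b
  have hinv := polyWeight_mul_neg s x ξ
  have hinv' := polyWeight_mul_neg s (x + a) (ξ + b)
  have hneg : polyWeight (-s) (x + a) (ξ + b) ≤
      2 ^ (-s / 2) * polyWeight (-s) a b * polyWeight (-s) x ξ := by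
    simpa [polyWeight] using
      polyWeight_le_mul_of_nonneg (neg_nonneg.2 hs) (x + a) (ξ + b) (-a) (-b)
  have hpos := (polyWeight_pos s x ξ).le
  have hpos' := (polyWeight_pos s (x + a) (ξ + b)).le
  rw [abs_of_nonpos hs]
  calc polyWeight s x ξ
      = polyWeight s x ξ * polyWeight s (x + a) (ξ + b) * polyWeight (-s) (x + a) (ξ + b) := by
        rw [mul_assoc, hinv', mul_one]
    _ ≤ polyWeight s x ξ * polyWeight s (x + a) (ξ + b) *
          (2 ^ (-s / 2) * polyWeight (-s) a b * polyWeight (-s) x ξ) := by gcongr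
    _ = 2 ^ (-s / 2) * polyWeight (-s) a b * polyWeight s (x + a) (ξ + b) *
          (polyWeight s x ξ * polyWeight (-s) x ξ) := by ring
    _ = _ := by rw [hinv, mul_one]

theorem modNorm_eq_mixedNorm (g : 𝓢(Rn d, ℂ)) (p q : ℝ≥0∞) (s : ℝ) (f : 𝓢'(Rn d, ℂ)) :
    modNorm g p q s f =
      mixedNorm volume volume p q fun x ξ => ‖polyWeight s x ξ • stft g f x ξ‖ₑ := rfl

theorem eq_zero_of_modNorm_eq_zero {g : 𝓢(Rn d, ℂ)} (hg : g ≠ 0) {p q : ℝ≥0∞} (hp : 1 ≤ p)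
    (hq : q ≠ 0) {s : ℝ} {f : 𝓢'(Rn d, ℂ)} (hf : modNorm g p q s f = 0) : f = 0 := by
  have hp0 : p ≠ 0 := (zero_lt_one.trans_le hp).ne'
  unfold modNorm at hf
  rw [eLpNorm_eq_zero_iff (measurable_eLpNorm_slice g p hp s f).aestronglyMeasurable hq] at hf
  have hslice : ∀ᵐ ξ ∂(volume : Measure (Rn d)), ∀ x : Rn d, stft g f x ξ = 0 := by
    filter_upwards [hf] with ξ hξ x
    have hcx : Continuous fun x : Rn d => polyWeight s x ξ • stft g f x ξ :=
      (continuous_weighted_stft g s f).comp (f := fun x : Rn d => (x, ξ)) (by fun_prop)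
    rw [Pi.zero_apply, eLpNorm_eq_zero_iff hcx.aestronglyMeasurable hp0] at hξ
    have hzero := congrFun ((Continuous.ae_eq_iff_eq volume hcx continuous_const).1 hξ) x
    exact (smul_eq_zero.1 hzero).resolve_left (polyWeight_pos s x ξ).ne'
  refine eq_zero_of_stft_eq_zero hg fun x ξ => ?_
  have hcξ : Continuous fun ξ : Rn d => stft g f x ξ :=
    (continuous_stft g f).comp (f := fun ξ : Rn d => (x, ξ)) (by fun_prop)
  exact congrFun ((Continuous.ae_eq_iff_eq volume hcξ continuous_const).1
    (hslice.mono fun ξ hξ => hξ x)) ξ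

theorem stft_conjSchwartz (g u : 𝓢(Rn d, ℂ)) (x ξ : Rn d) :
    stft g (ofSchwartz (conjSchwartz u)) x ξ =
      (starRingEnd ℂ) (ofSchwartz u (gaborAtom g x ξ)) := by
  rw [stft, ofSchwartz_apply, ofSchwartz_apply, ← integral_conj]
  simp [← conj_stftAtom_apply, conjSchwartz_apply]

theorem enorm_apply_le_modNorm_mul_modNorm (g : 𝓢(Rn d, ℂ)) {p q : ℝ≥0∞} [hp : Fact (1 ≤ p)]
    [hq : Fact (1 ≤ q)] (s : ℝ) (f : 𝓢'(Rn d, ℂ)) (u : 𝓢(Rn d, ℂ)) :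
    ‖(inversionConst g : ℂ) * f u‖ₑ ≤ modNorm g p q s f *
      modNorm g p.conjExponent q.conjExponent (-s) (ofSchwartz (conjSchwartz u)) := by
  have : p.HolderConjugate p.conjExponent := .conjExponent hp.out
  have : q.HolderConjugate q.conjExponent := .conjExponent hq.out
  set f' := ofSchwartz (conjSchwartz u) with hf'
  have hmul (z : Rn d × Rn d) : ‖stft g f z.1 z.2 * ofSchwartz u (gaborAtom g z.1 z.2)‖ₑ =
      ‖polyWeight s z.1 z.2 • stft g f z.1 z.2‖ₑ *
        ‖polyWeight (-s) z.1 z.2 • stft g f' z.1 z.2‖ₑ := by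
    rw [← enorm_mul, smul_mul_smul_comm, polyWeight_mul_neg, one_smul, hf', stft_conjSchwartz,
      enorm_mul, enorm_mul, RCLike.enorm_conj]
  rw [← (stft_inversion g f u).2, modNorm_eq_mixedNorm, modNorm_eq_mixedNorm]
  refine (enorm_integral_le_lintegral_enorm _).trans ?_
  simp_rw [hmul, Measure.volume_eq_prod]
  refine lintegral_prod_mul_le_mixedNorm (continuous_weighted_stft g s f).enorm.measurable
    (continuous_weighted_stft g (-s) f').enorm.measurable ?_ ?_
  · simpa only [eLpNorm_enorm] using measurable_eLpNorm_slice g p hp.out s f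
  · simpa only [eLpNorm_enorm] using
      measurable_eLpNorm_slice g _ (by simp [ENNReal.conjExponent]) (-s) f'

theorem exists_forall_ge_eLpNorm_inv_one_add_norm_pow_ne_top (p : ℝ≥0∞) :
    ∃ m : ℕ, ∀ n, m ≤ n →
      eLpNorm (fun x : Rn d => ENNReal.ofReal ((1 + ‖x‖) ^ n)⁻¹) p volume ≠ ⊤ := by
  obtain ⟨m, hm⟩ := Measure.HasTemperateGrowth.exists_eLpNorm_lt_top (E := Rn d) p
    (μ := volume) inferInstance
  refine ⟨m, fun n hn => ne_top_of_le_ne_top hm.ne (eLpNorm_mono_enorm fun x => ?_)⟩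
  rw [enorm_eq_self, Real.enorm_eq_ofReal (by positivity), Real.rpow_neg (by positivity),
    Real.rpow_natCast]
  gcongr
  linarith [norm_nonneg x]

theorem exists_mixedNorm_le_of_decay (p q : ℝ≥0∞) (s : ℝ) :
    ∃ (N : ℕ) (C : ℝ≥0∞), C ≠ ⊤ ∧ ∀ (b : ℝ), 0 ≤ b → ∀ h : Rn d → Rn d → ℂ,
      (∀ x ξ, ‖h x ξ‖ ≤ b * (phaseWeight N x ξ)⁻¹) →
      mixedNorm volume volume p q (fun x ξ => ‖polyWeight s x ξ • h x ξ‖ₑ) ≤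
        ENNReal.ofReal b * C := by
  obtain ⟨m₁, hm₁⟩ := exists_forall_ge_eLpNorm_inv_one_add_norm_pow_ne_top (d := d) p
  obtain ⟨m₂, hm₂⟩ := exists_forall_ge_eLpNorm_inv_one_add_norm_pow_ne_top (d := d) q
  set n := max m₁ m₂
  set k := ⌈|s|⌉₊
  have hp := hm₁ n (le_max_left _ _)
  refine ⟨k + n, _, ENNReal.mul_ne_top hp (hm₂ n (le_max_right _ _)), fun b hb h hh => ?_⟩
  refine le_trans (mixedNorm_mono fun x ξ => ?_)
    ((mixedNorm_const_mul_le (ENNReal.ofReal_ne_top (r := b)) _).trans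
      (mul_le_mul_right (mixedNorm_mul_le (fun _ => ENNReal.ofReal_ne_top) hp) _))
  rw [← ENNReal.ofReal_mul (by positivity), ← ENNReal.ofReal_mul hb, ← ofReal_norm]
  refine ENNReal.ofReal_le_ofReal ?_
  have hk := phaseWeight_pos k x ξ
  calc ‖polyWeight s x ξ • h x ξ‖ = polyWeight s x ξ * ‖h x ξ‖ := by
        rw [norm_smul, Real.norm_of_nonneg (polyWeight_pos s x ξ).le]
    _ ≤ phaseWeight k x ξ * (b * (phaseWeight (k + n) x ξ)⁻¹) := by
        gcongr
        · exact polyWeight_le_phaseWeight s x ξ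
        · exact hh x ξ
    _ = b * (phaseWeight n x ξ)⁻¹ := by rw [phaseWeight_add]; field_simp
    _ = _ := by rw [phaseWeight, mul_inv]

theorem exists_modNorm_ofSchwartz_le (g : 𝓢(Rn d, ℂ)) (p q : ℝ≥0∞) (s : ℝ) :
    ∃ P : Seminorm ℂ 𝓢(Rn d, ℂ), Continuous P ∧ ∀ u,
      modNorm g p q s (ofSchwartz u) ≤ ENNReal.ofReal (P u) ∧
      modNorm g p q s (ofSchwartz (conjSchwartz u)) ≤ ENNReal.ofReal (P u) := by
  obtain ⟨N, C, hC, h⟩ := exists_mixedNorm_le_of_decay (d := d) p q s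
  obtain ⟨P₁, hP₁, h₁⟩ := exists_stft_decay N g
  obtain ⟨P₂, hP₂, h₂⟩ := exists_gabor_decay N g
  have hw (x ξ : Rn d) : 0 ≤ (phaseWeight N x ξ)⁻¹ := (inv_pos.2 (phaseWeight_pos N x ξ)).le
  have hr (u : 𝓢(Rn d, ℂ)) :
      ENNReal.ofReal ((C.toNNReal • (P₁ + P₂)) u) = ENNReal.ofReal ((P₁ + P₂) u) * C := by
    change ENNReal.ofReal ((C.toNNReal : ℝ) * (P₁ + P₂) u) = _
    rw [ENNReal.ofReal_mul (by positivity), ENNReal.ofReal_coe_nnreal, ENNReal.coe_toNNReal hC,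
      mul_comm]
  refine ⟨C.toNNReal • (P₁ + P₂), (hP₁.add hP₂).const_smul C.toNNReal, fun u => ?_⟩
  rw [hr, modNorm_eq_mixedNorm, modNorm_eq_mixedNorm]
  refine ⟨h _ (apply_nonneg _ _) _ fun x ξ => (h₁ u x ξ).trans ?_,
    h _ (apply_nonneg _ _) _ fun x ξ => ?_⟩
  · exact mul_le_mul_of_nonneg_right (le_add_of_nonneg_right (apply_nonneg P₂ u)) (hw x ξ)
  · rw [stft_conjSchwartz, RCLike.norm_conj]
    exact (h₂ u x ξ).trans
      (mul_le_mul_of_nonneg_right (le_add_of_nonneg_left (apply_nonneg P₁ u)) (hw x ξ))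

theorem modNorm_le_tsum (g : 𝓢(Rn d, ℂ)) {p q : ℝ≥0∞} (hp : 1 ≤ p) (hq : 1 ≤ q) (hpt : p ≠ ⊤)
    (hqt : q ≠ ⊤) (s : ℝ) {f : ℕ → 𝓢'(Rn d, ℂ)} {f₀ : 𝓢'(Rn d, ℂ)}
    (h : ∀ u, HasSum (fun n => f n u) (f₀ u)) :
    modNorm g p q s f₀ ≤ ∑' n, modNorm g p q s (f n) := by
  simp_rw [modNorm_eq_mixedNorm]
  rw [← lintegral_count (fun n => mixedNorm volume volume p q
    fun x ξ => ‖polyWeight s x ξ • stft g (f n) x ξ‖ₑ)]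
  refine le_trans (mixedNorm_mono fun x ξ => ?_) (mixedNorm_lintegral_le
    (h := fun x ξ n => ‖polyWeight s x ξ • stft g (f n) x ξ‖ₑ) ?_ hp hpt hq hqt)
  · rw [lintegral_count, stft, ← (h (stftAtom g x ξ)).tsum_eq, enorm_smul]
    simp_rw [enorm_smul]
    rw [ENNReal.tsum_mul_left]
    gcongr
    exact enorm_tsum_le_tsum_enorm
  · exact measurable_from_prod_countable_left fun n =>
      (continuous_weighted_stft g s (f n)).enorm.measurable

theorem continuous_of_norm_le_seminorm {E F : Type*} [AddCommGroup E] [Module ℂ E]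
    [TopologicalSpace E] [IsTopologicalAddGroup E] [SeminormedAddCommGroup F] [Module ℂ F]
    (L : E →ₗ[ℂ] F) {P : Seminorm ℂ E} (hP : Continuous P) (h : ∀ u, ‖L u‖ ≤ P u) :
    Continuous L := by
  refine continuous_of_continuousAt_zero L ?_
  rw [ContinuousAt, map_zero, tendsto_zero_iff_norm_tendsto_zero]
  exact squeeze_zero (fun _ => norm_nonneg _) h (by simpa using hP.tendsto 0)

/-! ### Modulation spaces as Banach spaces -/

namespace ModulationSpace

variable {g : 𝓢(Rn d, ℂ)} {p q : ℝ≥0∞} [hp : Fact (1 ≤ p)] [hq : Fact (1 ≤ q)] {s : ℝ}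

theorem toDistribution_injective :
    Function.Injective (toDistribution : ModulationSpace g p q s →ₗ[ℂ] 𝓢'(Rn d, ℂ)) :=
  Subtype.val_injective

/-- A tempered distribution of finite modulation norm as an element of the modulation space. -/
def ofDistribution (f : 𝓢'(Rn d, ℂ)) (hf : modNorm g p q s f < ⊤) : ModulationSpace g p q s :=
  ⟨f, hf⟩

theorem ofReal_norm_eq_modNorm (f : ModulationSpace g p q s) :
    ENNReal.ofReal ‖f‖ = modNorm g p q s (toDistribution f) := by
  rw [norm_def, ENNReal.ofReal_toReal (modNorm_lt_top f).ne]

variable (g p q s) in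
/-- The norm of the conjugate of a Schwartz function in `M_{-s}^{p',q'}`, which bounds the
functional it induces on `M_s^{p,q}`. -/
def dualNorm (u : 𝓢(Rn d, ℂ)) : ℝ :=
  (modNorm g p.conjExponent q.conjExponent (-s) (ofSchwartz (conjSchwartz u))).toReal

theorem norm_toDistribution_apply_le (hg : g ≠ 0) (f : ModulationSpace g p q s)
    (u : 𝓢(Rn d, ℂ)) :
    ‖toDistribution f u‖ ≤ (inversionConst g)⁻¹ * dualNorm g p q s u * ‖f‖ := by
  have hc := inversionConst_pos hg
  obtain ⟨P, -, hP⟩ := exists_modNorm_ofSchwartz_le g p.conjExponent q.conjExponent (-s)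
  have hfin := ne_top_of_le_ne_top ENNReal.ofReal_ne_top (hP u).2
  have hpair := ENNReal.toReal_mono (ENNReal.mul_ne_top (modNorm_lt_top f).ne hfin)
    (enorm_apply_le_modNorm_mul_modNorm g (p := p) (q := q) s (toDistribution f) u)
  rw [ENNReal.toReal_mul, toReal_enorm, norm_mul, Complex.norm_real,
    Real.norm_of_nonneg hc.le] at hpair
  rw [mul_assoc, ← div_eq_inv_mul, le_div_iff₀' hc, mul_comm (dualNorm g p q s u)]
  exact hpair

theorem exists_seminorm_eval_bound (g : 𝓢(Rn d, ℂ)) (p q : ℝ≥0∞) [hp : Fact (1 ≤ p)]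
    [hq : Fact (1 ≤ q)] (s : ℝ) (hg : g ≠ 0) :
    ∃ P : Seminorm ℂ 𝓢(Rn d, ℂ), Continuous P ∧
      ∀ (f : ModulationSpace g p q s) u, ‖toDistribution f u‖ ≤ ‖f‖ * P u := by
  obtain ⟨P, hPc, hP⟩ := exists_modNorm_ofSchwartz_le g p.conjExponent q.conjExponent (-s)
  have hc := (inv_pos.2 (inversionConst_pos hg)).le
  refine ⟨Real.toNNReal (inversionConst g)⁻¹ • P, hPc.const_smul (Real.toNNReal _), fun f u => ?_⟩
  have hdual : dualNorm g p q s u ≤ P u :=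
    ENNReal.toReal_le_of_le_ofReal (apply_nonneg P u) (hP u).2
  change _ ≤ ‖f‖ * ((Real.toNNReal (inversionConst g)⁻¹ : ℝ) * P u)
  rw [Real.coe_toNNReal _ hc, mul_comm ‖f‖]
  exact (norm_toDistribution_apply_le hg f u).trans (by gcongr)

/-- The evaluation of the elements of a modulation space at a Schwartz function. -/
def evalCLM (hg : g ≠ 0) (u : 𝓢(Rn d, ℂ)) : ModulationSpace g p q s →L[ℂ] ℂ :=
  LinearMap.mkContinuous
    { toFun := fun f => toDistribution f u
      map_add' := fun f₁ f₂ => by simp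
      map_smul' := fun c f => by simp }
    ((inversionConst g)⁻¹ * dualNorm g p q s u) fun f => norm_toDistribution_apply_le hg f u

theorem evalCLM_apply (hg : g ≠ 0) (u : 𝓢(Rn d, ℂ)) (f : ModulationSpace g p q s) :
    evalCLM hg u f = toDistribution f u := rfl

theorem norm_evalCLM_le (hg : g ≠ 0) (u : 𝓢(Rn d, ℂ)) :
    ‖(evalCLM hg u : ModulationSpace g p q s →L[ℂ] ℂ)‖ ≤
      (inversionConst g)⁻¹ * dualNorm g p q s u :=
  LinearMap.mkContinuous_norm_le _
    (mul_nonneg (inv_pos.2 (inversionConst_pos hg)).le ENNReal.toReal_nonneg) _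

variable (g p q s) in
/-- The inclusion of the Schwartz space into a modulation space. -/
def schwartzCLM : 𝓢(Rn d, ℂ) →L[ℂ] ModulationSpace g p q s :=
  let L : 𝓢(Rn d, ℂ) →ₗ[ℂ] ModulationSpace g p q s :=
    { toFun := fun u => ofDistribution (ofSchwartz u) (by
        obtain ⟨P, -, hP⟩ := exists_modNorm_ofSchwartz_le g p q s
        exact (hP u).1.trans_lt ENNReal.ofReal_lt_top)
      map_add' := fun u v => toDistribution_injective
        (map_add (SchwartzMap.toTemperedDistributionCLM (Rn d) ℂ volume) u v)
      map_smul' := fun c u => toDistribution_injective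
        (map_smul (SchwartzMap.toTemperedDistributionCLM (Rn d) ℂ volume) c u) }
  ⟨L, by
    obtain ⟨P, hPc, hP⟩ := exists_modNorm_ofSchwartz_le g p q s
    exact continuous_of_norm_le_seminorm L hPc fun u =>
      ENNReal.toReal_le_of_le_ofReal (apply_nonneg P u) (hP u).1⟩

theorem toDistribution_schwartzCLM (u : 𝓢(Rn d, ℂ)) :
    toDistribution (schwartzCLM g p q s u) = ofSchwartz u := rfl

theorem exists_hasSum_toDistribution_apply (hg : g ≠ 0) {f : ℕ → ModulationSpace g p q s}
    (hf : Summable fun n => ‖f n‖) :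
    ∃ f₀ : 𝓢'(Rn d, ℂ), ∀ u, HasSum (fun n => toDistribution (f n) u) (f₀ u) := by
  obtain ⟨P, hPc, hP⟩ := exists_seminorm_eval_bound g p q s hg
  have hsum (u) : Summable fun n => toDistribution (f n) u :=
    Summable.of_norm_bounded (hf.mul_right (P u)) fun n => hP (f n) u
  let L : 𝓢(Rn d, ℂ) →ₗ[ℂ] ℂ :=
    { toFun := fun u => ∑' n, toDistribution (f n) u
      map_add' := fun u v => by
        simp_rw [map_add]
        exact (hsum u).tsum_add (hsum v)
      map_smul' := fun c u => by
        simp_rw [map_smul, smul_eq_mul]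
        exact tsum_mul_left }
  have hL : Continuous L :=
    continuous_of_norm_le_seminorm L (P := (∑' n, ‖f n‖₊) • P) (hPc.const_smul (∑' n, ‖f n‖₊))
      fun u => by
        refine (tsum_of_norm_bounded (hf.mul_right (P u)).hasSum fun n => hP (f n) u).trans_eq ?_
        rw [tsum_mul_right, smul_apply, NNReal.smul_def, NNReal.coe_tsum]
        rfl
  exact ⟨ContinuousLinearMap.toPointwiseConvergenceCLM _ _ _ _ ⟨L, hL⟩, fun u => (hsum u).hasSum⟩

theorem exists_tendsto_of_summable_norm (hg : g ≠ 0) (hpt : p ≠ ⊤) (hqt : q ≠ ⊤)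
    (f : ℕ → ModulationSpace g p q s) (hf : Summable fun n => ‖f n‖) :
    ∃ a, Filter.Tendsto (fun n => ∑ i ∈ Finset.range n, f i) Filter.atTop (𝓝 a) := by
  obtain ⟨f₀, hf₀⟩ := exists_hasSum_toDistribution_apply hg hf
  have hfin : ∑' n, modNorm g p q s (toDistribution (f n)) ≠ ⊤ := by
    simp_rw [← ofReal_norm_eq_modNorm]
    exact hf.tsum_ofReal_ne_top
  have hlt : modNorm g p q s f₀ < ⊤ :=
    (modNorm_le_tsum g hp.out hq.out hpt hqt s hf₀).trans_lt hfin.lt_top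
  refine ⟨ofDistribution f₀ hlt, ?_⟩
  rw [tendsto_iff_norm_sub_tendsto_zero]
  have htail := (ENNReal.tendsto_toReal ENNReal.zero_ne_top).comp
    (ENNReal.tendsto_sum_nat_add (fun n => modNorm g p q s (toDistribution (f n))) hfin)
  rw [ENNReal.toReal_zero] at htail
  refine squeeze_zero (fun _ => norm_nonneg _) (fun n => ?_) htail
  rw [norm_sub_rev, norm_def]
  refine ENNReal.toReal_mono (ne_top_of_le_ne_top hfin
    (ENNReal.tsum_comp_le_tsum_of_injective (add_left_injective n) _))
    (modNorm_le_tsum g hp.out hq.out hpt hqt s fun u => ?_)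
  have hdiff : toDistribution (ofDistribution f₀ hlt - ∑ i ∈ Finset.range n, f i) u =
      f₀ u - ∑ i ∈ Finset.range n, toDistribution (f i) u := by
    simp_rw [← evalCLM_apply hg, map_sub, map_sum]
    rfl
  rw [hdiff]
  exact (hasSum_nat_add_iff' n).2 (hf₀ u)

/-- The modulation space as a normed group, for a nonzero window. -/
abbrev normedAddCommGroup (hg : g ≠ 0) : NormedAddCommGroup (ModulationSpace g p q s) :=
  NormedAddCommGroup.ofSeparation fun f hf => toDistribution_injective <| by
    rw [map_zero]
    refine eq_zero_of_modNorm_eq_zero hg hp.out (zero_lt_one.trans_le hq.out).ne' (s := s) ?_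
    rw [← ofReal_norm_eq_modNorm, hf, ENNReal.ofReal_zero]

theorem completeSpace (hg : g ≠ 0) (hpt : p ≠ ⊤) (hqt : q ≠ ⊤) :
    CompleteSpace (ModulationSpace g p q s) :=
  letI := normedAddCommGroup (p := p) (q := q) (s := s) hg
  NormedAddCommGroup.completeSpace_of_summable_imp_tendsto
    (exists_tendsto_of_summable_norm hg hpt hqt)

end ModulationSpace

/-! ### Synthesis from mixed-norm spaces -/

theorem mixedNorm_lintegral_mul_comp_add_right_le {G : Type*} [MeasurableSpace G] [AddGroup G]
    [MeasurableAdd₂ G] {μ : Measure G} [SigmaFinite μ] [μ.IsAddRightInvariant]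
    {τ : Measure (G × G)} [SFinite τ] {p q : ℝ≥0∞} (hp : 1 ≤ p) (hpt : p ≠ ⊤) (hq : 1 ≤ q)
    (hqt : q ≠ ⊤) {k : G × G → ℝ≥0∞} (hk : Measurable k) (hkt : ∀ z, k z ≠ ⊤)
    {u : G → G → ℝ≥0∞} (hu : Measurable (Function.uncurry u)) :
    mixedNorm μ μ p q (fun x y => ∫⁻ z, k z * u (x + z.1) (y + z.2) ∂τ) ≤
      (∫⁻ z, k z ∂τ) * mixedNorm μ μ p q u := by
  have hm : Measurable fun w : (G × G) × (G × G) => k w.2 * u (w.1.1 + w.2.1) (w.1.2 + w.2.2) :=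
    (hk.comp measurable_snd).mul (hu.comp (f := fun w : (G × G) × (G × G) =>
      (w.1.1 + w.2.1, w.1.2 + w.2.2)) (by fun_prop))
  calc _ ≤ ∫⁻ z, mixedNorm μ μ p q (fun x y => k z * u (x + z.1) (y + z.2)) ∂τ :=
        mixedNorm_lintegral_le (h := fun x y z => k z * u (x + z.1) (y + z.2)) hm hp hpt hq hqt
    _ ≤ ∫⁻ z, k z * mixedNorm μ μ p q u ∂τ := lintegral_mono fun z =>
        (mixedNorm_const_mul_le (hkt z) _).trans_eq (by rw [mixedNorm_comp_add_right])
    _ = _ := lintegral_mul_const _ hk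

theorem norm_ofSchwartz_stftAtom_gaborAtom (g : 𝓢(Rn d, ℂ)) (t η x ξ : Rn d) :
    ‖ofSchwartz (stftAtom g t η) (gaborAtom g x ξ)‖ =
      ‖ofSchwartz (conjSchwartz g) (gaborAtom g (x - t) (ξ - η))‖ := by
  have hunit : ‖Complex.exp (((⟪t, ξ⟫_ℝ - ⟪t, η⟫_ℝ : ℝ) : ℂ) * Complex.I)‖ = 1 :=
    Complex.norm_exp_ofReal_mul_I _
  rw [ofSchwartz_apply, ofSchwartz_apply,
    ← integral_add_right_eq_self (fun y => gaborAtom g x ξ y * stftAtom g t η y) t,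
    ← one_mul (‖∫ y, gaborAtom g (x - t) (ξ - η) y * conjSchwartz g y‖), ← hunit, ← norm_mul,
    ← integral_const_mul]
  congr 1
  refine integral_congr_ae (ae_of_all _ fun y => ?_)
  simp only [gaborAtom_apply, stftAtom_apply, conjSchwartz_apply, add_sub_cancel_right]
  rw [show y + t - x = y - (x - t) by abel]
  have hphase : Complex.exp (Complex.I * ((⟪y + t, ξ⟫_ℝ : ℝ) : ℂ)) *
      Complex.exp (-(Complex.I * ((⟪y + t, η⟫_ℝ : ℝ) : ℂ))) =
      Complex.exp (((⟪t, ξ⟫_ℝ - ⟪t, η⟫_ℝ : ℝ) : ℂ) * Complex.I) *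
        Complex.exp (Complex.I * ((⟪y, ξ - η⟫_ℝ : ℝ) : ℂ)) := by
    rw [← Complex.exp_add, ← Complex.exp_add, inner_add_left, inner_add_left, inner_sub_right]
    congr 1
    push_cast; ring
  linear_combination (g (y - (x - t)) * (starRingEnd ℂ) (g y)) * hphase

/-- The convolution kernel that dominates the weighted reproducing kernel of the short-time Fourier
transform; its weight comes from Peetre's inequality. -/
def synthesisKernel (g : 𝓢(Rn d, ℂ)) (s : ℝ) (z : Rn d × Rn d) : ℝ :=
  2 ^ (|s| / 2) * polyWeight |s| z.1 z.2 * ‖ofSchwartz (conjSchwartz g) (gaborAtom g z.1 z.2)‖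

theorem synthesisKernel_nonneg (g : 𝓢(Rn d, ℂ)) (s : ℝ) (z : Rn d × Rn d) :
    0 ≤ synthesisKernel g s z :=
  mul_nonneg (mul_nonneg (by positivity) (polyWeight_pos _ _ _).le) (norm_nonneg _)

theorem continuous_synthesisKernel (g : 𝓢(Rn d, ℂ)) (s : ℝ) : Continuous (synthesisKernel g s) :=
  (continuous_const.mul (continuous_polyWeight |s|)).mul
    (continuous_ofSchwartz_gaborAtom g (conjSchwartz g)).norm

theorem integrable_synthesisKernel (g : 𝓢(Rn d, ℂ)) (s : ℝ) :
    Integrable (synthesisKernel g s) := by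
  set k := ⌈|(|s|)|⌉₊
  obtain ⟨r, -, hrb⟩ := exists_gabor_decay (k + (d + 1)) g
  refine (integrable_phaseWeight_inv.const_mul (2 ^ (|s| / 2) * r (conjSchwartz g))).mono'
    (continuous_synthesisKernel g s).aestronglyMeasurable (ae_of_all _ fun z => ?_)
  rw [Real.norm_of_nonneg (synthesisKernel_nonneg g s z)]
  have hk := phaseWeight_pos k z.1 z.2
  calc synthesisKernel g s z ≤ 2 ^ (|s| / 2) * phaseWeight k z.1 z.2 *
        (r (conjSchwartz g) * (phaseWeight (k + (d + 1)) z.1 z.2)⁻¹) := by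
        refine mul_le_mul ?_ (hrb _ _ _) (norm_nonneg _) (by positivity)
        gcongr
        exact polyWeight_le_phaseWeight _ _ _
    _ = _ := by rw [phaseWeight_add]; field_simp

theorem lintegral_synthesisKernel_ne_top (g : 𝓢(Rn d, ℂ)) (s : ℝ) :
    ∫⁻ z, ENNReal.ofReal (synthesisKernel g s z) ≠ ⊤ := by
  rw [← ofReal_integral_eq_lintegral_ofReal (integrable_synthesisKernel g s)
    (ae_of_all _ (synthesisKernel_nonneg g s))]
  exact ENNReal.ofReal_ne_top

theorem polyWeight_mul_norm_ofSchwartz_stftAtom_gaborAtom_le (g : 𝓢(Rn d, ℂ)) (s : ℝ)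
    (x ξ : Rn d) (z : Rn d × Rn d) :
    polyWeight s x ξ * ‖ofSchwartz (stftAtom g x ξ) (gaborAtom g (x + z.1) (ξ + z.2))‖ ≤
      synthesisKernel g s z * polyWeight s (x + z.1) (ξ + z.2) := by
  rw [norm_ofSchwartz_stftAtom_gaborAtom, add_sub_cancel_left, add_sub_cancel_left]
  refine (mul_le_mul_of_nonneg_right (polyWeight_le_mul s x ξ z.1 z.2)
    (norm_nonneg _)).trans_eq ?_
  rw [synthesisKernel]
  ring

theorem enorm_weighted_stft_le_of_synthesis {g : 𝓢(Rn d, ℂ)} (s : ℝ) {H : Rn d × Rn d → ℂ}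
    {f : 𝓢'(Rn d, ℂ)} (hf : ∀ u, f u = ∫ z, H z * ofSchwartz u (gaborAtom g z.1 z.2))
    (x ξ : Rn d) :
    ‖polyWeight s x ξ • stft g f x ξ‖ₑ ≤ ∫⁻ z : Rn d × Rn d,
      ENNReal.ofReal (synthesisKernel g s z) *
        ‖polyWeight s (x + z.1) (ξ + z.2) • H (x + z.1, ξ + z.2)‖ₑ := by
  have : (volume : Measure (Rn d × Rn d)).IsAddLeftInvariant := by
    rw [Measure.volume_eq_prod]
    infer_instance
  rw [enorm_smul, stft, hf]
  calc ‖polyWeight s x ξ‖ₑ * ‖∫ z, H z * ofSchwartz (stftAtom g x ξ) (gaborAtom g z.1 z.2)‖ₑ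
      ≤ ‖polyWeight s x ξ‖ₑ *
        ∫⁻ z, ‖H z * ofSchwartz (stftAtom g x ξ) (gaborAtom g z.1 z.2)‖ₑ := by
        gcongr; exact enorm_integral_le_lintegral_enorm _
    _ = ∫⁻ z : Rn d × Rn d, ‖polyWeight s x ξ‖ₑ * ‖H (x + z.1, ξ + z.2) *
        ofSchwartz (stftAtom g x ξ) (gaborAtom g (x + z.1) (ξ + z.2))‖ₑ := by
        rw [← lintegral_add_left_eq_self _ (x, ξ), lintegral_const_mul' _ _ enorm_ne_top]
        rfl
    _ ≤ _ := lintegral_mono fun z => ?_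
  simp_rw [← ofReal_norm]
  rw [← ENNReal.ofReal_mul (norm_nonneg _), ← ENNReal.ofReal_mul (synthesisKernel_nonneg g s z),
    norm_mul, norm_smul, Real.norm_of_nonneg (polyWeight_pos _ _ _).le,
    Real.norm_of_nonneg (polyWeight_pos _ _ _).le]
  have hkernel := mul_le_mul_of_nonneg_right
    (polyWeight_mul_norm_ofSchwartz_stftAtom_gaborAtom_le g s x ξ z)
    (norm_nonneg (H (x + z.1, ξ + z.2)))
  exact ENNReal.ofReal_le_ofReal (by linarith)

theorem modNorm_le_of_synthesis {g : 𝓢(Rn d, ℂ)} {p q : ℝ≥0∞} (hp : 1 ≤ p) (hpt : p ≠ ⊤)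
    (hq : 1 ≤ q) (hqt : q ≠ ⊤) (s : ℝ) {H : Rn d × Rn d → ℂ} (hH : Measurable H)
    {f : 𝓢'(Rn d, ℂ)} (hf : ∀ u, f u = ∫ z, H z * ofSchwartz u (gaborAtom g z.1 z.2)) :
    modNorm g p q s f ≤ (∫⁻ z, ENNReal.ofReal (synthesisKernel g s z)) *
      mixedNorm volume volume p q fun x ξ => ‖polyWeight s x ξ • H (x, ξ)‖ₑ :=
  (mixedNorm_mono (enorm_weighted_stft_le_of_synthesis s hf)).trans
    (mixedNorm_lintegral_mul_comp_add_right_le (u := fun x ξ => ‖polyWeight s x ξ • H (x, ξ)‖ₑ)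
      hp hpt hq hqt (continuous_synthesisKernel g s).measurable.ennreal_ofReal
      (fun _ => ENNReal.ofReal_ne_top) ((continuous_polyWeight s).measurable.smul hH).enorm)

/-! ### Traces of nuclear operators -/

section Resolution

variable {B Z : Type*} [NormedAddCommGroup B] [NormedSpace ℂ B]
  [TopologicalSpace Z] [MeasurableSpace Z]

/-- A resolution of the identity of `B` by localised integrals of rank-one operators: every `y` is
the limit of the integrals of `l z y • b z` over the compact sets `K n`. -/
structure IsResolution (μ : Measure Z) (K : ℕ → Set Z) (b : Z → B) (l : Z → B →L[ℂ] ℂ) :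
    Prop where
  isCompact : ∀ n, IsCompact (K n)
  continuous_vec : Continuous b
  continuous_apply : ∀ y, Continuous fun z => l z y
  tendsto : ∀ y, Filter.Tendsto (fun n => ∫ z in K n, l z y • b z ∂μ) Filter.atTop (𝓝 y)

namespace IsResolution

variable {μ : Measure Z} {K : ℕ → Set Z} {b : Z → B} {l : Z → B →L[ℂ] ℂ}

theorem integrableOn [T2Space Z] [OpensMeasurableSpace Z] [IsFiniteMeasureOnCompacts μ]
    (h : IsResolution μ K b l) (n : ℕ) (y : B) : IntegrableOn (fun z => l z y • b z) (K n) μ :=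
  ((h.continuous_apply y).smul h.continuous_vec).continuousOn.integrableOn_compact (h.isCompact n)

theorem exists_norm_le [CompleteSpace B] (h : IsResolution μ K b l) (n : ℕ) :
    ∃ C, 0 ≤ C ∧ ∀ z ∈ K n, ‖l z‖ ≤ C := by
  obtain ⟨C, hC⟩ := banach_steinhaus (g := fun z : K n => l z) fun y =>
    ((h.isCompact n).exists_bound_of_continuousOn (h.continuous_apply y).continuousOn).imp
      fun _ hD z => hD z z.2
  exact ⟨max C 0, le_max_right _ _, fun z hz => (hC ⟨z, hz⟩).trans (le_max_left _ _)⟩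

variable [T2Space Z] [OpensMeasurableSpace Z] [IsFiniteMeasureOnCompacts μ] [CompleteSpace B]

/-- The localization operators of a resolution of the identity. -/
def localization (h : IsResolution μ K b l) (n : ℕ) : B →L[ℂ] B :=
  LinearMap.mkContinuousOfExistsBound
    { toFun := fun y => ∫ z in K n, l z y • b z ∂μ
      map_add' := fun y₁ y₂ => by
        simp only [map_add, add_smul]
        exact integral_add (h.integrableOn n y₁) (h.integrableOn n y₂)
      map_smul' := fun c y => by
        simp only [map_smul, smul_assoc, RingHom.id_apply]
        exact integral_smul c _ } <| by
    obtain ⟨C, hC0, hC⟩ := h.exists_norm_le n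
    obtain ⟨D, hD⟩ := (h.isCompact n).exists_bound_of_continuousOn h.continuous_vec.continuousOn
    refine ⟨C * D * μ.real (K n), fun y => ?_⟩
    have hbound : ∀ z ∈ K n, ‖l z y • b z‖ ≤ C * ‖y‖ * D := fun z hz => by
      rw [norm_smul]
      exact mul_le_mul ((l z).le_of_opNorm_le (hC z hz) y) (hD z hz) (norm_nonneg _)
        (by positivity)
    refine (norm_setIntegral_le_of_norm_le_const (h.isCompact n).measure_lt_top
      hbound).trans_eq ?_
    ring

theorem localization_apply (h : IsResolution μ K b l) (n : ℕ) (y : B) :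
    h.localization n y = ∫ z in K n, l z y • b z ∂μ := rfl

theorem apply_localization {F : Type*} [NormedAddCommGroup F] [NormedSpace ℂ F] [CompleteSpace F]
    (h : IsResolution μ K b l) (T : B →L[ℂ] F) (n : ℕ) (y : B) :
    T (h.localization n y) = ∫ z in K n, l z y • T (b z) ∂μ := by
  rw [localization_apply, ← T.integral_comp_comm (h.integrableOn n y)]
  simp only [map_smul]

theorem tendsto_localization (h : IsResolution μ K b l) (y : B) :
    Filter.Tendsto (fun n => h.localization n y) Filter.atTop (𝓝 y) :=
  h.tendsto y

theorem exists_norm_localization_le (h : IsResolution μ K b l) :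
    ∃ C, ∀ n, ‖h.localization n‖ ≤ C :=
  banach_steinhaus fun y => ((h.tendsto_localization y).norm.bddAbove_range).imp
    fun _ hC n => hC ⟨n, rfl⟩

theorem eq_zero (h : IsResolution μ K b l) {T : B →L[ℂ] B} (hT : ∀ z, T (b z) = 0) : T = 0 := by
  ext y
  refine tendsto_nhds_unique ((T.continuous.tendsto y).comp (h.tendsto_localization y)) ?_
  simp [Function.comp_def, h.apply_localization, hT]

theorem tsum_apply_localization (h : IsResolution μ K b l) {T : B →L[ℂ] B}
    {x' : ℕ → B →L[ℂ] ℂ} {y : ℕ → B} (hrep : IsNuclearRepresentation 1 T x' y) (n : ℕ) :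
    ∑' k, x' k (h.localization n (y k)) = ∫ z in K n, l z (T (b z)) ∂μ := by
  obtain ⟨hsum, hT⟩ := hrep
  simp only [Real.rpow_one] at hsum
  obtain ⟨C, hC0, hC⟩ := h.exists_norm_le n
  obtain ⟨D, hD⟩ := (h.isCompact n).exists_bound_of_continuousOn h.continuous_vec.continuousOn
  have hbound : ∀ k, ∀ z ∈ K n, ‖l z (y k) • x' k (b z)‖ ≤ C * D * (‖x' k‖ * ‖y k‖) := by
    intro k z hz
    rw [norm_smul]
    calc _ ≤ (C * ‖y k‖) * (‖x' k‖ * D) := mul_le_mul ((l z).le_of_opNorm_le (hC z hz) _)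
          ((x' k).le_opNorm_of_le (hD z hz)) (norm_nonneg _) (by positivity)
      _ = _ := by ring
  have hmeas := (h.isCompact n).measurableSet
  simp_rw [h.apply_localization]
  refine (hasSum_integral_of_dominated_convergence (F := fun k z => l z (y k) • x' k (b z))
    (fun k _ => C * D * (‖x' k‖ * ‖y k‖))
    (fun k => (((h.continuous_apply (y k)).smul
      ((x' k).continuous.comp h.continuous_vec)).continuousOn.integrableOn_compact
        (h.isCompact n)).aestronglyMeasurable)
    (fun k => (ae_restrict_iff' hmeas).2 (ae_of_all _ (hbound k)))
    (ae_of_all _ fun _ => hsum.mul_left _)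
    (integrableOn_const (h.isCompact n).measure_lt_top.ne)
    (ae_of_all _ fun z => ?_)).tsum_eq
  simpa only [map_smul, smul_eq_mul, mul_comm] using (l z).hasSum (hT (b z))

theorem tendsto_trace (h : IsResolution μ K b l) {T : B →L[ℂ] B}
    {x' : ℕ → B →L[ℂ] ℂ} {y : ℕ → B} (hrep : IsNuclearRepresentation 1 T x' y) :
    Filter.Tendsto (fun n => ∫ z in K n, l z (T (b z)) ∂μ) Filter.atTop
      (𝓝 (∑' k, x' k (y k))) := by
  obtain ⟨C, hC⟩ := h.exists_norm_localization_le
  have hsum := hrep.1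
  simp only [Real.rpow_one] at hsum
  simp_rw [← h.tsum_apply_localization hrep]
  refine tendsto_tsum_of_dominated_convergence (hsum.mul_left C)
    (fun k => ((x' k).continuous.tendsto _).comp (h.tendsto_localization (y k)))
    (Filter.Eventually.of_forall fun n k => ?_)
  calc _ ≤ ‖x' k‖ * (C * ‖y k‖) :=
        (x' k).le_opNorm_of_le ((h.localization n).le_of_opNorm_le (hC n) _)
    _ = _ := by ring

end IsResolution

end Resolution

/-! ### The Gabor resolution of the identity -/

namespace ModulationSpace

variable {g : 𝓢(Rn d, ℂ)} {p q : ℝ≥0∞} [hp : Fact (1 ≤ p)] [hq : Fact (1 ≤ q)] {s : ℝ}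

theorem continuous_schwartzCLM_gaborAtom (g : 𝓢(Rn d, ℂ)) (p q : ℝ≥0∞) [Fact (1 ≤ p)]
    [Fact (1 ≤ q)] (s : ℝ) :
    Continuous fun z : Rn d × Rn d => schwartzCLM g p q s (gaborAtom g z.1 z.2) :=
  (schwartzCLM g p q s).continuous.comp (continuous_gaborAtom g)

theorem evalCLM_setIntegral_gaborAtom (hg : g ≠ 0) (hpt : p ≠ ⊤) (hqt : q ≠ ⊤)
    {K : Set (Rn d × Rn d)} (hK : IsCompact K) {H : Rn d × Rn d → ℂ} (hH : Continuous H)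
    (u : 𝓢(Rn d, ℂ)) :
    letI := normedAddCommGroup (p := p) (q := q) (s := s) hg
    evalCLM hg u (∫ z in K, H z • schwartzCLM g p q s (gaborAtom g z.1 z.2)) =
      ∫ z in K, H z * ofSchwartz u (gaborAtom g z.1 z.2) := by
  let := normedAddCommGroup (p := p) (q := q) (s := s) hg
  have := completeSpace (g := g) (p := p) (q := q) (s := s) hg hpt hqt
  have hint : IntegrableOn (fun z => H z • schwartzCLM g p q s (gaborAtom g z.1 z.2)) K :=
    (hH.smul (continuous_schwartzCLM_gaborAtom g p q s)).continuousOn.integrableOn_compact hK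
  rw [← (evalCLM hg u).integral_comp_comm hint]
  simp only [map_smul, smul_eq_mul, evalCLM_apply, toDistribution_schwartzCLM]
  exact integral_congr_ae (ae_of_all _ fun z => congrArg _ (ofSchwartz_comm _ _))

theorem toDistribution_sub_setIntegral_apply (hg : g ≠ 0) (hpt : p ≠ ⊤) (hqt : q ≠ ⊤)
    {K : Set (Rn d × Rn d)} (hK : IsCompact K) (y : ModulationSpace g p q s) (u : 𝓢(Rn d, ℂ)) :
    letI := normedAddCommGroup (p := p) (q := q) (s := s) hg
    toDistribution ((inversionConst g : ℂ) • y - ∫ z in K,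
      stft g (toDistribution y) z.1 z.2 • schwartzCLM g p q s (gaborAtom g z.1 z.2)) u =
        ∫ z, Kᶜ.indicator (fun z => stft g (toDistribution y) z.1 z.2) z *
          ofSchwartz u (gaborAtom g z.1 z.2) := by
  let := normedAddCommGroup (p := p) (q := q) (s := s) hg
  have hinv := stft_inversion g (toDistribution y) u
  have hcompl : (fun z : Rn d × Rn d =>
      Kᶜ.indicator (fun z => stft g (toDistribution y) z.1 z.2) z *
        ofSchwartz u (gaborAtom g z.1 z.2)) = Kᶜ.indicator fun z =>
          stft g (toDistribution y) z.1 z.2 * ofSchwartz u (gaborAtom g z.1 z.2) := by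
    funext z
    by_cases hz : z ∈ Kᶜ
    · simp only [Set.indicator_of_mem hz]
    · simp only [Set.indicator_of_notMem hz, zero_mul]
  rw [hcompl, integral_indicator hK.measurableSet.compl, ← evalCLM_apply hg, map_sub, map_smul,
    evalCLM_setIntegral_gaborAtom hg hpt hqt hK (continuous_stft g (toDistribution y)),
    evalCLM_apply, smul_eq_mul, ← hinv.2, ← integral_add_compl hK.measurableSet hinv.1,
    add_sub_cancel_left]

theorem tendsto_mixedNorm_indicator_compl_closedBall (hpt : p ≠ ⊤) (hqt : q ≠ ⊤)
    (y : ModulationSpace g p q s) :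
    Filter.Tendsto (fun n : ℕ => mixedNorm volume volume p q fun x ξ => ‖polyWeight s x ξ •
      (Metric.closedBall 0 (n : ℝ))ᶜ.indicator
        (fun z => stft g (toDistribution y) z.1 z.2) (x, ξ)‖ₑ) Filter.atTop (𝓝 0) := by
  refine tendsto_mixedNorm_zero (zero_lt_one.trans_le hp.out).ne' hpt
    (zero_lt_one.trans_le hq.out).ne' hqt
    (v := fun x ξ => ‖polyWeight s x ξ • stft g (toDistribution y) x ξ‖ₑ) (fun n => ?_)
    (continuous_weighted_stft g s _).enorm.measurable ?_ (fun n x ξ => ?_) fun x ξ => ?_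
  · exact ((continuous_polyWeight s).measurable.smul
      ((continuous_stft g (toDistribution y)).measurable.indicator
        measurableSet_closedBall.compl)).enorm
  · rw [← modNorm_eq_mixedNorm]
    exact (modNorm_lt_top y).ne
  · rw [enorm_smul, enorm_smul]
    gcongr
    exact enorm_indicator_le_enorm_self _ _
  · refine tendsto_const_nhds.congr' ?_
    filter_upwards [Filter.eventually_ge_atTop ⌈‖(x, ξ)‖⌉₊] with n hn
    have hmem : (x, ξ) ∈ Metric.closedBall (0 : Rn d × Rn d) n :=
      mem_closedBall_zero_iff.2 (Nat.ceil_le.1 hn)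
    simp [hmem]

theorem tendsto_setIntegral_stft_smul_gaborAtom (hg : g ≠ 0) (hpt : p ≠ ⊤) (hqt : q ≠ ⊤)
    (y : ModulationSpace g p q s) :
    letI := normedAddCommGroup (p := p) (q := q) (s := s) hg
    Filter.Tendsto (fun n : ℕ => ∫ z in Metric.closedBall (0 : Rn d × Rn d) n,
      stft g (toDistribution y) z.1 z.2 • schwartzCLM g p q s (gaborAtom g z.1 z.2))
        Filter.atTop (𝓝 ((inversionConst g : ℂ) • y)) := by
  let := normedAddCommGroup (p := p) (q := q) (s := s) hg
  rw [tendsto_iff_norm_sub_tendsto_zero]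
  simp_rw [norm_sub_rev _ ((inversionConst g : ℂ) • y)]
  have hlim := ENNReal.Tendsto.const_mul
    (tendsto_mixedNorm_indicator_compl_closedBall hpt hqt y)
    (Or.inr (lintegral_synthesisKernel_ne_top g s))
  rw [mul_zero] at hlim
  have hmod := tendsto_of_tendsto_of_tendsto_of_le_of_le tendsto_const_nhds hlim
    (fun _ => zero_le) fun n => modNorm_le_of_synthesis hp.out hpt hq.out hqt s
      ((continuous_stft g (toDistribution y)).measurable.indicator
        measurableSet_closedBall.compl)
      (toDistribution_sub_setIntegral_apply hg hpt hqt (isCompact_closedBall 0 _) y)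
  exact (ENNReal.tendsto_toReal ENNReal.zero_ne_top).comp hmod

theorem isResolution_gaborAtom (hg : g ≠ 0) (hpt : p ≠ ⊤) (hqt : q ≠ ⊤) :
    letI := normedAddCommGroup (p := p) (q := q) (s := s) hg
    IsResolution (B := ModulationSpace g p q s) (volume : Measure (Rn d × Rn d))
      (fun n => Metric.closedBall 0 n)
      (fun z => schwartzCLM g p q s (gaborAtom g z.1 z.2))
      (fun z => (inversionConst g : ℂ)⁻¹ • evalCLM hg (stftAtom g z.1 z.2)) := by
  let := normedAddCommGroup (p := p) (q := q) (s := s) hg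
  have hc : (inversionConst g : ℂ) ≠ 0 := by exact_mod_cast (inversionConst_pos hg).ne'
  refine ⟨fun n => isCompact_closedBall 0 _, continuous_schwartzCLM_gaborAtom g p q s,
    fun y => continuous_const.mul (continuous_stft g (toDistribution y)), fun y => ?_⟩
  have hlim := (tendsto_setIntegral_stft_smul_gaborAtom hg hpt hqt y).const_smul
    (inversionConst g : ℂ)⁻¹
  rw [inv_smul_smul₀ hc] at hlim
  refine hlim.congr fun n => ?_
  rw [← integral_smul]
  simp only [smul_apply, smul_assoc, evalCLM_apply]
  rfl

theorem trace_unique (hg : g ≠ 0) (hpt : p ≠ ⊤) (hqt : q ≠ ⊤)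
    {T : ModulationSpace g p q s →L[ℂ] ModulationSpace g p q s}
    {x₁ x₂ : ℕ → ModulationSpace g p q s →L[ℂ] ℂ} {y₁ y₂ : ℕ → ModulationSpace g p q s}
    (h₁ : IsNuclearRepresentation 1 T x₁ y₁) (h₂ : IsNuclearRepresentation 1 T x₂ y₂) :
    ∑' n, x₁ n (y₁ n) = ∑' n, x₂ n (y₂ n) :=
  letI := normedAddCommGroup (p := p) (q := q) (s := s) hg
  have := completeSpace (g := g) (p := p) (q := q) (s := s) hg hpt hqt
  have h := isResolution_gaborAtom (p := p) (q := q) (s := s) hg hpt hqt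
  tendsto_nhds_unique (h.tendsto_trace h₁) (h.tendsto_trace h₂)

theorem eq_zero_of_schwartzCLM (hg : g ≠ 0) (hpt : p ≠ ⊤) (hqt : q ≠ ⊤)
    {T : ModulationSpace g p q s →L[ℂ] ModulationSpace g p q s}
    (hT : ∀ u, T (schwartzCLM g p q s u) = 0) : T = 0 :=
  letI := normedAddCommGroup (p := p) (q := q) (s := s) hg
  have := completeSpace (g := g) (p := p) (q := q) (s := s) hg hpt hqt
  (isResolution_gaborAtom hg hpt hqt).eq_zero fun _ => hT _

end ModulationSpace

/-! ### Orthonormality of the Hermite functions -/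

theorem integrable_aeval_mul_exp_neg_sq_div_two (Q : Polynomial ℤ) :
    Integrable fun t : ℝ => Polynomial.aeval t Q * Real.exp (-(t ^ 2 / 2)) := by
  simp_rw [Polynomial.aeval_eq_sum_range, Finset.sum_mul]
  refine integrable_finsetSum _ fun k _ => ?_
  have hk := (integrable_rpow_mul_exp_neg_mul_sq (one_half_pos (α := ℝ))
    (neg_one_lt_zero.trans_le k.cast_nonneg)).const_mul (Q.coeff k : ℝ)
  refine hk.congr (ae_of_all _ fun t => ?_)
  simp only [Real.rpow_natCast, zsmul_eq_mul, mul_assoc]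
  congr 4
  ring

/-- The inner product of `P` and `Q` in `L²` of the Gaussian weight `exp (-t²/2)`. -/
def hermiteInner (P Q : Polynomial ℤ) : ℝ :=
  ∫ t : ℝ, Polynomial.aeval t (P * Q) * Real.exp (-(t ^ 2 / 2))

theorem hermiteInner_comm (P Q : Polynomial ℤ) : hermiteInner P Q = hermiteInner Q P := by
  rw [hermiteInner, hermiteInner, mul_comm]

theorem hermiteInner_zero_right (P : Polynomial ℤ) : hermiteInner P 0 = 0 := by
  simp [hermiteInner]

theorem hermiteInner_natCast_mul_right (P Q : Polynomial ℤ) (n : ℕ) :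
    hermiteInner P (n * Q) = n * hermiteInner P Q := by
  rw [hermiteInner, hermiteInner, ← integral_const_mul]
  simp only [map_mul, map_natCast]
  congr 1 with t
  ring

theorem hasDerivAt_hermite_mul_exp_neg_sq_div_two (m : ℕ) (t : ℝ) :
    HasDerivAt (fun t => Polynomial.aeval t (Polynomial.hermite m) * Real.exp (-(t ^ 2 / 2)))
      (-(Polynomial.aeval t (Polynomial.hermite (m + 1)) * Real.exp (-(t ^ 2 / 2)))) t := by
  have hexp : HasDerivAt (fun t : ℝ => Real.exp (-(t ^ 2 / 2)))
      (Real.exp (-(t ^ 2 / 2)) * -t) t :=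
    (((hasDerivAt_pow 2 t).div_const 2).neg.congr_deriv (by ring)).exp
  refine (((Polynomial.hermite m).hasDerivAt_aeval t).mul hexp).congr_deriv ?_
  rw [Polynomial.hermite_succ, map_sub, map_mul, Polynomial.aeval_X]
  ring

theorem hermiteInner_hermite_succ (m : ℕ) (Q : Polynomial ℤ) :
    hermiteInner (Polynomial.hermite (m + 1)) Q =
      hermiteInner (Polynomial.hermite m) (Polynomial.derivative Q) := by
  have hint : ∀ P R : Polynomial ℤ, Integrable fun t : ℝ =>
      Polynomial.aeval t R * (Polynomial.aeval t P * Real.exp (-(t ^ 2 / 2))) := fun P R =>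
    (integrable_aeval_mul_exp_neg_sq_div_two (P * R)).congr (ae_of_all _ fun t => by
      simp only [map_mul]; ring)
  have hparts := integral_mul_deriv_eq_deriv_mul_of_integrable
    (fun t _ => Q.hasDerivAt_aeval t)
    (fun t _ => hasDerivAt_hermite_mul_exp_neg_sq_div_two m t)
    ((hint (Polynomial.hermite (m + 1)) Q).neg.congr (ae_of_all _ fun t => by
      simp only [Pi.mul_apply, Pi.neg_apply]; ring))
    (hint _ _) (hint _ _)
  simp only [mul_neg, integral_neg, neg_inj] at hparts
  simpa only [hermiteInner, map_mul, mul_comm, mul_left_comm, mul_assoc] using hparts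

theorem hermiteInner_hermite (m n : ℕ) :
    hermiteInner (Polynomial.hermite m) (Polynomial.hermite n) =
      if m = n then n ! * √(2 * Real.pi) else 0 := by
  induction m generalizing n with
  | zero =>
    cases n with
    | zero =>
      have hgauss := integral_gaussian (1 / 2)
      rw [div_div_eq_mul_div, div_one, mul_comm] at hgauss
      simpa [hermiteInner, neg_div, div_eq_inv_mul] using hgauss
    | succ n =>
      rw [hermiteInner_comm, hermiteInner_hermite_succ]
      simp [hermiteInner_zero_right]
  | succ m ih =>
    rw [hermiteInner_hermite_succ]
    cases n with
    | zero => simp [hermiteInner_zero_right]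
    | succ n =>
      rw [derivative_hermite_succ, ← Nat.cast_add_one, hermiteInner_natCast_mul_right, ih,
        Nat.factorial_succ]
      simp only [add_left_inj, mul_ite, mul_zero, Nat.cast_mul, mul_assoc]

theorem integral_normHermite_mul (m n : ℕ) :
    ∫ t : ℝ, normHermite m t * Real.exp (-(t ^ 2 / 2)) *
      (normHermite n t * Real.exp (-(t ^ 2 / 2))) = if m = n then 1 else 0 := by
  let F : ℝ → ℝ := fun t => Polynomial.aeval t (Polynomial.hermite m * Polynomial.hermite n) *
    Real.exp (-(t ^ 2 / 2))
  have hF : ∀ t : ℝ, normHermite m t * Real.exp (-(t ^ 2 / 2)) *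
      (normHermite n t * Real.exp (-(t ^ 2 / 2))) =
        (√(m ! * √Real.pi))⁻¹ * (√(n ! * √Real.pi))⁻¹ * F (√2 * t) := by
    intro t
    have hexp : Real.exp (-((√2 * t) ^ 2 / 2)) =
        Real.exp (-(t ^ 2 / 2)) * Real.exp (-(t ^ 2 / 2)) := by
      rw [← Real.exp_add, mul_pow, Real.sq_sqrt zero_le_two]
      congr 1
      ring
    simp only [F, hexp, normHermite, map_mul]
    ring
  have hint : ∫ t, F t = hermiteInner (Polynomial.hermite m) (Polynomial.hermite n) := rfl
  simp_rw [hF]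
  rw [integral_const_mul, Measure.integral_comp_mul_left, hint, hermiteInner_hermite, abs_inv,
    abs_of_nonneg (Real.sqrt_nonneg 2), smul_eq_mul]
  split_ifs with hmn
  · subst hmn
    rw [← mul_inv, Real.mul_self_sqrt (by positivity), Real.sqrt_mul zero_le_two]
    field_simp
  · simp

theorem hermiteDistribution_hermiteFunction (α β : Fin d → ℕ) :
    hermiteDistribution α (hermiteFunction β) = if α = β then 1 else 0 := by
  let F : Fin d → ℝ → ℝ := fun i t => normHermite (β i) t * Real.exp (-(t ^ 2 / 2)) *
    (normHermite (α i) t * Real.exp (-(t ^ 2 / 2)))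
  have hF : ∀ y : Rn d, hermiteFunction β y * hermiteFunction α y =
      ((∏ i, F i (y i) : ℝ) : ℂ) := by
    intro y
    rw [hermiteFunction_apply, hermiteFunction_apply, ← Complex.ofReal_mul,
      ← Finset.prod_mul_distrib]
  have hfubini : ∫ y : Rn d, ∏ i, F i (y i) = ∏ i, ∫ t, F i t :=
    ((EuclideanSpace.volume_preserving_symm_measurableEquiv_toLp (Fin d)).integral_comp'
      fun y : Fin d → ℝ => ∏ i, F i (y i)).trans (integral_fintype_prod_volume_eq_prod F)
  change ofSchwartz (hermiteFunction α) (hermiteFunction β) = _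
  rw [ofSchwartz_apply]
  simp_rw [hF]
  rw [integral_complex_ofReal, hfubini]
  simp only [F, integral_normHermite_mul]
  split_ifs with hαβ
  · simp [hαβ]
  · obtain ⟨i, hi⟩ := Function.ne_iff.1 hαβ
    rw [Finset.prod_eq_zero (Finset.mem_univ i) (if_neg hi.symm), Complex.ofReal_zero]

theorem conjSchwartz_hermiteFunction (α : Fin d → ℕ) :
    conjSchwartz (hermiteFunction α) = hermiteFunction α := by
  ext y
  rw [conjSchwartz_apply, hermiteFunction_apply, Complex.conj_ofReal]

/-! ### Totality of the Hermite functions -/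

theorem X_mul_hermite (n : ℕ) : Polynomial.X * Polynomial.hermite n =
    Polynomial.hermite (n + 1) + (n : Polynomial ℤ) * Polynomial.hermite (n - 1) := by
  rw [Polynomial.hermite_succ]
  cases n with
  | zero => simp
  | succ n =>
    rw [derivative_hermite_succ, Nat.add_sub_cancel]
    push_cast
    ring

theorem exists_mul_normHermite (n : ℕ) : ∃ a b : ℝ, ∀ t,
    t * normHermite n t = a * normHermite (n + 1) t + b * normHermite (n - 1) t := by
  let c : ℕ → ℝ := fun k => (√(k ! * √Real.pi))⁻¹
  have hc : ∀ k, c k ≠ 0 := fun k => by positivity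
  refine ⟨c n / √2 / c (n + 1), c n / √2 * n / c (n - 1), fun t => ?_⟩
  have hrec := congrArg (Polynomial.aeval (√2 * t)) (X_mul_hermite n)
  simp only [map_mul, map_add, Polynomial.aeval_X, map_natCast] at hrec
  simp only [normHermite, ← mul_assoc]
  change t * c n * _ = c n / √2 / c (n + 1) * c (n + 1) * _ + _ / c (n - 1) * c (n - 1) * _
  rw [div_mul_cancel₀ _ (hc _), div_mul_cancel₀ _ (hc _), mul_assoc (c n / √2), ← mul_add, ← hrec]
  field_simp

theorem hermiteFunction_update_apply (α : Fin d → ℕ) (i : Fin d) (n : ℕ) (y : Rn d) :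
    hermiteFunction (Function.update α i n) y =
      ((normHermite n (y i) * Real.exp (-((y i) ^ 2 / 2)) *
        ∏ j ∈ Finset.univ.erase i, (normHermite (α j) (y j) * Real.exp (-((y j) ^ 2 / 2))) : ℝ) :
          ℂ) := by
  rw [hermiteFunction_apply, ← Finset.mul_prod_erase _ _ (Finset.mem_univ i),
    Function.update_self]
  congr 2
  refine Finset.prod_congr rfl fun j hj => ?_
  rw [Function.update_of_ne (Finset.ne_of_mem_erase hj)]

theorem exists_coord_mul_hermiteFunction (α : Fin d → ℕ) (i : Fin d) : ∃ a b : ℂ, ∀ y : Rn d,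
    (y i : ℂ) * hermiteFunction α y =
      a * hermiteFunction (Function.update α i (α i + 1)) y +
      b * hermiteFunction (Function.update α i (α i - 1)) y := by
  obtain ⟨a, b, hab⟩ := exists_mul_normHermite (α i)
  refine ⟨a, b, fun y => ?_⟩
  have hα := hermiteFunction_update_apply α i (α i) y
  rw [Function.update_eq_self] at hα
  rw [hα, hermiteFunction_update_apply, hermiteFunction_update_apply]
  norm_cast
  linear_combination (Real.exp (-((y i) ^ 2 / 2)) *
    ∏ j ∈ Finset.univ.erase i, (normHermite (α j) (y j) * Real.exp (-((y j) ^ 2 / 2)))) * hab (y i)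

/-- The linear span of the Hermite functions, i.e. the polynomials times the Gaussian. -/
def hermiteSpan (d : ℕ) : Submodule ℂ 𝓢(Rn d, ℂ) := Submodule.span ℂ (Set.range hermiteFunction)

theorem hermiteFunction_mem_hermiteSpan (α : Fin d → ℕ) : hermiteFunction α ∈ hermiteSpan d :=
  Submodule.subset_span ⟨α, rfl⟩

theorem smulLeftCLM_hermiteFunction_mem_hermiteSpan (l : Rn d →L[ℝ] ℂ) (α : Fin d → ℕ) :
    SchwartzMap.smulLeftCLM ℂ (fun y => l y) (hermiteFunction α) ∈ hermiteSpan d := by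
  choose a b hab using fun i => exists_coord_mul_hermiteFunction α i
  have hexpand : SchwartzMap.smulLeftCLM ℂ (fun y => l y) (hermiteFunction α) =
      ∑ i, l (EuclideanSpace.basisFun (Fin d) ℝ i) •
        (a i • hermiteFunction (Function.update α i (α i + 1)) +
        b i • hermiteFunction (Function.update α i (α i - 1))) := by
    ext y
    have hy : l y = ∑ i, (y i : ℂ) * l (EuclideanSpace.basisFun (Fin d) ℝ i) := by
      conv_lhs => rw [← (EuclideanSpace.basisFun (Fin d) ℝ).sum_repr y]
      simp [map_sum]
    rw [SchwartzMap.smulLeftCLM_apply_apply l.hasTemperateGrowth, sum_apply, hy, Finset.sum_smul]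
    refine Finset.sum_congr rfl fun i _ => ?_
    simp only [smul_apply, add_apply, smul_eq_mul]
    rw [← hab]
    ring
  rw [hexpand]
  exact Submodule.sum_mem _ fun i _ => Submodule.smul_mem _ _ <| Submodule.add_mem _
    (Submodule.smul_mem _ _ (hermiteFunction_mem_hermiteSpan _))
    (Submodule.smul_mem _ _ (hermiteFunction_mem_hermiteSpan _))

theorem smulLeftCLM_mem_hermiteSpan (l : Rn d →L[ℝ] ℂ) {u : 𝓢(Rn d, ℂ)} (hu : u ∈ hermiteSpan d) :
    SchwartzMap.smulLeftCLM ℂ (fun y => l y) u ∈ hermiteSpan d := by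
  have hle : hermiteSpan d ≤ (hermiteSpan d).comap
      (SchwartzMap.smulLeftCLM ℂ (fun y => l y)).toLinearMap :=
    Submodule.span_le.2 <| Set.range_subset_iff.2 <|
      smulLeftCLM_hermiteFunction_mem_hermiteSpan l
  exact hle hu

theorem hermiteFunction_zero_apply (y : Rn d) : hermiteFunction (0 : Fin d → ℕ) y =
    ((((Real.sqrt (Real.sqrt Real.pi))⁻¹) ^ d : ℝ) : ℂ) *
      ((Real.exp (-(‖y‖ ^ 2 / 2)) : ℝ) : ℂ) := by
  rw [hermiteFunction_apply, ← Complex.ofReal_mul, Finset.prod_mul_distrib, ← Real.exp_sum,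
    Finset.sum_neg_distrib, ← Finset.sum_div, EuclideanSpace.norm_sq_eq]
  simp [normHermite]

theorem hermiteFunction_ne_zero (α : Fin d → ℕ) : hermiteFunction α ≠ 0 := by
  intro h
  have hα := hermiteDistribution_hermiteFunction α α
  rw [h, map_zero, if_pos rfl] at hα
  exact zero_ne_one hα

section ExponentialSeries

variable {E : Type*} [NormedAddCommGroup E] [NormedSpace ℝ E]

theorem fderiv_pow_succ_div_factorial (l : E →L[ℝ] ℂ) (n : ℕ) :
    fderiv ℝ (fun y => l y ^ (n + 1) / ((n + 1)! : ℂ)) =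
      fun y => (ContinuousLinearMap.mul ℝ ℂ (l y ^ n / (n ! : ℂ))).comp l := by
  funext y
  have hderiv : HasFDerivAt (fun y : E => l y ^ (n + 1) / ((n + 1)! : ℂ)) _ y :=
    ((l.hasFDerivAt (x := y)).pow (n + 1)).mul_const (((n + 1)! : ℂ)⁻¹)
  rw [hderiv.fderiv]
  ext v
  have hn : (n ! : ℂ) ≠ 0 := by exact_mod_cast n.factorial_ne_zero
  have hn' : (n + 1 : ℂ) ≠ 0 := by exact_mod_cast n.succ_ne_zero
  simp only [Nat.factorial_succ, Nat.cast_mul, Nat.cast_add, Nat.cast_one, mul_inv_rev,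
    add_tsub_cancel_right, nsmul_eq_mul, smul_apply, smul_eq_mul,
    ContinuousLinearMap.comp_apply, ContinuousLinearMap.mul_apply']
  field_simp

theorem norm_iteratedFDeriv_mul_comp_le (l : E →L[ℝ] ℂ) {f : E → ℂ} (hf : ContDiff ℝ ∞ f)
    (i : ℕ) (y : E) :
    ‖iteratedFDeriv ℝ i (fun y => (ContinuousLinearMap.mul ℝ ℂ (f y)).comp l) y‖ ≤
      ‖l‖ * ‖iteratedFDeriv ℝ i f y‖ := by
  let L : ℂ →L[ℝ] (E →L[ℝ] ℂ) :=
    ((ContinuousLinearMap.compL ℝ E ℂ ℂ).flip l).comp (ContinuousLinearMap.mul ℝ ℂ)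
  have hL : ‖L‖ ≤ ‖l‖ := by
    refine ContinuousLinearMap.opNorm_le_bound _ (norm_nonneg _) fun c => ?_
    refine ContinuousLinearMap.opNorm_le_bound _ (by positivity) fun v => ?_
    change ‖c * l v‖ ≤ _
    rw [norm_mul, mul_comm ‖l‖, mul_assoc]
    gcongr
    exact l.le_opNorm v
  refine (L.norm_iteratedFDeriv_comp_left hf.contDiffAt (mod_cast le_top)).trans ?_
  gcongr

theorem norm_iteratedFDeriv_pow_div_factorial_le (l : E →L[ℝ] ℂ) (i n : ℕ) (y : E) :
    ‖iteratedFDeriv ℝ i (fun y => l y ^ n / (n ! : ℂ)) y‖ ≤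
      (2 * ‖l‖) ^ i * ((1 / 2) ^ n * Real.exp (2 * ‖l‖ * ‖y‖)) := by
  induction i generalizing n with
  | zero =>
    rw [norm_iteratedFDeriv_zero, pow_zero, one_mul, norm_div, norm_pow, Complex.norm_natCast]
    calc ‖l y‖ ^ n / (n ! : ℝ) ≤ (‖l‖ * ‖y‖) ^ n / (n ! : ℝ) := by gcongr; exact l.le_opNorm y
      _ = (1 / 2) ^ n * ((2 * ‖l‖ * ‖y‖) ^ n / (n ! : ℝ)) := by
        rw [mul_assoc 2, mul_pow 2, one_div, inv_pow]; field_simp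
      _ ≤ _ := by gcongr; exact Real.pow_div_factorial_le_exp _ (by positivity) n
  | succ i ih =>
    cases n with
    | zero =>
      simp only [pow_zero, Nat.factorial_zero, Nat.cast_one, div_one]
      rw [iteratedFDeriv_const_of_ne (Nat.succ_ne_zero i), Pi.zero_apply, norm_zero]
      positivity
    | succ n =>
      rw [← norm_iteratedFDeriv_fderiv, fderiv_pow_succ_div_factorial]
      calc _ ≤ ‖l‖ * ‖iteratedFDeriv ℝ i (fun y => l y ^ n / (n ! : ℂ)) y‖ :=
            norm_iteratedFDeriv_mul_comp_le l ((l.contDiff.pow n).div_const _) i y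
        _ ≤ ‖l‖ * ((2 * ‖l‖) ^ i * ((1 / 2) ^ n * Real.exp (2 * ‖l‖ * ‖y‖))) := by
            gcongr; exact ih n
        _ = _ := by ring

end ExponentialSeries

theorem norm_iteratedFDeriv_exp_le {E : Type*} [NormedAddCommGroup E] [NormedSpace ℝ E]
    {f : E → ℝ} (hf : Function.HasTemperateGrowth f) (n : ℕ) :
    ∃ (m : ℕ) (C : ℝ), 0 ≤ C ∧ ∀ x, ‖iteratedFDeriv ℝ n (fun x => Real.exp (f x)) x‖ ≤
      C * (1 + ‖x‖) ^ m * Real.exp (f x) := by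
  obtain ⟨m, C, hC, hb⟩ := hf.norm_iteratedFDeriv_le_uniform n
  refine ⟨m * n, n ! * (1 + C) ^ n, by positivity, fun x => ?_⟩
  have hf' : ∀ i, 1 ≤ i → i ≤ n → ‖iteratedFDeriv ℝ i f x‖ ≤ ((1 + C) * (1 + ‖x‖) ^ m) ^ i := by
    intro i hi hin
    have hone : 1 ≤ (1 + C) * (1 + ‖x‖) ^ m :=
      one_le_mul_of_one_le_of_one_le (by linarith)
        (one_le_pow₀ (le_add_of_nonneg_right (norm_nonneg x)))
    calc _ ≤ C * (1 + ‖x‖) ^ m := hb i hin x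
      _ ≤ (1 + C) * (1 + ‖x‖) ^ m := by gcongr; linarith
      _ ≤ ((1 + C) * (1 + ‖x‖) ^ m) ^ i := le_self_pow₀ hone (by omega)
  have hexp : ∀ i ≤ n, ‖iteratedFDeriv ℝ i Real.exp (f x)‖ ≤ Real.exp (f x) := fun i _ => by
    rw [norm_iteratedFDeriv_eq_norm_iteratedDeriv, iteratedDeriv_eq_iterate,
      Real.iter_deriv_exp, Real.norm_of_nonneg (Real.exp_pos _).le]
  refine (norm_iteratedFDeriv_comp_le (N := ∞) Real.contDiff_exp hf.1
    (by exact_mod_cast le_top) x hexp hf').trans_eq ?_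
  rw [mul_pow, pow_mul]
  ring

theorem one_add_pow_mul_exp_mul_exp_neg_sq_le (N : ℕ) (a : ℝ) {t : ℝ} (ht : 0 ≤ t) :
    (1 + t) ^ N * (Real.exp (a * t) * Real.exp (-(t ^ 2 / 2))) ≤
      N ! * Real.exp (1 + (a + 1) ^ 2 / 2) := by
  have hpow := Real.pow_div_factorial_le_exp (1 + t) (by positivity) N
  rw [div_le_iff₀ (by positivity)] at hpow
  calc _ ≤ (Real.exp (1 + t) * N !) * (Real.exp (a * t) * Real.exp (-(t ^ 2 / 2))) := by
        gcongr
    _ = N ! * Real.exp (1 + t + (a * t + -(t ^ 2 / 2))) := by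
        rw [Real.exp_add (1 + t), Real.exp_add (a * t)]; ring
    _ ≤ _ := by
        refine mul_le_mul_of_nonneg_left (Real.exp_le_exp.2 ?_) (by positivity)
        nlinarith [sq_nonneg (t - (a + 1))]

theorem exists_exp_mul_gaussian_bound {E : Type*} [NormedAddCommGroup E] [InnerProductSpace ℝ E]
    (k n : ℕ) (a : ℝ) : ∃ C : ℝ, ∀ x : E, ‖x‖ ^ k * (Real.exp (a * ‖x‖) *
      ‖iteratedFDeriv ℝ n (fun x : E => Real.exp (-(‖x‖ ^ 2 / 2))) x‖) ≤ C := by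
  have htemp : Function.HasTemperateGrowth (fun x : E => -(‖x‖ ^ 2 / 2)) := by
    have : Function.HasTemperateGrowth (fun x : E => (-(1 / 2) : ℝ) * ‖x‖ ^ 2) := by fun_prop
    convert this using 2
    ring
  obtain ⟨m, C, hC, hb⟩ := norm_iteratedFDeriv_exp_le htemp n
  refine ⟨C * ((k + m)! * Real.exp (1 + (a + 1) ^ 2 / 2)), fun x => ?_⟩
  calc _ ≤ (1 + ‖x‖) ^ k * (Real.exp (a * ‖x‖) *
        (C * (1 + ‖x‖) ^ m * Real.exp (-(‖x‖ ^ 2 / 2)))) := by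
        gcongr
        · exact le_add_of_nonneg_left zero_le_one
        · exact hb x
    _ = C * ((1 + ‖x‖) ^ (k + m) * (Real.exp (a * ‖x‖) * Real.exp (-(‖x‖ ^ 2 / 2)))) := by ring
    _ ≤ _ := mul_le_mul_of_nonneg_left
        (one_add_pow_mul_exp_mul_exp_neg_sq_le _ a (norm_nonneg x)) hC

theorem exists_exp_mul_hermiteFunction_zero_bound (k n : ℕ) (a : ℝ) : ∃ C : ℝ, ∀ x : Rn d,
    ‖x‖ ^ k * (Real.exp (a * ‖x‖) *
      ‖iteratedFDeriv ℝ n (hermiteFunction (0 : Fin d → ℕ)) x‖) ≤ C := by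
  obtain ⟨C, hC⟩ := exists_exp_mul_gaussian_bound (E := Rn d) k n a
  let L : ℝ →L[ℝ] ℂ := ((((Real.sqrt (Real.sqrt Real.pi))⁻¹) ^ d : ℝ) : ℂ) • Complex.ofRealCLM
  have hfun : (hermiteFunction (0 : Fin d → ℕ) : Rn d → ℂ) =
      L ∘ fun x : Rn d => Real.exp (-(‖x‖ ^ 2 / 2)) :=
    funext hermiteFunction_zero_apply
  refine ⟨‖L‖ * C, fun x => ?_⟩
  rw [hfun]
  calc _ ≤ ‖x‖ ^ k * (Real.exp (a * ‖x‖) *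
        (‖L‖ * ‖iteratedFDeriv ℝ n (fun x : Rn d => Real.exp (-(‖x‖ ^ 2 / 2))) x‖)) := by
        gcongr
        exact L.norm_iteratedFDeriv_comp_left ((gaussian d).smooth ⊤).contDiffAt
          (mod_cast le_top)
    _ = ‖L‖ * (‖x‖ ^ k * (Real.exp (a * ‖x‖) *
        ‖iteratedFDeriv ℝ n (fun x : Rn d => Real.exp (-(‖x‖ ^ 2 / 2))) x‖)) := by ring
    _ ≤ _ := by gcongr; exact hC x

/-- The terms `lⁿ/n! φ₀` of the expansion of `exp(l) φ₀`. -/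
def expTerm (l : Rn d →L[ℝ] ℂ) (n : ℕ) : 𝓢(Rn d, ℂ) :=
  (n ! : ℂ)⁻¹ • (SchwartzMap.smulLeftCLM ℂ (fun y => l y))^[n] (hermiteFunction 0)

theorem expTerm_apply (l : Rn d →L[ℝ] ℂ) (n : ℕ) (y : Rn d) :
    expTerm l n y = l y ^ n / (n ! : ℂ) * hermiteFunction 0 y := by
  have hiter : (SchwartzMap.smulLeftCLM ℂ (fun y => l y))^[n] (hermiteFunction 0) y =
      l y ^ n * hermiteFunction 0 y := by
    induction n with
    | zero => simp
    | succ n ih =>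
      rw [Function.iterate_succ_apply', SchwartzMap.smulLeftCLM_apply_apply l.hasTemperateGrowth,
        ih, smul_eq_mul, pow_succ', mul_assoc]
  rw [expTerm, smul_apply, hiter, smul_eq_mul]
  ring

theorem expTerm_mem_hermiteSpan (l : Rn d →L[ℝ] ℂ) (n : ℕ) : expTerm l n ∈ hermiteSpan d := by
  refine Submodule.smul_mem _ _ ?_
  induction n with
  | zero => exact hermiteFunction_mem_hermiteSpan 0
  | succ n ih =>
    rw [Function.iterate_succ_apply']
    exact smulLeftCLM_mem_hermiteSpan l ih

theorem exists_seminorm_expTerm_le (l : Rn d →L[ℝ] ℂ) (k m : ℕ) :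
    ∃ C : ℝ, ∀ n, SchwartzMap.seminorm ℂ k m (expTerm l n) ≤ C * (1 / 2) ^ n := by
  choose C hC using fun j => exists_exp_mul_hermiteFunction_zero_bound (d := d) k j (2 * ‖l‖)
  have hC0 : ∀ j, 0 ≤ C j := fun j => le_trans (by positivity) (hC j 0)
  refine ⟨∑ i ∈ Finset.range (m + 1), m.choose i * (2 * ‖l‖) ^ i * C (m - i), fun n => ?_⟩
  refine SchwartzMap.seminorm_le_bound ℂ k m _ (mul_nonneg (Finset.sum_nonneg fun i _ =>
    mul_nonneg (by positivity) (hC0 _)) (by positivity)) fun x => ?_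
  have hsmooth : ContDiff ℝ ⊤ (fun y : Rn d => l y ^ n / (n ! : ℂ)) :=
    (l.contDiff.pow n).div_const _
  have hleibniz := norm_iteratedFDeriv_mul_le (hsmooth.of_le le_top)
    ((hermiteFunction (0 : Fin d → ℕ)).smooth ⊤) x (n := m) (mod_cast le_top)
  rw [show (expTerm l n : Rn d → ℂ) = _ from funext (expTerm_apply l n)]
  refine (mul_le_mul_of_nonneg_left hleibniz (by positivity)).trans ?_
  rw [Finset.mul_sum, Finset.sum_mul]
  refine Finset.sum_le_sum fun i _ => ?_
  calc _ ≤ ‖x‖ ^ k * ((m.choose i : ℝ) *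
        ((2 * ‖l‖) ^ i * ((1 / 2) ^ n * Real.exp (2 * ‖l‖ * ‖x‖))) *
          ‖iteratedFDeriv ℝ (m - i) (hermiteFunction (0 : Fin d → ℕ)) x‖) := by
        gcongr
        exact norm_iteratedFDeriv_pow_div_factorial_le l i n x
    _ = (m.choose i : ℝ) * (2 * ‖l‖) ^ i * (1 / 2) ^ n * (‖x‖ ^ k * (Real.exp (2 * ‖l‖ * ‖x‖) *
          ‖iteratedFDeriv ℝ (m - i) (hermiteFunction (0 : Fin d → ℕ)) x‖)) := by ring
    _ ≤ (m.choose i : ℝ) * (2 * ‖l‖) ^ i * (1 / 2) ^ n * C (m - i) := by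
        gcongr
        exact hC (m - i) x
    _ = _ := by ring

theorem schwartzIntegrable_expTerm (l : Rn d →L[ℝ] ℂ) :
    SchwartzIntegrable (expTerm l) Measure.count := by
  refine ⟨continuous_of_discreteTopology, fun P hP => ?_⟩
  obtain ⟨t, C, -, hC⟩ := Seminorm.bound_of_continuous (schwartz_withSeminorms ℂ (Rn d) ℂ) P hP
  choose D hD using fun i : ℕ × ℕ => exists_seminorm_expTerm_le l i.1 i.2
  rw [integrable_count_iff]
  have hsum : ∀ n, P (expTerm l n) ≤ C * ((∑ i ∈ t, D i) * (1 / 2) ^ n) := fun n => by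
    refine (hC _).trans (mul_le_mul_of_nonneg_left ?_ C.coe_nonneg)
    rw [Finset.sum_mul]
    refine (Seminorm.le_def.1 (Seminorm.finset_sup_le_sum _ t) _).trans ?_
    rw [sum_apply]
    exact Finset.sum_le_sum fun i _ => hD i n
  refine Summable.of_nonneg_of_le (fun n => norm_nonneg _) (fun n => ?_)
    ((summable_geometric_two.mul_left (∑ i ∈ t, D i)).mul_left (C : ℝ))
  rw [Real.norm_of_nonneg (apply_nonneg _ _)]
  exact hsum n

/-- The linear form `l` with `exp(l) φ₀ = exp(|x|²/2) M_{-ξ} T_x φ₀`: completing the square turns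
the generating function of the Hermite functions into a time-frequency shift of the Gaussian. -/
def shiftExponent (x ξ : Rn d) : Rn d →L[ℝ] ℂ :=
  Complex.ofRealCLM.comp (innerSL ℝ x) - Complex.I • Complex.ofRealCLM.comp (innerSL ℝ ξ)

theorem shiftExponent_apply (x ξ y : Rn d) :
    shiftExponent x ξ y = ((⟪x, y⟫_ℝ : ℝ) : ℂ) - Complex.I * ((⟪ξ, y⟫_ℝ : ℝ) : ℂ) := rfl

theorem exp_shiftExponent_mul_hermiteFunction_zero (x ξ y : Rn d) :
    Complex.exp (shiftExponent x ξ y) * hermiteFunction 0 y =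
      ((Real.exp (‖x‖ ^ 2 / 2) : ℝ) : ℂ) * stftAtom (hermiteFunction 0) x ξ y := by
  have hsquare : Complex.exp (shiftExponent x ξ y) * ((Real.exp (-(‖y‖ ^ 2 / 2)) : ℝ) : ℂ) =
      ((Real.exp (‖x‖ ^ 2 / 2) : ℝ) : ℂ) * (Complex.exp (-(Complex.I * ((⟪y, ξ⟫_ℝ : ℝ) : ℂ))) *
        ((Real.exp (-(‖y - x‖ ^ 2 / 2)) : ℝ) : ℂ)) := by
    rw [Complex.ofReal_exp, Complex.ofReal_exp, Complex.ofReal_exp, ← Complex.exp_add,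
      ← Complex.exp_add, ← Complex.exp_add, shiftExponent_apply, norm_sub_sq_real,
      real_inner_comm x y, real_inner_comm ξ y]
    congr 1
    push_cast
    ring
  rw [stftAtom_apply, hermiteFunction_zero_apply, hermiteFunction_zero_apply, map_mul,
    Complex.conj_ofReal, Complex.conj_ofReal]
  linear_combination ((((Real.sqrt (Real.sqrt Real.pi))⁻¹) ^ d : ℝ) : ℂ) * hsquare

theorem integral_expTerm_shiftExponent_apply (x ξ y : Rn d) :
    ∫ n, expTerm (shiftExponent x ξ) n y ∂Measure.count =
      (((Real.exp (‖x‖ ^ 2 / 2) : ℝ) : ℂ) • stftAtom (hermiteFunction 0) x ξ) y := by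
  rw [integral_countable ((schwartzIntegrable_expTerm _).integrable_eval y)]
  simp only [expTerm_apply, Measure.real, Measure.count_singleton, ENNReal.toReal_one, one_smul]
  rw [tsum_mul_right, (NormedSpace.expSeries_div_hasSum_exp (shiftExponent x ξ y)).tsum_eq,
    ← Complex.exp_eq_exp_ℂ, exp_shiftExponent_mul_hermiteFunction_zero, smul_apply, smul_eq_mul]

theorem eq_zero_of_hermiteFunction {f : 𝓢'(Rn d, ℂ)} (hf : ∀ α, f (hermiteFunction α) = 0) :
    f = 0 := by
  have hspan : hermiteSpan d ≤ LinearMap.ker f.toLinearMap :=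
    Submodule.span_le.2 (Set.range_subset_iff.2 hf)
  refine eq_zero_of_stft_eq_zero (hermiteFunction_ne_zero 0) fun x ξ => ?_
  have hseries := ((schwartzIntegrable_expTerm _).integrable_integral_apply
    (integral_expTerm_shiftExponent_apply x ξ) f).2
  have hzero : f (((Real.exp (‖x‖ ^ 2 / 2) : ℝ) : ℂ) • stftAtom (hermiteFunction 0) x ξ) = 0 :=
    hseries.symm.trans (integral_eq_zero_of_ae (ae_of_all _ fun n =>
      hspan (expTerm_mem_hermiteSpan _ n)))
  rw [map_smul, smul_eq_mul, mul_eq_zero] at hzero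
  exact hzero.resolve_left (by exact_mod_cast (Real.exp_pos _).ne')

/-! ### Functions of the harmonic oscillator -/

theorem eq_zero_of_ofSchwartz_eq_zero {u : 𝓢(Rn d, ℂ)} (hu : ofSchwartz u = 0) : u = 0 := by
  by_contra hne
  have hsq : ofSchwartz u (conjSchwartz u) = ((∫ y, ‖u y‖ ^ 2 : ℝ) : ℂ) := by
    simp only [ofSchwartz_apply, conjSchwartz_apply, ← integral_complex_ofReal,
      Complex.conj_mul', Complex.ofReal_pow]
  rw [hu] at hsq
  exact (integral_norm_sq_pos hne).ne (Complex.ofReal_injective hsq)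

theorem harmonicOscillator_hermiteDistribution_apply (α β : Fin d → ℕ) :
    harmonicOscillator (hermiteDistribution α) (hermiteFunction β) =
      (hermiteEigenvalue β : ℂ) * hermiteDistribution α (hermiteFunction β) := by
  rw [harmonicOscillator_hermiteDistribution]
  change (hermiteEigenvalue α : ℂ) * hermiteDistribution α (hermiteFunction β) = _
  rw [hermiteDistribution_hermiteFunction]
  split_ifs with h
  · rw [h]
  · rw [mul_zero, mul_zero]

/-- The orthogonality and the totality of the Hermite functions turn the eigenvalue equation for
the distributions `φ_α` into the one for the functions `φ_β`, without a second differentiation. -/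
theorem harmonicOscillator_apply_hermiteFunction (f : 𝓢'(Rn d, ℂ)) (β : Fin d → ℕ) :
    harmonicOscillator f (hermiteFunction β) =
      (hermiteEigenvalue β : ℂ) * f (hermiteFunction β) := by
  let A : 𝓢(Rn d, ℂ) := -Δ (hermiteFunction β) +
    SchwartzMap.smulLeftCLM ℂ (fun x : Rn d => ((‖x‖ ^ 2 : ℝ) : ℂ)) (hermiteFunction β)
  have hdual : ∀ f : 𝓢'(Rn d, ℂ), harmonicOscillator f (hermiteFunction β) = f A := fun f => by
    rw [map_add, map_neg, ← TemperedDistribution.laplacian_apply_apply,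
      ← TemperedDistribution.smulLeftCLM_apply_apply]
    rfl
  have hA : A - (hermiteEigenvalue β : ℂ) • hermiteFunction β = 0 := by
    refine eq_zero_of_ofSchwartz_eq_zero (eq_zero_of_hermiteFunction fun α => ?_)
    rw [ofSchwartz_comm, map_sub, map_smul, ← hdual, smul_eq_mul]
    exact sub_eq_zero.2 (harmonicOscillator_hermiteDistribution_apply α β)
  rw [hdual, sub_eq_zero.1 hA, map_smul, smul_eq_mul]

theorem summable_of_summable_rpow {ι : Type*} {a : ι → ℝ} (ha : ∀ i, 0 ≤ a i) {r : ℝ} (hr : 0 < r)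
    (hr1 : r ≤ 1) (h : Summable fun i => a i ^ r) : Summable a := by
  refine h.of_norm_bounded_eventually ?_
  filter_upwards [h.tendsto_cofinite_zero.eventually (gt_mem_nhds one_pos)] with i hi
  have hle : a i ≤ 1 := by
    by_contra! hlt
    exact (Real.one_le_rpow hlt.le hr.le).not_gt hi
  rw [Real.norm_of_nonneg (ha i)]
  exact Real.self_le_rpow_of_le_one (ha i) hle hr1

section Nuclear

variable {B₁ B₂ ι : Type*} [SeminormedAddCommGroup B₁] [NormedSpace ℂ B₁]
  [SeminormedAddCommGroup B₂] [NormedSpace ℂ B₂]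

theorem exists_hasSum_rank_one [CompleteSpace B₂] {x : ι → B₁ →L[ℂ] ℂ} {y : ι → B₂}
    (h : Summable fun i => ‖x i‖ * ‖y i‖) :
    ∃ T : B₁ →L[ℂ] B₂, ∀ z, HasSum (fun i => x i z • y i) (T z) := by
  have hsum : Summable fun i => (x i).smulRight (y i) := by
    refine Summable.of_norm ?_
    simpa only [ContinuousLinearMap.norm_smulRight_apply] using h
  obtain ⟨T, hT⟩ := hsum
  refine ⟨T, fun z => ?_⟩
  have hz := (ContinuousLinearMap.apply ℂ B₂ z).hasSum hT
  exact hz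

theorem IsNuclearRepresentation.extend {r : ℝ} (hr : r ≠ 0) {T : B₁ →L[ℂ] B₂}
    {x : ι → B₁ →L[ℂ] ℂ} {y : ι → B₂} (hs : Summable fun i => ‖x i‖ ^ r * ‖y i‖ ^ r)
    (hT : ∀ z, HasSum (fun i => x i z • y i) (T z)) {e : ι → ℕ} (he : Function.Injective e) :
    IsNuclearRepresentation r T (Function.extend e x 0) (Function.extend e y 0) := by
  have hx : ∀ n ∉ Set.range e, Function.extend e x 0 n = 0 := fun n hn =>
    Function.extend_apply' _ _ _ hn
  refine ⟨(he.summable_iff fun n hn => ?_).1 ?_, fun z => (he.hasSum_iff fun n hn => ?_).1 ?_⟩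
  · rw [hx n hn, norm_zero, Real.zero_rpow hr, zero_mul]
  · simpa only [Function.comp_def, he.extend_apply] using hs
  · rw [hx n hn, zero_apply, zero_smul]
  · simpa only [Function.comp_def, he.extend_apply] using hT z

theorem tsum_extend_apply_extend {x : ι → B₁ →L[ℂ] ℂ} {y : ι → B₁} {e : ι → ℕ}
    (he : Function.Injective e) :
    ∑' n, Function.extend e x 0 n (Function.extend e y 0 n) = ∑' i, x i (y i) := by
  rw [← he.tsum_eq]
  · simp only [he.extend_apply]
  · refine Function.support_subset_iff'.2 fun n hn => ?_
    rw [Function.extend_apply' _ _ _ hn, Pi.zero_apply, zero_apply]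

end Nuclear

namespace ModulationSpace

variable {g : 𝓢(Rn d, ℂ)} {p q : ℝ≥0∞} [hp : Fact (1 ≤ p)] [hq : Fact (1 ≤ q)] {s : ℝ}

theorem eq_of_hermiteFunction {f₁ f₂ : ModulationSpace g p q s}
    (h : ∀ β, toDistribution f₁ (hermiteFunction β) = toDistribution f₂ (hermiteFunction β)) :
    f₁ = f₂ :=
  toDistribution_injective (sub_eq_zero.1 (eq_zero_of_hermiteFunction fun β =>
    sub_eq_zero.2 (h β)))

theorem isFunctionOfOscillator_of_apply_hermiteFunction {F : ℝ → ℂ}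
    {T : ModulationSpace g p q s →L[ℂ] ModulationSpace g p q s}
    (hT : ∀ f β, toDistribution (T f) (hermiteFunction β) =
      F (hermiteEigenvalue β) * toDistribution f (hermiteFunction β)) :
    IsFunctionOfOscillator F T := by
  intro lam f hf
  refine eq_of_hermiteFunction fun β => ?_
  have heig := harmonicOscillator_apply_hermiteFunction (toDistribution f) β
  rw [hf] at heig
  change (lam : ℂ) * toDistribution f (hermiteFunction β) = _ at heig
  rw [hT, map_smul]
  change _ = F lam * toDistribution f (hermiteFunction β)
  rcases mul_eq_mul_right_iff.1 heig with hlam | hzero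
  · rw [Complex.ofReal_injective hlam]
  · rw [hzero, mul_zero, mul_zero]

theorem apply_hermiteFunction_of_isFunctionOfOscillator {F : ℝ → ℂ}
    {T : ModulationSpace g p q s →L[ℂ] ModulationSpace g p q s} (hT : IsFunctionOfOscillator F T)
    (α : Fin d → ℕ) : T (schwartzCLM g p q s (hermiteFunction α)) =
      F (hermiteEigenvalue α) • schwartzCLM g p q s (hermiteFunction α) :=
  hT _ _ (harmonicOscillator_hermiteDistribution α)

theorem eq_zero_of_schwartzCLM_hermiteFunction (hg : g ≠ 0) (hpt : p ≠ ⊤) (hqt : q ≠ ⊤)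
    {T : ModulationSpace g p q s →L[ℂ] ModulationSpace g p q s}
    (hT : ∀ α, T (schwartzCLM g p q s (hermiteFunction α)) = 0) : T = 0 := by
  refine eq_zero_of_schwartzCLM hg hpt hqt fun u => eq_of_hermiteFunction fun β => ?_
  let f : 𝓢'(Rn d, ℂ) := ContinuousLinearMap.toPointwiseConvergenceCLM _ _ _ _
    ((evalCLM hg (hermiteFunction β)).comp (T.comp (schwartzCLM g p q s)))
  have hf : f = 0 := eq_zero_of_hermiteFunction fun α => by
    change evalCLM hg (hermiteFunction β) (T (schwartzCLM g p q s (hermiteFunction α))) = 0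
    rw [hT, map_zero]
  exact DFunLike.congr_fun hf u

theorem isFunctionOfOscillator_unique (hg : g ≠ 0) (hpt : p ≠ ⊤) (hqt : q ≠ ⊤) {F : ℝ → ℂ}
    {T₁ T₂ : ModulationSpace g p q s →L[ℂ] ModulationSpace g p q s}
    (h₁ : IsFunctionOfOscillator F T₁) (h₂ : IsFunctionOfOscillator F T₂) : T₁ = T₂ :=
  sub_eq_zero.1 <| eq_zero_of_schwartzCLM_hermiteFunction hg hpt hqt fun α => by
    rw [sub_apply, apply_hermiteFunction_of_isFunctionOfOscillator h₁,
      apply_hermiteFunction_of_isFunctionOfOscillator h₂, sub_self]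

/-- The functionals `F(λ_α) ⟨·, φ_α⟩` of the Hermite expansion of `F(A)`. -/
def hermiteFunctional (hg : g ≠ 0) (F : ℝ → ℂ) (α : Fin d → ℕ) :
    ModulationSpace g p q s →L[ℂ] ℂ :=
  F (hermiteEigenvalue α) • evalCLM hg (hermiteFunction α)

theorem hermiteFunctional_apply (hg : g ≠ 0) (F : ℝ → ℂ) (α : Fin d → ℕ)
    (f : ModulationSpace g p q s) : hermiteFunctional hg F α f =
      F (hermiteEigenvalue α) * toDistribution f (hermiteFunction α) := rfl

theorem toDistribution_schwartzCLM_hermiteFunction (α β : Fin d → ℕ) :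
    toDistribution (schwartzCLM g p q s (hermiteFunction α)) (hermiteFunction β) =
      if α = β then 1 else 0 := by
  rw [toDistribution_schwartzCLM]
  exact hermiteDistribution_hermiteFunction α β

theorem hermiteFunctional_schwartzCLM (hg : g ≠ 0) (F : ℝ → ℂ) (α : Fin d → ℕ) :
    hermiteFunctional hg F α (schwartzCLM g p q s (hermiteFunction α)) =
      F (hermiteEigenvalue α) := by
  rw [hermiteFunctional_apply, toDistribution_schwartzCLM_hermiteFunction, if_pos rfl, mul_one]

theorem norm_hermiteFunctional_le (hg : g ≠ 0) (F : ℝ → ℂ) (α : Fin d → ℕ) :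
    ‖(hermiteFunctional hg F α : ModulationSpace g p q s →L[ℂ] ℂ)‖ ≤
      ‖F (hermiteEigenvalue α)‖ * ((inversionConst g)⁻¹ *
        (modNorm g p.conjExponent q.conjExponent (-s) (hermiteDistribution α)).toReal) := by
  have hdual : dualNorm g p q s (hermiteFunction α) =
      (modNorm g p.conjExponent q.conjExponent (-s) (hermiteDistribution α)).toReal := by
    rw [dualNorm, conjSchwartz_hermiteFunction]
    rfl
  rw [hermiteFunctional, norm_smul, ← hdual]
  exact mul_le_mul_of_nonneg_left (norm_evalCLM_le hg _) (norm_nonneg _)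

theorem summable_norm_hermiteFunctional (hg : g ≠ 0) {F : ℝ → ℂ} {r : ℝ} (hr : 0 < r)
    (h : hermiteSeries g p q s F r < ⊤) :
    Summable fun α : Fin d → ℕ =>
      ‖(hermiteFunctional hg F α : ModulationSpace g p q s →L[ℂ] ℂ)‖ ^ r *
        ‖schwartzCLM g p q s (hermiteFunction α)‖ ^ r := by
  have hc := (inv_pos.2 (inversionConst_pos hg)).le
  refine Summable.of_nonneg_of_le (fun α => by positivity) (fun α => ?_)
    ((ENNReal.summable_toReal h.ne).mul_left ((inversionConst g)⁻¹ ^ r))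
  simp only [ENNReal.toReal_mul, ← ENNReal.toReal_rpow, toReal_enorm]
  refine (mul_le_mul_of_nonneg_right (Real.rpow_le_rpow (norm_nonneg _)
    (norm_hermiteFunctional_le hg F α) hr.le) (by positivity)).trans_eq ?_
  rw [Real.mul_rpow (norm_nonneg _) (by positivity), Real.mul_rpow hc (by positivity),
    show ‖schwartzCLM g p q s (hermiteFunction α)‖ =
      (modNorm g p q s (hermiteDistribution α)).toReal from rfl]
  ring

theorem exists_hasSum_hermite (hg : g ≠ 0) (hpt : p ≠ ⊤) (hqt : q ≠ ⊤) {F : ℝ → ℂ}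
    (h : Summable fun α : Fin d → ℕ =>
      ‖(hermiteFunctional hg F α : ModulationSpace g p q s →L[ℂ] ℂ)‖ *
      ‖schwartzCLM g p q s (hermiteFunction α)‖) :
    ∃ T : ModulationSpace g p q s →L[ℂ] ModulationSpace g p q s, IsFunctionOfOscillator F T ∧
      ∀ f, HasSum (fun α => hermiteFunctional hg F α f • schwartzCLM g p q s (hermiteFunction α))
        (T f) := by
  have := completeSpace (g := g) (p := p) (q := q) (s := s) hg hpt hqt
  obtain ⟨T, hT⟩ := exists_hasSum_rank_one h
  refine ⟨T, isFunctionOfOscillator_of_apply_hermiteFunction fun f β => ?_, hT⟩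
  refine ((evalCLM hg (hermiteFunction β)).hasSum (hT f)).unique ?_
  simp only [map_smul, smul_eq_mul, evalCLM_apply, toDistribution_schwartzCLM_hermiteFunction,
    mul_ite, mul_one, mul_zero]
  convert hasSum_single β fun α hα => if_neg hα using 1
  rw [if_pos rfl, hermiteFunctional_apply]

theorem hasNuclearTrace_of_representation (hg : g ≠ 0) (hpt : p ≠ ⊤) (hqt : q ≠ ⊤)
    {T : ModulationSpace g p q s →L[ℂ] ModulationSpace g p q s}
    {x : ℕ → ModulationSpace g p q s →L[ℂ] ℂ} {y : ℕ → ModulationSpace g p q s}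
    (h : IsNuclearRepresentation 1 T x y) : HasNuclearTrace T (∑' n, x n (y n)) := by
  refine ⟨⟨x, y, h⟩, fun x' y' h' => ?_⟩
  rw [trace_unique hg hpt hqt h h']
  have hsum : Summable fun n => ‖x' n‖ * ‖y' n‖ := by simpa only [Real.rpow_one] using h'.1
  exact (hsum.of_norm_bounded fun n => (x' n).le_opNorm (y' n)).hasSum

theorem exists_hermite_representation (hg : g ≠ 0) (hpt : p ≠ ⊤) (hqt : q ≠ ⊤) {F : ℝ → ℂ} {r : ℝ}
    (hr : 0 < r) (hr1 : r ≤ 1) (h : hermiteSeries g p q s F r < ⊤) :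
    ∃ T : ModulationSpace g p q s →L[ℂ] ModulationSpace g p q s, IsFunctionOfOscillator F T ∧
      ∃ x y, IsNuclearRepresentation r T x y ∧
        ∑' n, x n (y n) = ∑' α : Fin d → ℕ, F (hermiteEigenvalue α) := by
  have hrpow := summable_norm_hermiteFunctional hg hr h
  obtain ⟨T, hT, hTsum⟩ := exists_hasSum_hermite hg hpt hqt
    (summable_of_summable_rpow (fun α => by positivity) hr hr1
      (by simpa only [Real.mul_rpow (norm_nonneg _) (norm_nonneg _)] using hrpow))
  obtain ⟨e, he⟩ := exists_injective_nat (Fin d → ℕ)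
  refine ⟨T, hT, _, _, IsNuclearRepresentation.extend hr.ne' hrpow hTsum he, ?_⟩
  simp_rw [tsum_extend_apply_extend he, hermiteFunctional_schwartzCLM]

theorem summable_norm_apply_hermiteEigenvalue (hg : g ≠ 0) {F : ℝ → ℂ}
    (h : hermiteSeries g p q s F 1 < ⊤) :
    Summable fun α : Fin d → ℕ => ‖F (hermiteEigenvalue α)‖ := by
  have hsum := summable_norm_hermiteFunctional hg one_pos h
  simp only [Real.rpow_one] at hsum
  refine hsum.of_nonneg_of_le (fun α => norm_nonneg _) fun α => ?_
  rw [← hermiteFunctional_schwartzCLM (p := p) (q := q) (s := s) hg F α]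
  exact ContinuousLinearMap.le_opNorm _ _

end ModulationSpace

end HarmonicModulation

end

theorem theorem2p5 (d : ℕ) (p q : ℝ≥0∞) [Fact (1 ≤ p)] [Fact (1 ≤ q)] (hp : p ≠ ⊤) (hq : q ≠ ⊤)
    (s : ℝ) (g : 𝓢(HarmonicModulation.Rn d, ℂ)) (hg : g ≠ 0) (F : ℝ → ℂ) :
    (∀ r : ℝ, 0 < r → r ≤ 1 → HarmonicModulation.hermiteSeries g p q s F r < ⊤ →
      (∃! T : HarmonicModulation.ModulationSpace g p q s →L[ℂ]
          HarmonicModulation.ModulationSpace g p q s,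
        HarmonicModulation.IsFunctionOfOscillator F T) ∧
      ∀ T : HarmonicModulation.ModulationSpace g p q s →L[ℂ]
          HarmonicModulation.ModulationSpace g p q s,
        HarmonicModulation.IsFunctionOfOscillator F T → HarmonicModulation.IsRNuclear r T) ∧
    (HarmonicModulation.hermiteSeries g p q s F 1 < ⊤ →
      Summable (fun α : Fin d → ℕ => ‖F (HarmonicModulation.hermiteEigenvalue α)‖) ∧
      ∀ T : HarmonicModulation.ModulationSpace g p q s →L[ℂ]
          HarmonicModulation.ModulationSpace g p q s,
        HarmonicModulation.IsFunctionOfOscillator F T →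
        HarmonicModulation.HasNuclearTrace T
          (∑' α : Fin d → ℕ, F (HarmonicModulation.hermiteEigenvalue α))) := by
  refine ⟨fun r hr hr1 h => ?_, fun h =>
    ⟨HarmonicModulation.ModulationSpace.summable_norm_apply_hermiteEigenvalue hg h,
      fun T hT => ?_⟩⟩
  · obtain ⟨T, hT, x, y, hxy, -⟩ :=
      HarmonicModulation.ModulationSpace.exists_hermite_representation hg hp hq hr hr1 h
    have hu : ∀ T', HarmonicModulation.IsFunctionOfOscillator F T' → T' = T := fun T' hT' =>
      HarmonicModulation.ModulationSpace.isFunctionOfOscillator_unique hg hp hq hT' hT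
    exact ⟨⟨T, hT, hu⟩, fun T' hT' => hu T' hT' ▸ ⟨x, y, hxy⟩⟩
  · obtain ⟨T', hT', x, y, hxy, ht⟩ :=
      HarmonicModulation.ModulationSpace.exists_hermite_representation hg hp hq one_pos le_rfl h
    rw [HarmonicModulation.ModulationSpace.isFunctionOfOscillator_unique hg hp hq hT hT', ← ht]
    exact HarmonicModulation.ModulationSpace.hasNuclearTrace_of_representation hg hp hq hxy
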